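/- Let $(N,J,g,\omega,\Omega)$ be a Calabi–Yau threefold: $(N,J)$ is a complex manifold of complex dimension $3$, $g$ is a Kähler metric with Kähler form $\omega=g(J\cdot,\cdot)$, and $\Omega$ is a holomorphic $(3,0)$-form of constant unit length, i.e. $\omega^3/3!=\tfrac{i}{8}\,\Omega\wedge\overline\Omega$. Let $M=N\times S^1$ carry the metric $g+dt^2$, the $3$-form $\phi=\omega\wedge dt+\Re\Omega$ and the vector product defined by $\langle u\times v,w\rangle=\phi(u,v,w)$. Let $L\subset N$ be a special Lagrangian submanifold (an embedded $3$-manifold, possibly with boundary, with $\omega|_{TL}=0$ and $\Im\Omega|_{TL}=0$), with the induced metric and the orientation for which $\Re\Omega|_{TL}$ is positive, and let $t_0\in S^1$ and $Y=L\times\{t_0\}\subset M$, with normal bundle $\nu$. Let $D$ be the operator $Ds=\sum_{i=1}^3 e_i\times\nabla^\perp_{e_i}s$ on $\Gamma(Y,\nu)$, where $(e_i)$ is an orthonormal frame of $TY$ and $\nabla^\perp$ is the connection on $\nu$ induced by the Levi-Civita connection of $M$. Write $\vee$ for the metric duality between $TL$ and $T^*L$, $*$ for the Hodge star of $L$, and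 $\pi_L,\pi_t$ for the components of $\nu=JTL\oplus\mathbb{R}\partial_t$. Then $(\alpha,\tau)\mapsto J\alpha^\vee+\tau\,\partial_t$ is a bijection from the smooth pairs $\Omega^1(L)\times\Omega^0(L)$ onto the smooth sections of $\nu$. Define $D^\vee(\alpha,\tau)=\big((-J\pi_L D(J\alpha^\vee+\tau\partial_t))^\vee,\ \pi_t D(J\alpha^\vee+\tau\partial_t)\big)$. For every smooth pair $(\alpha,\tau)$, the pair $D^\vee(\alpha,\tau)$ is smooth, it is the pair corresponding to $D(J\alpha^\vee+\tau\partial_t)$ under this bijection, and $$D^\vee(\alpha,\tau)=(-*d\alpha-d\tau,\ *d*\alpha),\qquad (D^\vee)^2(\alpha,\tau)=-\Delta(\alpha,\tau),$$ where $\Delta=d^*d+dd^*$ (which is $d^*d$ on $\tau$) with the sign convention $d^*=(-1)^{3p+1}*d*$ on $p$-forms. In terms of the codifferential $\delta=(-1)^{p}*d*$ on $p$-forms (the formal adjoint of $d$, so that $d^*=-\delta$), this says that $(D^\vee)^2=\delta d+d\delta$. -/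

import Mathlib

open Manifold ContDiff Set Module

noncomputable section

namespace SpecialLagrangianDirac

/-! ### Linear algebra -/

/-- The vector representing the linear form `l` with respect to the nondegenerate bilinear
form `b`: the vector `c` with `b c w = l w` for all `w`. -/
def dualVector {V : Type*} [AddCommGroup V] (b : V → V → ℝ) (l : V → ℝ) : V :=
  Classical.epsilon fun c => ∀ w, b c w = l w

section Star

variable {V : Type*} [NormedAddCommGroup V] [NormedSpace ℝ V]

/-- The form `μ(w₀, …, w_{k-1}, ·, …, ·)`. -/
def contract {m : ℕ} : (k : ℕ) → (V [⋀^Fin (m + k)]→L[ℝ] ℝ) → (Fin k → V) → V [⋀^Fin m]→L[ℝ] ℝ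
  | 0, μ, _ => μ
  | k + 1, μ, w => contract k (μ.curryLeft (w 0)) (Fin.tail w)

variable [FiniteDimensional ℝ V]

/-- The volume form `e¹ ∧ ⋯ ∧ eⁿ` of a basis `e`, equal to `1` on `(e₁, …, eₙ)`. -/
def volForm {n : ℕ} (e : Basis (Fin n) ℝ V) : V [⋀^Fin n]→L[ℝ] ℝ :=
  { e.det with
    cont := by
      change Continuous fun v : Fin n → V => e.det v
      simp only [Basis.det_apply]
      refine Continuous.matrix_det (continuous_matrix fun i j => ?_)
      exact (e.coord i).continuous_of_finiteDimensional.comp (continuous_apply j) }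

/-- The Hodge star on `k`-forms of the oriented Euclidean space for which `e` is a positively
oriented orthonormal basis:
`(*β)(v) = (1/k!) ∑ β(e_{i₁}, …, e_{iₖ}) vol(e_{i₁}, …, e_{iₖ}, v)`.
It satisfies `α ∧ *β = ⟨α, β⟩ vol`, e.g. `*e¹ = e² ∧ e³` in dimension three. -/
def hodgeStar {m k : ℕ} (e : Basis (Fin (m + k)) ℝ V) (β : V [⋀^Fin k]→L[ℝ] ℝ) :
    V [⋀^Fin m]→L[ℝ] ℝ :=
  ((k.factorial : ℝ)⁻¹) •
    ∑ i : Fin k → Fin (m + k), β (fun a => e (i a)) • contract k (volForm e) (fun a => e (i a))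

end Star

/-! ### Differential forms on manifolds -/

section Forms

variable {𝕜 : Type*} [NontriviallyNormedField 𝕜]
  {E : Type*} [NormedAddCommGroup E] [NormedSpace 𝕜 E]
  {H : Type*} [TopologicalSpace H] (I : ModelWithCorners 𝕜 E H)
  {M : Type*} [TopologicalSpace M] [ChartedSpace H M]
  {F : Type*} [NormedAddCommGroup F] [NormedSpace 𝕜 F]

variable (M F) in
/-- (Not necessarily smooth) `F`-valued differential `k`-forms on `M`. -/
abbrev DForm (k : ℕ) := ∀ x : M, (TangentSpace I x) [⋀^Fin k]→L[𝕜] F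

variable {I} {k : ℕ}

/-- The expression of a form in the preferred chart at `x₀`: its pullback under the inverse of
this chart. -/
def formInChart (α : DForm I M F k) (x₀ : M) (y : E) : E [⋀^Fin k]→L[𝕜] F :=
  (α ((extChartAt I x₀).symm y)).compContinuousLinearMap
    (mfderivWithin 𝓘(𝕜, E) I (extChartAt I x₀).symm (range I) y)

/-- A form which is smooth in charts. -/
def IsSmoothForm (α : DForm I M F k) : Prop :=
  ∀ x₀ : M, ContDiffOn 𝕜 ∞ (formInChart α x₀) (extChartAt I x₀).target

/-- The exterior derivative, computed at `x` in the preferred chart at `x` (in which the tangent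
space at `x` is identified with the model vector space `E`). -/
def extD (α : DForm I M F k) : DForm I M F (k + 1) := fun x =>
  (extDerivWithin (formInChart α x) (range I) (extChartAt I x x) : E [⋀^Fin (k + 1)]→L[𝕜] F)

end Forms

/-! ### The Levi-Civita connection along a map -/

section LeviCivita

variable {E : Type*} [NormedAddCommGroup E] [NormedSpace ℝ E]
  {H : Type*} [TopologicalSpace H] {J : ModelWithCorners ℝ E H}
  {M : Type*} [TopologicalSpace M] [ChartedSpace H M]
  {E' : Type*} [NormedAddCommGroup E'] [NormedSpace ℝ E']
  {H' : Type*} [TopologicalSpace H'] (I : ModelWithCorners ℝ E' H')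
  {L : Type*} [TopologicalSpace L] [ChartedSpace H' L]

/-- The coefficients `g_y(u, v)` of a metric in the preferred chart at `p`. -/
def metricInChart (g : ∀ q : M, TangentSpace J q → TangentSpace J q → ℝ) (p : M) (u v y : E) : ℝ :=
  g ((extChartAt J p).symm y)
    (mfderivWithin 𝓘(ℝ, E) J (extChartAt J p).symm (range J) y u)
    (mfderivWithin 𝓘(ℝ, E) J (extChartAt J p).symm (range J) y v)

/-- The derivative at `p` of the metric coefficient `g(u, v)` in the direction `w`, in the
preferred chart at `p`. -/
def dMetric (g : ∀ q : M, TangentSpace J q → TangentSpace J q → ℝ) (p : M) (w u v : E) : ℝ :=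
  fderivWithin ℝ (metricInChart g p u v) (range J) (extChartAt J p p) w

/-- The Christoffel symbol `Γ(u, v)` at `p` of the Levi-Civita connection of `g`, in the preferred
chart at `p`: `g(Γ(u, v), w) = (∂_u g(v, w) + ∂_v g(u, w) - ∂_w g(u, v)) / 2`. -/
def christoffel (g : ∀ q : M, TangentSpace J q → TangentSpace J q → ℝ) (p : M)
    (u v : TangentSpace J p) : TangentSpace J p :=
  dualVector (g p) fun w =>
    (dMetric g p u v w + dMetric g p v u w - dMetric g p w u v) / 2

/-- The Levi-Civita covariant derivative `∇_v s` at `x` of a vector field `s` of `M` along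
`ι : L → M`, in the direction of a tangent vector `v` of `L`. In the preferred chart at `ι x` it is
`ds(v) + Γ(dι(v), s)`. -/
def covDeriv (g : ∀ q : M, TangentSpace J q → TangentSpace J q → ℝ) (ι : L → M)
    (s : ∀ x, TangentSpace J (ι x)) (x : L) (v : TangentSpace I x) : TangentSpace J (ι x) :=
  let ds : TangentSpace J (ι x) :=
    (mfderiv I 𝓘(ℝ, E) (fun z => (mfderiv J 𝓘(ℝ, E) (extChartAt J (ι x)) (ι z) (s z) : E)) x v : E)
  ds + christoffel g (ι x) (mfderiv I J ι x v) (s x)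

end LeviCivita

/-! ### Calabi-Yau threefolds -/

/-- The model of complex threefolds. -/
abbrev C3 := EuclideanSpace ℂ (Fin 3)

/-- The model of three-manifolds. -/
abbrev R3 := EuclideanSpace ℝ (Fin 3)

/-- A complex threefold is a smooth (real) manifold. -/
instance isManifold_real (N : Type*) [TopologicalSpace N] [ChartedSpace C3 N]
    [IsManifold 𝓘(ℂ, C3) ω N] : IsManifold 𝓘(ℝ, C3) ∞ N := by
  refine isManifold_of_contDiffOn _ _ _ fun e e' he he' => ?_
  have h := (contDiffGroupoid ω 𝓘(ℂ, C3)).compatible he he'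
  rw [contDiffGroupoid, mem_groupoid_of_pregroupoid] at h
  exact (ContDiffOn.restrict_scalars ℝ h.1).of_le le_top

/-- The complex structure of the tangent spaces of a complex threefold: multiplication by `i` in
holomorphic charts. -/
def cplx {N : Type*} [TopologicalSpace N] [ChartedSpace C3 N] (x : N) :
    TangentSpace 𝓘(ℝ, C3) x →L[ℝ] TangentSpace 𝓘(ℝ, C3) x :=
  ((Complex.I • ContinuousLinearMap.id ℂ C3).restrictScalars ℝ : C3 →L[ℝ] C3)

/-- A Calabi-Yau structure on a complex threefold `N`: a Kähler metric `g` with Kähler form `kah`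
and a holomorphic volume form `hol` of constant unit length. -/
structure CalabiYau (N : Type*) [TopologicalSpace N] [ChartedSpace C3 N]
    [IsManifold 𝓘(ℂ, C3) ω N] where
  /-- The Riemannian metric. -/
  g : Bundle.ContMDiffRiemannianMetric 𝓘(ℝ, C3) ∞ C3 (fun x : N => TangentSpace 𝓘(ℝ, C3) x)
  /-- The metric is Hermitian. -/
  hermitian : ∀ x u v, g.inner x (cplx x u) (cplx x v) = g.inner x u v
  /-- The Kähler form. -/
  kah : DForm 𝓘(ℝ, C3) N ℝ 2
  kah_apply : ∀ x u v, kah x ![u, v] = g.inner x (cplx x u) v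
  kah_closed : ∀ x, extD kah x = 0
  /-- The holomorphic volume form, a complex multilinear alternating form. -/
  hol : DForm 𝓘(ℂ, C3) N ℂ 3
  hol_holomorphic : ∀ x₀ : N,
    DifferentiableOn ℂ (formInChart hol x₀) (extChartAt 𝓘(ℂ, C3) x₀).target
  /-- `|hol(u₁, u₂, u₃)| = 1` for every unitary basis; equivalently
  `kah³ / 3! = (i / 8) hol ∧ conj hol`. -/
  hol_unit : ∀ (x : N) (u : Fin 3 → TangentSpace 𝓘(ℝ, C3) x),
    (∀ i j, g.inner x (u i) (u j) = if i = j then 1 else 0) →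
    (∀ i j, kah x ![u i, u j] = 0) → ‖hol x u‖ = 1

/-! ### The circle -/

/-- The vector field `∂_t` on the circle: the velocity at `θ = 0` of `θ ↦ exp(iθ) z`. -/
def partialT (z : Circle) : TangentSpace (𝓡 1) z :=
  (mfderiv 𝓘(ℝ, ℝ) (𝓡 1) (fun θ : ℝ => Circle.exp θ * z) 0 (1 : ℝ) : EuclideanSpace ℝ (Fin 1))

/-- The `1`-form `dt` on the circle: a tangent vector `a` at `z`, seen as a complex number, equals
`i dt(a) z`. -/
def dt (z : Circle) (a : TangentSpace (𝓡 1) z) : ℝ :=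
  let c : ℂ := mfderiv (𝓡 1) 𝓘(ℝ, ℂ) (fun w : Circle => (w : ℂ)) z a
  (c * (starRingEnd ℂ) (z : ℂ)).im

/-! ### The product of a Calabi-Yau threefold with a circle -/

/-- The model with corners of `N × S¹`. -/
abbrev JM : ModelWithCorners ℝ (C3 × EuclideanSpace ℝ (Fin 1))
    (ModelProd C3 (EuclideanSpace ℝ (Fin 1))) :=
  𝓘(ℝ, C3).prod (𝓡 1)

/-- The slice `x ↦ (f x, t₀)`, parametrizing `L × {t₀}` in `N × S¹`. -/
def slice {N L : Type*} (f : L → N) (t₀ : Circle) (x : L) : N × Circle := (f x, t₀)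

namespace CalabiYau

variable {N : Type*} [TopologicalSpace N] [ChartedSpace C3 N] [IsManifold 𝓘(ℂ, C3) ω N]
  (X : CalabiYau N)

/-- The product metric `g + dt²` on `N × S¹`. -/
def gM (p : N × Circle) (v w : TangentSpace JM p) : ℝ :=
  X.g.inner p.1 v.1 w.1 + dt p.2 v.2 * dt p.2 w.2

/-- The `3`-form `φ = kah ∧ dt + Re hol` on `N × S¹`. -/
def phi (p : N × Circle) (u v w : TangentSpace JM p) : ℝ :=
  X.kah p.1 ![u.1, v.1] * dt p.2 w.2 + X.kah p.1 ![v.1, w.1] * dt p.2 u.2 +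
    X.kah p.1 ![w.1, u.1] * dt p.2 v.2 + (X.hol p.1 ![u.1, v.1, w.1]).re

/-- The vector product on `N × S¹`: `⟨u × v, w⟩ = φ(u, v, w)`. -/
def cross (p : N × Circle) (u v : TangentSpace JM p) : TangentSpace JM p :=
  dualVector (X.gM p) (X.phi p u v)

section Submanifold

variable {H : Type*} [TopologicalSpace H] (I : ModelWithCorners ℝ R3 H)
  {L : Type*} [TopologicalSpace L] [ChartedSpace H L] (f : L → N) (t₀ : Circle)

/-- `f` embeds the three-manifold `L` as a special Lagrangian submanifold: the Kähler form and
the imaginary part of the holomorphic volume form vanish on `L`. -/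
structure IsSpecialLagrangian : Prop where
  embedding : IsSmoothEmbedding I 𝓘(ℝ, C3) ∞ f
  kah_eq_zero : ∀ (x : L) (u v : TangentSpace I x),
    X.kah (f x) ![mfderiv I 𝓘(ℝ, C3) f x u, mfderiv I 𝓘(ℝ, C3) f x v] = 0
  im_hol_eq_zero : ∀ (x : L) (u v w : TangentSpace I x),
    (X.hol (f x) ![mfderiv I 𝓘(ℝ, C3) f x u, mfderiv I 𝓘(ℝ, C3) f x v,
      mfderiv I 𝓘(ℝ, C3) f x w]).im = 0

/-- The metric induced on `L`. -/
def metricL (x : L) (u v : TangentSpace I x) : ℝ :=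
  X.g.inner (f x) (mfderiv I 𝓘(ℝ, C3) f x u) (mfderiv I 𝓘(ℝ, C3) f x v)

/-- `e` is a choice, at every point `x` of `L`, of an orthonormal basis of the tangent space of
`L`, positive for the orientation of `L` defined by `Re hol`. Nothing is required on the dependence
on `x`, so that such a choice always exists on a special Lagrangian submanifold. -/
def IsOrientedOrthonormal (e : ∀ x : L, Basis (Fin 3) ℝ (TangentSpace I x)) : Prop :=
  ∀ x, (∀ i j, X.metricL I f x (e x i) (e x j) = if i = j then 1 else 0) ∧
    0 < (X.hol (f x) fun i => mfderiv I 𝓘(ℝ, C3) f x (e x i)).re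

variable (e : ∀ x : L, Basis (Fin 3) ℝ (TangentSpace I x))

/-! #### The operator `D` -/

/-- Orthogonal projection onto the fibre at `x` of the normal bundle of `L × {t₀}`. -/
def normalProj (x : L) (w : TangentSpace JM (slice f t₀ x)) : TangentSpace JM (slice f t₀ x) :=
  w - ∑ i, X.gM _ w (mfderiv I JM (slice f t₀) x (e x i)) • mfderiv I JM (slice f t₀) x (e x i)

/-- The operator `D s = ∑ᵢ eᵢ × ∇^⊥_{eᵢ} s` on sections of the normal bundle of `L × {t₀}`. -/
def opD (s : ∀ x : L, TangentSpace JM (slice f t₀ x)) (x : L) : TangentSpace JM (slice f t₀ x) :=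
  ∑ i, X.cross _ (mfderiv I JM (slice f t₀) x (e x i))
    (X.normalProj I f t₀ e x (covDeriv I X.gM (slice f t₀) s x (e x i)))

/-- Smooth sections of the normal bundle of `L × {t₀}`. -/
def IsNormalSection (s : ∀ x : L, TangentSpace JM (slice f t₀ x)) : Prop :=
  ContMDiff I JM.tangent ∞ (fun x => (⟨slice f t₀ x, s x⟩ : TangentBundle JM (N × Circle))) ∧
    ∀ (x : L) (v : TangentSpace I x), X.gM _ (s x) (mfderiv I JM (slice f t₀) x v) = 0

/-! #### Pairs of forms -/

/-- Pairs in `Ω¹(L) × Ω⁰(L)`, without smoothness. -/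
abbrev FormPair := DForm I L ℝ 1 × DForm I L ℝ 0

/-- The metric dual `α^∨` of a `1`-form on `L`. -/
def sharp (α : DForm I L ℝ 1) (x : L) : TangentSpace I x :=
  dualVector (X.metricL I f x) fun w => α x ![w]

/-- The section `Jα^∨ + τ ∂_t` of the normal bundle of `L × {t₀}`. -/
def toNormal (p : FormPair I (L := L)) (x : L) : TangentSpace JM (slice f t₀ x) :=
  (cplx (f x) (mfderiv I 𝓘(ℝ, C3) f x (X.sharp I f p.1 x)), p.2 x ![] • partialT t₀)

/-- The pair `((-J π_L s)^∨, π_t s)` of a section `s` of the normal bundle of `L × {t₀}`. -/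
def toForms (s : ∀ x : L, TangentSpace JM (slice f t₀ x)) : FormPair I (L := L) :=
  (fun x => ContinuousAlternatingMap.ofSubsingleton ℝ (TangentSpace I x) ℝ (0 : Fin 1)
      ((X.g.inner (f x) (-cplx (f x) (s x).1)).comp (mfderiv I 𝓘(ℝ, C3) f x)),
    fun x => ContinuousAlternatingMap.constOfIsEmpty ℝ (TangentSpace I x) (Fin 0) (dt t₀ (s x).2))

/-- The operator `D^∨(α, τ) = ((-J π_L D(Jα^∨, τ))^∨, π_t D(Jα^∨, τ))`. -/
def opDvee (p : FormPair I (L := L)) : FormPair I (L := L) :=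
  X.toForms I f t₀ (X.opD I f t₀ e (X.toNormal I f t₀ p))

end Submanifold

end CalabiYau

/-! ### Hodge theory on a three-manifold -/

section Hodge

variable {H : Type*} [TopologicalSpace H] {I : ModelWithCorners ℝ R3 H}
  {L : Type*} [TopologicalSpace L] [ChartedSpace H L]
  (e : ∀ x : L, Basis (Fin 3) ℝ (TangentSpace I x))

/-- The Hodge star `Ω¹ → Ω²` on a three-manifold with positive orthonormal bases `e x`. -/
def star₁ (α : DForm I L ℝ 1) : DForm I L ℝ 2 := fun x =>
  (hodgeStar (V := R3) (m := 2) (k := 1) (e x) (α x) : R3 [⋀^Fin 2]→L[ℝ] ℝ)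

/-- The Hodge star `Ω² → Ω¹`. -/
def star₂ (β : DForm I L ℝ 2) : DForm I L ℝ 1 := fun x =>
  (hodgeStar (V := R3) (m := 1) (k := 2) (e x) (β x) : R3 [⋀^Fin 1]→L[ℝ] ℝ)

/-- The Hodge star `Ω³ → Ω⁰`. -/
def star₃ (γ : DForm I L ℝ 3) : DForm I L ℝ 0 := fun x =>
  (hodgeStar (V := R3) (m := 0) (k := 3) (e x) (γ x) : R3 [⋀^Fin 0]→L[ℝ] ℝ)

/-- The operator `(-1)^(3p+1) * d *` on `p`-forms, for `p = 1`. -/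
def dStar₁ (α : DForm I L ℝ 1) : DForm I L ℝ 0 :=
  (-1 : ℝ) ^ (3 * 1 + 1) • star₃ e (extD (star₁ e α))

/-- The operator `(-1)^(3p+1) * d *` on `p`-forms, for `p = 2`. -/
def dStar₂ (β : DForm I L ℝ 2) : DForm I L ℝ 1 :=
  (-1 : ℝ) ^ (3 * 2 + 1) • star₂ e (extD (star₂ e β))

/-- The codifferential (formal adjoint of `d`), `(-1)^(n(p+1)+1) * d *` on `p`-forms of an
`n`-manifold, for `n = 3` and `p = 1`. -/
def codiff₁ (α : DForm I L ℝ 1) : DForm I L ℝ 0 :=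
  (-1 : ℝ) ^ (3 * (1 + 1) + 1) • star₃ e (extD (star₁ e α))

/-- The codifferential (formal adjoint of `d`), `(-1)^(n(p+1)+1) * d *` on `p`-forms of an
`n`-manifold, for `n = 3` and `p = 2`. -/
def codiff₂ (β : DForm I L ℝ 2) : DForm I L ℝ 1 :=
  (-1 : ℝ) ^ (3 * (2 + 1) + 1) • star₂ e (extD (star₂ e β))

/-- `Δ = d^* d + d d^*` on `Ω¹ × Ω⁰` with the convention `d^* = (-1)^(3p+1) * d *`. -/
def lap (p : CalabiYau.FormPair I (L := L)) : CalabiYau.FormPair I (L := L) :=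
  (dStar₂ e (extD p.1) + extD (dStar₁ e p.1), dStar₁ e (extD p.2))

/-- The (nonnegative) Hodge Laplacian `δ d + d δ` on `Ω¹ × Ω⁰`, for the codifferential `δ`. -/
def hodgeLap (p : CalabiYau.FormPair I (L := L)) : CalabiYau.FormPair I (L := L) :=
  (codiff₂ e (extD p.1) + extD (codiff₁ e p.1), codiff₁ e (extD p.2))

end Hodge

end SpecialLagrangianDirac
end

set_option linter.unusedSectionVars false

open Filter Topology

noncomputable section

namespace SpecialLagrangianDirac

/-! ### Smoothness of maps into spaces of alternating forms -/

section AlternatingSmooth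

variable {E G F : Type*} [NormedAddCommGroup E] [NormedSpace ℝ E]
  [NormedAddCommGroup G] [NormedSpace ℝ G]

/-! Since `L` is Lagrangian, an orthonormal basis `e_i` of `TL` is a unitary basis of `TN`, and `J
TL ⊕ ℝ∂_t` is the normal space; the condition on the phase and the orientation give `Ω(e_0, e_1,
e_2) = 1`. So `Ω` restricts to the volume form of `L`, and `*α = Re Ω(α^∨, ·, ·)`.

For a Kähler metric `J` is parallel, and the circle factor contributes nothing to the Christoffel
symbols in directions tangent to `N`. Hence the derivative of `Jα^∨ + τ∂_t` along `e_i` is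
`J∇_{e_i}α^∨ + dτ(e_i)∂_t` (`gMAt_covDeriv`), and its normal part involves only `dτ` and the matrix
`c_ij = ⟨∇_{e_i}α^∨, e_j⟩`. In `∑ φ(e_i, n_i, w)`, with `n_i` this normal part, `Re Ω` sees only the
antisymmetric part of `c`, while `ω ∧ dt` sees the trace of `c` and `dτ` (`opD_toNormal`).

It remains to identify the two parts of `c`. The antisymmetric part is `dα`, because `α = ⟨α^∨, df
·⟩` and the connection is metric and torsion free (`formAt_extD_one`). The trace is `*d*α`
(`formAt_extD_star₁`). Differentiating `Re Ω(α^∨, df ·, df ·)` produces derivatives of `Ω`; as there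
are no complex `4`-forms on `ℂ³`, they combine into the derivative of `Ω` along `α^∨`
(`alternating_holomorphic`). Because `|Ω| = 1`, its real part is half the trace of the derivative of
the metric (`norm_sq_eq_det_gram`, `fderiv_volume_eq`), which is the Christoffel contribution to the
trace of `c`. Only the ambient connection enters; that of `L` is never needed.

The formula for the square is then formal: `d² = 0` and `** = 1` remove the mixed terms. It does
require `*` to preserve smoothness, although the frame `e` may vary arbitrarily from point to point.
The frame enters only through the volume of the coordinate vectors, whose square is a smooth Gram
determinant and whose sign is locally constant because `Re Ω` is continuous
(`contDiffWithinAt_volChart`). -/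

theorem finiteDimensional_alternating [FiniteDimensional ℝ G] (k : ℕ) :
    FiniteDimensional ℝ (G [⋀^Fin k]→L[ℝ] ℝ) := by
  let b := Module.finBasis ℝ G
  let T : (G [⋀^Fin k]→L[ℝ] ℝ) →ₗ[ℝ] ((Fin k → Fin (finrank ℝ G)) → ℝ) :=
    { toFun := fun f i => f fun a => b (i a)
      map_add' := fun _ _ => rfl
      map_smul' := fun _ _ => rfl }
  refine Module.Finite.of_injective T fun f g h => ?_
  apply ContinuousAlternatingMap.toAlternatingMap_injective
  exact Module.Basis.ext_alternating b fun i _ => congrFun h i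

/-- Evaluation on basis vectors embeds the space of alternating forms linearly in a power of `ℝ`,
and a linear left inverse recovers the form from these values. -/
theorem contDiffWithinAt_alternating_iff [FiniteDimensional ℝ G] {k : ℕ} {n : WithTop ℕ∞}
    {η : E → G [⋀^Fin k]→L[ℝ] ℝ} {s : Set E} {y : E} :
    ContDiffWithinAt ℝ n η s y ↔ ∀ v, ContDiffWithinAt ℝ n (fun z => η z v) s y := by
  refine ⟨fun h v => ?_, fun h => ?_⟩
  · exact (ContinuousAlternatingMap.apply ℝ G ℝ v).contDiff.contDiffAt.comp_contDiffWithinAt y h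
  have := finiteDimensional_alternating (G := G) k
  let b := Module.finBasis ℝ G
  let T : (G [⋀^Fin k]→L[ℝ] ℝ) →ₗ[ℝ] ((Fin k → Fin (finrank ℝ G)) → ℝ) :=
    { toFun := fun f i => f fun a => b (i a)
      map_add' := fun _ _ => rfl
      map_smul' := fun _ _ => rfl }
  have hT : LinearMap.ker T = ⊥ := LinearMap.ker_eq_bot.2 fun f g h => by
    apply ContinuousAlternatingMap.toAlternatingMap_injective
    exact Module.Basis.ext_alternating b fun i _ => congrFun h i
  obtain ⟨S, hS⟩ := T.exists_leftInverse_of_injective hT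
  have key : η = fun z => LinearMap.toContinuousLinearMap S (T (η z)) := by
    funext z
    exact (LinearMap.congr_fun hS (η z)).symm
  rw [key]
  refine (LinearMap.toContinuousLinearMap S).contDiff.contDiffAt.comp_contDiffWithinAt y ?_
  exact contDiffWithinAt_pi.2 fun i => h _

end AlternatingSmooth

/-! ### Derivatives of charts -/

section Charts

variable {𝕜 : Type*} [NontriviallyNormedField 𝕜]
  {E : Type*} [NormedAddCommGroup E] [NormedSpace 𝕜 E]
  {H : Type*} [TopologicalSpace H] (I : ModelWithCorners 𝕜 E H)
  {M : Type*} [TopologicalSpace M] [ChartedSpace H M]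
  {F : Type*} [NormedAddCommGroup F] [NormedSpace 𝕜 F]
  {E' : Type*} [NormedAddCommGroup E'] [NormedSpace 𝕜 E']
  {H' : Type*} [TopologicalSpace H'] (I' : ModelWithCorners 𝕜 E' H')
  {M' : Type*} [TopologicalSpace M'] [ChartedSpace H' M']

/-- The derivative of the inverse of the preferred chart at `x₀`, in terms of the model space. -/
def symmD (x₀ : M) (y : E) : E →L[𝕜] E :=
  mfderivWithin 𝓘(𝕜, E) I (extChartAt I x₀).symm (range I) y

/-- The derivative of the preferred chart at `x₀`, in terms of the model space. -/
def chartD (x₀ z : M) : E →L[𝕜] E := mfderiv I 𝓘(𝕜, E) (extChartAt I x₀) z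

variable {I I'}

theorem formInChart_apply {k : ℕ} (α : DForm I M F k) (x₀ : M) (y : E) (v : Fin k → E) :
    formInChart α x₀ y v = (α ((extChartAt I x₀).symm y)) fun i => symmD I x₀ y (v i) := rfl

theorem chartD_self [IsManifold I 1 M] (x : M) : chartD I x x = ContinuousLinearMap.id 𝕜 E :=
  mfderiv_extChartAt_self

theorem symmD_self [IsManifold I 1 M] (x : M) :
    symmD I x (extChartAt I x x) = ContinuousLinearMap.id 𝕜 E :=
  mfderivWithin_range_extChartAt_symm

theorem chartD_symmD [IsManifold I 1 M] {x₀ : M} {y : E} (hy : y ∈ (extChartAt I x₀).target)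
    (v : E) : chartD I x₀ ((extChartAt I x₀).symm y) (symmD I x₀ y v) = v :=
  congrArg (fun A : E →L[𝕜] E => A v)
    (mfderiv_extChartAt_comp_mfderivWithin_extChartAt_symm (I := I) hy)

theorem symmD_chartD [IsManifold I 1 M] {x₀ : M} {y : E} (hy : y ∈ (extChartAt I x₀).target)
    (v : E) : symmD I x₀ y (chartD I x₀ ((extChartAt I x₀).symm y) v) = v :=
  congrArg (fun A : E →L[𝕜] E => A v)
    (mfderivWithin_extChartAt_symm_comp_mfderiv_extChartAt (I := I) hy)

theorem formInChart_self [IsManifold I 1 M] {k : ℕ} (α : DForm I M F k) (x : M) :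
    formInChart α x (extChartAt I x x) = (α x : E [⋀^Fin k]→L[𝕜] F) := by
  ext v
  rw [formInChart_apply, symmD_self]
  have : (extChartAt I x).symm (extChartAt I x x) = x := extChartAt_to_inv x
  have key : ∀ z (_ : z = x) , (α z : E [⋀^Fin k]→L[𝕜] F) v = (α x : E [⋀^Fin k]→L[𝕜] F) v := by
    rintro z rfl; rfl
  exact key _ this

/-- The expression of a map `f` in the preferred charts at `x₀` and `p`. -/
def inCharts (I : ModelWithCorners 𝕜 E H) (I' : ModelWithCorners 𝕜 E' H') (f : M → M')
    (x₀ : M) (p : M') (y : E) : E' :=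
  extChartAt I' p (f ((extChartAt I x₀).symm y))

/-- The chain rule for chart ∘ `f` ∘ inverse chart, solved for the derivative of `f`. With `f = id`
it is the change of coordinates; with an immersion it converts `df` on coordinate vectors into the
ordinary derivative of the local expression of `f`. -/
theorem mfderiv_symmD [IsManifold I 1 M] [IsManifold I' 1 M'] {f : M → M'} {x₀ : M} {p : M'}
    {y : E} (hy : y ∈ (extChartAt I x₀).target)
    (hf : MDifferentiableAt I I' f ((extChartAt I x₀).symm y))
    (hp : f ((extChartAt I x₀).symm y) ∈ (extChartAt I' p).source) (v : E) :
    (mfderiv I I' f ((extChartAt I x₀).symm y) (symmD I x₀ y v) : E') =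
      symmD I' p (inCharts I I' f x₀ p y) (fderivWithin 𝕜 (inCharts I I' f x₀ p) (range I) y v) := by
  have hu : UniqueMDiffWithinAt 𝓘(𝕜, E) (range I) y :=
    (I.uniqueDiffOn y (extChartAt_target_subset_range x₀ hy)).uniqueMDiffWithinAt
  have h1 : MDifferentiableWithinAt 𝓘(𝕜, E) I (extChartAt I x₀).symm (range I) y :=
    mdifferentiableWithinAt_extChartAt_symm hy
  have hp' : f ((extChartAt I x₀).symm y) ∈ (chartAt H' p).source := by
    rwa [← extChartAt_source I']
  have h2 : MDifferentiableAt I' 𝓘(𝕜, E') (extChartAt I' p) (f ((extChartAt I x₀).symm y)) :=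
    mdifferentiableAt_extChartAt hp'
  have h3 := mfderiv_comp_mfderivWithin (I := 𝓘(𝕜, E)) (I' := I) (I'' := I') y hf h1 hu
  have h5 : MDifferentiableWithinAt 𝓘(𝕜, E) I' (f ∘ (extChartAt I x₀).symm) (range I) y :=
    hf.comp_mdifferentiableWithinAt y h1
  have h4 := mfderiv_comp_mfderivWithin (I := 𝓘(𝕜, E)) (I' := I') (I'' := 𝓘(𝕜, E')) y h2 h5 hu
  rw [mfderivWithin_eq_fderivWithin] at h4
  have h6 : (fderivWithin 𝕜 (inCharts I I' f x₀ p) (range I) y v : E') =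
      chartD I' p (f ((extChartAt I x₀).symm y))
        (mfderiv I I' f ((extChartAt I x₀).symm y) (symmD I x₀ y v) : E') := by
    have := congrArg (fun A : E →L[𝕜] E' => A v) h4
    refine this.trans ?_
    have := congrArg (fun A : E →L[𝕜] E' => A v) h3
    exact congrArg (fun w : E' => chartD I' p (f ((extChartAt I x₀).symm y)) w) this
  rw [h6]
  have h7 : inCharts I I' f x₀ p y ∈ (extChartAt I' p).target := (extChartAt I' p).map_source hp
  have h8 := symmD_chartD h7 (mfderiv I I' f ((extChartAt I x₀).symm y) (symmD I x₀ y v) : E')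
  have h9 : (extChartAt I' p).symm (inCharts I I' f x₀ p y) = f ((extChartAt I x₀).symm y) :=
    (extChartAt I' p).left_inv hp
  rw [h9] at h8
  exact h8.symm

theorem contDiffWithinAt_inCharts {n : WithTop ℕ∞} [IsManifold I n M] [IsManifold I' n M']
    {f : M → M'} {x₀ : M} {p : M'}
    {y : E} (hy : y ∈ (extChartAt I x₀).target)
    (hf : ContMDiffAt I I' n f ((extChartAt I x₀).symm y))
    (hp : f ((extChartAt I x₀).symm y) ∈ (extChartAt I' p).source) :
    ContDiffWithinAt 𝕜 n (inCharts I I' f x₀ p) (range I) y := by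
  have h := ((contMDiffAt_iff_of_mem_source (I := I) (I' := I') (x := x₀) (y := p)
    (by rw [← extChartAt_source I]; exact (extChartAt I x₀).map_target hy)
    (by rwa [← extChartAt_source I'])).1 hf).2
  rwa [(extChartAt I x₀).right_inv hy] at h

end Charts

/-! ### Smooth forms and the exterior derivative -/

theorem minSmoothness_two_le : minSmoothness ℝ 2 ≤ (∞ : WithTop ℕ∞) := by
  rw [minSmoothness_of_isRCLikeNormedField]
  exact WithTop.coe_le_coe.2 (le_top : (2 : ℕ∞) ≤ ⊤)

section FormsReal

variable {E : Type*} [NormedAddCommGroup E] [NormedSpace ℝ E]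
  {H : Type*} [TopologicalSpace H] {I : ModelWithCorners ℝ E H}
  {M : Type*} [TopologicalSpace M] [ChartedSpace H M]
  {F : Type*} [NormedAddCommGroup F] [NormedSpace ℝ F] {k : ℕ}

/-- The target of a chart need not be open in `E`, but it is a neighbourhood of each of its points
within `range I`. Working within `range I` gives one set with unique derivatives for all charts, the
set on which `extD` is computed. -/
theorem isSmoothForm_iff {α : DForm I M F k} :
    IsSmoothForm α ↔ ∀ x₀ : M, ∀ y ∈ (extChartAt I x₀).target,
      ContDiffWithinAt ℝ ∞ (formInChart α x₀) (range I) y := by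
  refine forall_congr' fun x₀ => forall₂_congr fun y hy => ?_
  refine ⟨fun h => h.mono_of_mem_nhdsWithin (extChartAt_target_mem_nhdsWithin_of_mem hy),
    fun h => h.mono (extChartAt_target_subset_range x₀)⟩

theorem IsSmoothForm.add {α β : DForm I M F k} (hα : IsSmoothForm α) (hβ : IsSmoothForm β) :
    IsSmoothForm (α + β) := fun x₀ => by
  have : formInChart (α + β) x₀ = formInChart α x₀ + formInChart β x₀ := rfl
  rw [this]
  exact (hα x₀).add (hβ x₀)

theorem IsSmoothForm.smul {α : DForm I M F k} (c : ℝ) (hα : IsSmoothForm α) :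
    IsSmoothForm (c • α) := fun x₀ => by
  have : formInChart (c • α) x₀ = c • formInChart α x₀ := rfl
  rw [this]
  exact (hα x₀).const_smul c

theorem IsSmoothForm.neg {α : DForm I M F k} (hα : IsSmoothForm α) : IsSmoothForm (-α) := by
  have := hα.smul (-1)
  rwa [neg_one_smul] at this

theorem IsSmoothForm.sub {α β : DForm I M F k} (hα : IsSmoothForm α) (hβ : IsSmoothForm β) :
    IsSmoothForm (α - β) := by
  rw [sub_eq_add_neg]; exact hα.add hβ.neg

theorem IsSmoothForm.contDiffWithinAt {α : DForm I M F k} (hα : IsSmoothForm α) (x : M) :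
    ContDiffWithinAt ℝ ∞ (formInChart α x) (range I) (extChartAt I x x) :=
  isSmoothForm_iff.1 hα x _ (mem_extChartAt_target x)

theorem extD_smul (c : ℝ) (α : DForm I M F k) : extD (c • α) = c • extD α := by
  funext x
  exact extDerivWithin_smul c (formInChart α x) (I.uniqueDiffOn _ (mem_range_self _))

theorem extD_neg (α : DForm I M F k) : extD (-α) = -extD α := by
  rw [← neg_one_smul ℝ, extD_smul, neg_one_smul]

theorem extD_add {α β : DForm I M F k} (hα : IsSmoothForm α) (hβ : IsSmoothForm β) :
    extD (α + β) = extD α + extD β := by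
  funext x
  exact extDerivWithin_add (I.uniqueDiffOn _ (mem_range_self _))
    ((hα.contDiffWithinAt x).differentiableWithinAt (by simp))
    ((hβ.contDiffWithinAt x).differentiableWithinAt (by simp))

theorem extD_sub {α β : DForm I M F k} (hα : IsSmoothForm α) (hβ : IsSmoothForm β) :
    extD (α - β) = extD α - extD β := by
  rw [sub_eq_add_neg, extD_add hα hβ.neg, extD_neg, sub_eq_add_neg]

variable [IsManifold I ∞ M]

/-- Change of charts for differential forms. -/
theorem formInChart_eq_pullback (α : DForm I M F k) {x₀ x₁ : M} {y : E}
    (hy : y ∈ (extChartAt I x₀).target)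
    (h1 : (extChartAt I x₀).symm y ∈ (extChartAt I x₁).source) :
    formInChart α x₀ y = (formInChart α x₁ (inCharts I I id x₀ x₁ y)).compContinuousLinearMap
      (fderivWithin ℝ (inCharts I I id x₀ x₁) (range I) y) := by
  have : IsManifold I 1 M := IsManifold.of_le (n := ∞) (by simp)
  ext v
  have h2 : (extChartAt I x₁).symm (inCharts I I id x₀ x₁ y) = (extChartAt I x₀).symm y :=
    (extChartAt I x₁).left_inv h1
  rw [ContinuousAlternatingMap.compContinuousLinearMap_apply, formInChart_apply, formInChart_apply]
  have h3 : ∀ w : E, symmD I x₀ y w = symmD I x₁ (inCharts I I id x₀ x₁ y)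
      (fderivWithin ℝ (inCharts I I id x₀ x₁) (range I) y w) := fun w => by
    rw [← mfderiv_symmD hy mdifferentiableAt_id h1 w, mfderiv_id]
    rfl
  have key : ∀ z (_ : z = (extChartAt I x₀).symm y) (u : Fin k → E),
      (α z : E [⋀^Fin k]→L[ℝ] F) u = (α ((extChartAt I x₀).symm y) : E [⋀^Fin k]→L[ℝ] F) u := by
    rintro z rfl u; rfl
  refine Eq.trans ?_ (key _ h2 _).symm
  congr 1
  funext i
  exact h3 (v i)

/-- The exterior derivative can be computed in any chart. -/
theorem formInChart_extD {α : DForm I M F k} (hα : IsSmoothForm α) {x₀ : M} {y : E}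
    (hy : y ∈ (extChartAt I x₀).target) :
    formInChart (extD α) x₀ y = extDerivWithin (formInChart α x₀) (range I) y := by
  have : IsManifold I 1 M := IsManifold.of_le (n := ∞) (by simp)
  -- At this point `extD` is computed in the chart centred at `z`. The local forms in the two charts
  -- are pullbacks of one another under the transition map, and pullback commutes with the exterior
  -- derivative.
  set z := (extChartAt I x₀).symm y with hz
  have hyr : y ∈ range I := extChartAt_target_subset_range x₀ hy
  have hT : ContDiffWithinAt ℝ ∞ (inCharts I I id x₀ z) (range I) y :=
    contDiffWithinAt_inCharts hy contMDiffAt_id (mem_extChartAt_source z)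
  have hev : formInChart α x₀ =ᶠ[𝓝[range I] y] fun y' =>
      (formInChart α z (inCharts I I id x₀ z y')).compContinuousLinearMap
        (fderivWithin ℝ (inCharts I I id x₀ z) (range I) y') := by
    have hc : ContinuousWithinAt (extChartAt I x₀).symm (range I) y := by
      have := continuousAt_extChartAt_symm'' (I := I) (x := x₀) hy
      exact this.continuousWithinAt
    filter_upwards [extChartAt_target_mem_nhdsWithin_of_mem hy,
      hc.preimage_mem_nhdsWithin (extChartAt_source_mem_nhds (I := I) z)] with y' h1 h2
    exact formInChart_eq_pullback α h1 h2
  rw [hev.extDerivWithin_eq_of_mem hyr]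
  have hTy : inCharts I I id x₀ z y = extChartAt I z z := rfl
  rw [extDerivWithin_pullback (t := range I) (r := ∞)
    (by rw [hTy]; exact (hα.contDiffWithinAt z).differentiableWithinAt (by simp)) hT
    minSmoothness_two_le I.uniqueDiffOn (I.range_subset_closure_interior hyr) hyr
    (fun y' _ => by simp [inCharts, extChartAt])]
  ext v
  rw [formInChart_apply, ContinuousAlternatingMap.compContinuousLinearMap_apply]
  -- A chart has identity derivative at its own centre, so at `y` the transition map has the same
  -- derivative as the inverse chart at `x₀`.
  have h3 : ∀ w : E, symmD I x₀ y w =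
      (fderivWithin ℝ (inCharts I I id x₀ z) (range I) y w) := fun w => by
    have := mfderiv_symmD (I := I) (I' := I) (f := id) (p := z) hy mdifferentiableAt_id
      (mem_extChartAt_source z) w
    rw [mfderiv_id] at this
    refine this.trans ?_
    rw [hTy, symmD_self]
    rfl
  have : (fun i => symmD I x₀ y (v i)) =
      (fderivWithin ℝ (inCharts I I id x₀ z) (range I) y) ∘ v := funext fun i => h3 (v i)
  rw [this]
  rfl

theorem contDiffWithinAt_extDerivWithin {E F : Type*} [NormedAddCommGroup E] [NormedSpace ℝ E]
    [NormedAddCommGroup F] [NormedSpace ℝ F] {k : ℕ} {η : E → E [⋀^Fin k]→L[ℝ] F} {s : Set E}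
    {y : E} (h : ContDiffWithinAt ℝ ∞ η s y) (hs : UniqueDiffOn ℝ s) (hy : y ∈ s) :
    ContDiffWithinAt ℝ ∞ (extDerivWithin η s) s y := by
  have h1 : ContDiffWithinAt ℝ ∞ (fderivWithin ℝ η s) s y :=
    h.fderivWithin_right hs (by simp) hy
  exact (ContinuousAlternatingMap.alternatizeUncurryFinCLM ℝ E F).contDiff.contDiffAt
    |>.comp_contDiffWithinAt y h1

theorem IsSmoothForm.extD {α : DForm I M F k} (hα : IsSmoothForm α) : IsSmoothForm (extD α) := by
  refine isSmoothForm_iff.2 fun x₀ y hy => ?_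
  have hyr : y ∈ range I := extChartAt_target_subset_range x₀ hy
  refine (contDiffWithinAt_extDerivWithin (isSmoothForm_iff.1 hα x₀ y hy) I.uniqueDiffOn
    hyr).congr_of_eventuallyEq_of_mem ?_ hyr
  filter_upwards [extChartAt_target_mem_nhdsWithin_of_mem hy] with y' h'
  exact formInChart_extD hα h'

/-- The chart defining `extD` changes with the point. `formInChart_extD` replaces it near `x` by the
derivative of a single local form, to which the Euclidean `d² = 0` applies, at boundary points as
well because they lie in the closure of the interior of the range. -/
theorem extD_extD {α : DForm I M F k} (hα : IsSmoothForm α) :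
    SpecialLagrangianDirac.extD (SpecialLagrangianDirac.extD α) = 0 := by
  funext x
  have hev : formInChart (SpecialLagrangianDirac.extD α) x =ᶠ[𝓝[range I] (extChartAt I x x)]
      extDerivWithin (formInChart α x) (range I) := by
    filter_upwards [extChartAt_target_mem_nhdsWithin x] with y' h'
    exact formInChart_extD hα h'
  exact (hev.extDerivWithin_eq_of_mem (mem_range_self _)).trans
    (extDerivWithin_extDerivWithin_apply (hα.contDiffWithinAt x) minSmoothness_two_le I.uniqueDiffOn
      (I.range_subset_closure_interior (mem_range_self _)) (mem_range_self _))

end FormsReal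

/-! ### Smooth vector fields along maps -/

section VectorFields

variable {E : Type*} [NormedAddCommGroup E] [NormedSpace ℝ E]
  {H : Type*} [TopologicalSpace H] {I : ModelWithCorners ℝ E H}
  {M : Type*} [TopologicalSpace M] [ChartedSpace H M] [IsManifold I ∞ M]
  {E' : Type*} [NormedAddCommGroup E'] [NormedSpace ℝ E']
  {H' : Type*} [TopologicalSpace H'] {I' : ModelWithCorners ℝ E' H'}
  {M' : Type*} [TopologicalSpace M'] [ChartedSpace H' M']

/-- The trivialization of the tangent bundle centred at `p` acts on fibres as the derivative of the
chart at `p`. -/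
theorem contMDiffAt_tangent_iff {h : M' → M} {z : M'}
    (s : ∀ x, TangentSpace I (h x)) {p : M} (hp : h z ∈ (extChartAt I p).source) :
    ContMDiffAt I' I.tangent ∞ (fun x => (⟨h x, s x⟩ : TangentBundle I M)) z ↔
      ContMDiffAt I' I ∞ h z ∧ ContMDiffAt I' 𝓘(ℝ, E) ∞ (fun x => chartD I p (h x) (s x)) z := by
  have : IsManifold I 1 M := IsManifold.of_le (n := ∞) (by simp)
  have hp' : h z ∈ (chartAt H p).source := by rwa [← extChartAt_source I]
  let e := trivializationAt E (TangentSpace I : M → Type _) p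
  rw [Bundle.Trivialization.contMDiffAt_iff (e := e) (x₀ := z)
    (f := fun x => (⟨h x, s x⟩ : TangentBundle I M)) (e.mem_source.2 hp')]
  refine and_congr_right fun hh => ?_
  refine Filter.EventuallyEq.contMDiffAt_iff ?_
  filter_upwards [hh.continuousAt.preimage_mem_nhds ((chartAt H p).open_source.mem_nhds hp')]
    with x hx
  have h1 := TangentBundle.continuousLinearMapAt_trivializationAt (I := I) (x₀ := p) hx
  have h2 := congrArg (fun A : E →L[ℝ] E => A (s x)) h1
  refine Eq.trans ?_ h2
  exact (e.continuousLinearMapAt_apply_of_mem (R := ℝ) hx (s x)).symm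

end VectorFields

/-! ### Duality -/

/-- Positivity makes `v ↦ B v` injective into the dual, hence surjective by dimension. This is what
makes the choice in `dualVector` meaningful. -/
theorem exists_dual {V : Type*} [AddCommGroup V] [Module ℝ V] [FiniteDimensional ℝ V]
    (B : V →ₗ[ℝ] V →ₗ[ℝ] ℝ) (hB : ∀ v, v ≠ 0 → 0 < B v v) (l : V →ₗ[ℝ] ℝ) :
    ∃ c, ∀ w, B c w = l w := by
  have hinj : Function.Injective B := by
    rw [← LinearMap.ker_eq_bot, LinearMap.ker_eq_bot']
    intro v hv
    by_contra h
    have := hB v h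
    rw [hv] at this
    simp at this
  obtain ⟨c, hc⟩ := (LinearMap.injective_iff_surjective_of_finrank_eq_finrank
    (Subspace.dual_finrank_eq (K := ℝ) (V := V)).symm).1 hinj l
  exact ⟨c, fun w => LinearMap.congr_fun hc w⟩

theorem dualVector_spec {V : Type*} [AddCommGroup V] {b : V → V → ℝ} {l : V → ℝ}
    (h : ∃ c, ∀ w, b c w = l w) (w : V) : b (dualVector b l) w = l w :=
  Classical.epsilon_spec h w

/-! ### The Hodge star in terms of an orthonormal basis -/

section StarFormulas

variable {V : Type*} [NormedAddCommGroup V] [NormedSpace ℝ V]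
  (e : Basis (Fin 3) ℝ V)

theorem det_three (u v w : V) : e.det ![u, v, w] =
    e.repr u 0 * e.repr v 1 * e.repr w 2 - e.repr u 0 * e.repr w 1 * e.repr v 2
      - e.repr v 0 * e.repr u 1 * e.repr w 2 + e.repr v 0 * e.repr w 1 * e.repr u 2
      + e.repr w 0 * e.repr u 1 * e.repr v 2 - e.repr w 0 * e.repr v 1 * e.repr u 2 := by
  rw [Basis.det_apply, Matrix.det_fin_three]
  simp [Basis.toMatrix_apply]

theorem alternating_two_swap (β : V [⋀^Fin 2]→L[ℝ] ℝ) (u w : V) : β ![u, w] = -β ![w, u] := by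
  have := β.toAlternatingMap.map_swap ![w, u] (i := 0) (j := 1) (by simp)
  refine Eq.trans ?_ this
  change β _ = β _
  congr 1
  funext a
  fin_cases a <;> rfl

theorem alternating_one_ext {β β' : V [⋀^Fin 1]→L[ℝ] ℝ} (h : ∀ v, β ![v] = β' ![v]) :
    β = β' := by
  ext v
  have : v = ![v 0] := by
    funext a
    fin_cases a; rfl
  rw [this]
  exact h _

theorem alternating_zero_ext {β β' : V [⋀^Fin 0]→L[ℝ] ℝ} (h : β ![] = β' ![]) :
    β = β' := by
  ext v
  rw [show v = ![] from Subsingleton.elim _ _]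
  exact h

variable [FiniteDimensional ℝ V]

theorem hodgeStar_one_apply (α : V [⋀^Fin 1]→L[ℝ] ℝ) (v w : V) :
    hodgeStar (m := 2) (k := 1) e α ![v, w] =
      ∑ i, α ![e i] * e.det ![e i, v, w] := by
  have h : ∀ i : Fin 1 → Fin 3, (α fun a => e (i a)) *
      contract (m := 2) 1 (volForm e) (fun a => e (i a)) ![v, w] =
      α ![e (i 0)] * e.det ![e (i 0), v, w] := fun i => by
    congr 1
    congr 1
    funext a
    fin_cases a; rfl
  have h2 : hodgeStar (m := 2) (k := 1) e α ![v, w] = ((1 : ℕ).factorial : ℝ)⁻¹ *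
      ∑ i : Fin 1 → Fin 3, (α fun a => e (i a)) *
        contract (m := 2) 1 (volForm e) (fun a => e (i a)) ![v, w] := by
    rw [hodgeStar]
    simp
  rw [h2, Finset.sum_congr rfl fun i _ => h i]
  rw [← (Equiv.funUnique (Fin 1) (Fin 3)).symm.sum_comp]
  simp

theorem hodgeStar_two_apply (β : V [⋀^Fin 2]→L[ℝ] ℝ) (v : V) :
    hodgeStar (m := 1) (k := 2) e β ![v] =
      β ![e 1, e 2] * e.repr v 0 + β ![e 2, e 0] * e.repr v 1 + β ![e 0, e 1] * e.repr v 2 := by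
  have h : ∀ i : Fin 2 → Fin 3, (β fun a => e (i a)) *
      contract (m := 1) 2 (volForm e) (fun a => e (i a)) ![v] =
      β ![e (i 0), e (i 1)] * e.det ![e (i 0), e (i 1), v] := fun i => by
    congr 1
    congr 1
    funext a
    fin_cases a <;> rfl
  have h2 : hodgeStar (m := 1) (k := 2) e β ![v] = ((2 : ℕ).factorial : ℝ)⁻¹ *
      ∑ i : Fin 2 → Fin 3, (β fun a => e (i a)) *
        contract (m := 1) 2 (volForm e) (fun a => e (i a)) ![v] := by
    rw [hodgeStar]
    simp
  have hs := alternating_two_swap β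
  have h0 : ∀ u : V, β ![u, u] = 0 := fun u => by
    have := hs u u
    linarith
  rw [h2, Finset.sum_congr rfl fun i _ => h i]
  rw [← (finTwoArrowEquiv (Fin 3)).symm.sum_comp, Fintype.sum_prod_type]
  simp only [Fin.sum_univ_three, finTwoArrowEquiv_symm_apply, Matrix.cons_val_zero,
    Matrix.cons_val_one, det_three, Basis.repr_self, h0]
  -- The pairs `(i, j)` and `(j, i)` contribute equally, which cancels the factor `1/2!`.
  rw [hs (e 1) (e 0), hs (e 2) (e 1), hs (e 0) (e 2)]
  simp
  ring

theorem hodgeStar_three_apply (γ : V [⋀^Fin 3]→L[ℝ] ℝ) (v : Fin 0 → V) :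
    hodgeStar (m := 0) (k := 3) e γ v = γ ![e 0, e 1, e 2] := by
  have hv : v = ![] := Subsingleton.elim _ _
  subst hv
  have hγ : ∀ w, γ w = γ ![e 0, e 1, e 2] * e.det w := fun w => by
    have h1 := γ.toAlternatingMap.eq_smul_basis_det e
    have h2 := congrArg (fun A : V [⋀^Fin 3]→ₗ[ℝ] ℝ => A w) h1
    have h3 : (⇑e : Fin 3 → V) = ![e 0, e 1, e 2] := by
      funext a
      fin_cases a <;> rfl
    rw [← h3]
    exact h2
  have h : ∀ i : Fin 3 → Fin 3, (γ fun a => e (i a)) *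
      contract (m := 0) 3 (volForm e) (fun a => e (i a)) ![] =
      γ ![e 0, e 1, e 2] * e.det ![e (i 0), e (i 1), e (i 2)] ^ 2 := fun i => by
    have h1 : contract (m := 0) 3 (volForm e) (fun a => e (i a)) ![] =
        e.det ![e (i 0), e (i 1), e (i 2)] := by
      change e.det _ = _
      congr 1
    have h2 : (fun a => e (i a)) = ![e (i 0), e (i 1), e (i 2)] := by
      funext a
      fin_cases a <;> rfl
    rw [h1, h2, hγ]
    ring
  have h2 : hodgeStar (m := 0) (k := 3) e γ ![] = ((3 : ℕ).factorial : ℝ)⁻¹ *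
      ∑ i : Fin 3 → Fin 3, (γ fun a => e (i a)) *
        contract (m := 0) 3 (volForm e) (fun a => e (i a)) ![] := by
    rw [hodgeStar]
    simp
  rw [h2, Finset.sum_congr rfl fun i _ => h i, ← Finset.mul_sum]
  -- The six permutations contribute `1` each and repeated indices `0`; this cancels the factor
  -- `1/3!`.
  have h3 : ∑ i : Fin 3 → Fin 3, e.det ![e (i 0), e (i 1), e (i 2)] ^ 2 = 6 := by
    rw [← (Fin.consEquiv fun _ : Fin 3 => Fin 3).sum_comp, Fintype.sum_prod_type]
    have : ∀ a : Fin 3, ∑ y : Fin 2 → Fin 3,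
        e.det ![e ((Fin.consEquiv fun _ : Fin 3 => Fin 3) (a, y) 0),
          e ((Fin.consEquiv fun _ : Fin 3 => Fin 3) (a, y) 1),
          e ((Fin.consEquiv fun _ : Fin 3 => Fin 3) (a, y) 2)] ^ 2 =
        ∑ y : Fin 2 → Fin 3, e.det ![e a, e (y 0), e (y 1)] ^ 2 := fun a => rfl
    simp only [this]
    simp only [← (finTwoArrowEquiv (Fin 3)).symm.sum_comp, Fintype.sum_prod_type]
    simp only [Fin.sum_univ_three, finTwoArrowEquiv_symm_apply, Matrix.cons_val_zero,
      Matrix.cons_val_one, det_three, Basis.repr_self]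
    simp
    norm_num
  rw [h3]
  norm_num [Nat.factorial]
  ring

end StarFormulas

/-! ### Exterior derivatives of forms built from a vector field along an immersion -/

section AlongMap

variable {E V : Type*} [NormedAddCommGroup E] [NormedSpace ℝ E]
  [NormedAddCommGroup V] [NormedSpace ℝ V]
  {s : Set E} {y₀ : E} {F σ : E → V}

theorem extDerivWithin_one_apply {A : E → E [⋀^Fin 1]→L[ℝ] ℝ}
    (hA : DifferentiableWithinAt ℝ A s y₀) (hs : UniqueDiffWithinAt ℝ s y₀) (u v : E) :
    extDerivWithin A s y₀ ![u, v] =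
      fderivWithin ℝ (fun y => A y ![v]) s y₀ u - fderivWithin ℝ (fun y => A y ![u]) s y₀ v := by
  rw [extDerivWithin_apply hA hs, Fin.sum_univ_two]
  have h0 : (0 : Fin 2).removeNth ![u, v] = ![v] := by
    funext a; fin_cases a; rfl
  have h1 : (1 : Fin 2).removeNth ![u, v] = ![u] := by
    funext a; fin_cases a; rfl
  rw [h0, h1]
  simp [sub_eq_add_neg]

theorem extDerivWithin_two_apply {A : E → E [⋀^Fin 2]→L[ℝ] ℝ}
    (hA : DifferentiableWithinAt ℝ A s y₀) (hs : UniqueDiffWithinAt ℝ s y₀) (u v w : E) :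
    extDerivWithin A s y₀ ![u, v, w] =
      fderivWithin ℝ (fun y => A y ![v, w]) s y₀ u - fderivWithin ℝ (fun y => A y ![u, w]) s y₀ v
        + fderivWithin ℝ (fun y => A y ![u, v]) s y₀ w := by
  rw [extDerivWithin_apply hA hs, Fin.sum_univ_three]
  have h0 : (0 : Fin 3).removeNth ![u, v, w] = ![v, w] := by
    funext a; fin_cases a <;> rfl
  have h1 : (1 : Fin 3).removeNth ![u, v, w] = ![u, w] := by
    funext a; fin_cases a <;> rfl
  have h2 : (2 : Fin 3).removeNth ![u, v, w] = ![u, v] := by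
    funext a; fin_cases a <;> rfl
  rw [h0, h1, h2]
  simp [sub_eq_add_neg]

/-- The exterior derivative of the `1`-form `⟨σ, dF ·⟩` along a map `F`. -/
theorem extDerivWithin_inner_along {G : V → V →L[ℝ] V →L[ℝ] ℝ}
    (hs : UniqueDiffOn ℝ s) (hy : y₀ ∈ s) (hyi : y₀ ∈ closure (interior s))
    (hF : ContDiffWithinAt ℝ ∞ F s y₀) (hσ : DifferentiableWithinAt ℝ σ s y₀)
    (hG : DifferentiableAt ℝ G (F y₀)) {A : E → E [⋀^Fin 1]→L[ℝ] ℝ}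
    (hA : DifferentiableWithinAt ℝ A s y₀)
    (hAe : ∀ᶠ y in 𝓝[s] y₀, ∀ v, A y ![v] = G (F y) (σ y) (fderivWithin ℝ F s y v)) (u v : E) :
    extDerivWithin A s y₀ ![u, v] =
      fderiv ℝ G (F y₀) (fderivWithin ℝ F s y₀ u) (σ y₀) (fderivWithin ℝ F s y₀ v)
        + G (F y₀) (fderivWithin ℝ σ s y₀ u) (fderivWithin ℝ F s y₀ v)
      - (fderiv ℝ G (F y₀) (fderivWithin ℝ F s y₀ v) (σ y₀) (fderivWithin ℝ F s y₀ u)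
        + G (F y₀) (fderivWithin ℝ σ s y₀ v) (fderivWithin ℝ F s y₀ u)) := by
  have hu := hs y₀ hy
  rw [extDerivWithin_one_apply hA hu]
  have hF1 : HasFDerivWithinAt F (fderivWithin ℝ F s y₀) s y₀ :=
    (hF.differentiableWithinAt (by simp)).hasFDerivWithinAt
  have hF2 : HasFDerivWithinAt (fderivWithin ℝ F s) (fderivWithin ℝ (fderivWithin ℝ F s) s y₀)
      s y₀ := ((hF.fderivWithin_right (m := ∞) hs (by simp) hy).differentiableWithinAt
        (by simp)).hasFDerivWithinAt
  -- The second derivative of `F` contributes `G(σ, F''(a, b))`, which is symmetric and so drops out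
  -- of the exterior derivative. The hypothesis `hyi` gives the symmetry at boundary points too.
  have hsym : ∀ a b, fderivWithin ℝ (fderivWithin ℝ F s) s y₀ a b =
      fderivWithin ℝ (fderivWithin ℝ F s) s y₀ b a :=
    hF.isSymmSndFDerivWithinAt minSmoothness_two_le hs hyi hy
  have hGF : HasFDerivWithinAt (fun y => G (F y)) (fderiv ℝ G (F y₀) ∘L fderivWithin ℝ F s y₀) s y₀ :=
    HasFDerivAt.comp_hasFDerivWithinAt (g := G) (f := F) y₀ hG.hasFDerivAt hF1
  have key : ∀ a b, fderivWithin ℝ (fun y => A y ![b]) s y₀ a =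
      fderiv ℝ G (F y₀) (fderivWithin ℝ F s y₀ a) (σ y₀) (fderivWithin ℝ F s y₀ b)
        + G (F y₀) (fderivWithin ℝ σ s y₀ a) (fderivWithin ℝ F s y₀ b)
        + G (F y₀) (σ y₀) (fderivWithin ℝ (fderivWithin ℝ F s) s y₀ a b) := fun a b => by
    have h1 : (fun y => A y ![b]) =ᶠ[𝓝[s] y₀] fun y => G (F y) (σ y) (fderivWithin ℝ F s y b) := by
      filter_upwards [hAe] with y h using h b
    rw [h1.fderivWithin_eq_of_mem hy]
    have h2 := (hGF.clm_apply hσ.hasFDerivWithinAt).clm_apply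
      (hF2.clm_apply (hasFDerivWithinAt_const b y₀ s))
    have h3 := congrArg (fun L : E →L[ℝ] ℝ => L a) (h2.fderivWithin hu)
    refine h3.trans ?_
    simp
    ring
  rw [key, key, hsym v u]
  ring

/-- The exterior derivative of the `2`-form `Ψ(σ, dF ·, dF ·)` along a map `F`. -/
theorem extDerivWithin_contract_along {Ψ : V → V [⋀^Fin 3]→L[ℝ] ℝ}
    (hs : UniqueDiffOn ℝ s) (hy : y₀ ∈ s) (hyi : y₀ ∈ closure (interior s))
    (hF : ContDiffWithinAt ℝ ∞ F s y₀) (hσ : DifferentiableWithinAt ℝ σ s y₀)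
    (hΨ : DifferentiableAt ℝ Ψ (F y₀)) {A : E → E [⋀^Fin 2]→L[ℝ] ℝ}
    (hA : DifferentiableWithinAt ℝ A s y₀)
    (hAe : ∀ᶠ y in 𝓝[s] y₀, ∀ v w, A y ![v, w] =
      Ψ (F y) ![σ y, fderivWithin ℝ F s y v, fderivWithin ℝ F s y w]) (u v w : E) :
    let F' := fderivWithin ℝ F s y₀
    let σ' := fderivWithin ℝ σ s y₀
    let Ψ' := fderiv ℝ Ψ (F y₀)
    extDerivWithin A s y₀ ![u, v, w] =
      (Ψ' (F' u) ![σ y₀, F' v, F' w] + Ψ (F y₀) ![σ' u, F' v, F' w])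
      - (Ψ' (F' v) ![σ y₀, F' u, F' w] + Ψ (F y₀) ![σ' v, F' u, F' w])
      + (Ψ' (F' w) ![σ y₀, F' u, F' v] + Ψ (F y₀) ![σ' w, F' u, F' v]) := by
  intro F' σ' Ψ'
  have hu := hs y₀ hy
  rw [extDerivWithin_two_apply hA hu]
  have hF1 : HasFDerivWithinAt F F' s y₀ :=
    (hF.differentiableWithinAt (by simp)).hasFDerivWithinAt
  have hF2 : HasFDerivWithinAt (fderivWithin ℝ F s) (fderivWithin ℝ (fderivWithin ℝ F s) s y₀)
      s y₀ := ((hF.fderivWithin_right (m := ∞) hs (by simp) hy).differentiableWithinAt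
        (by simp)).hasFDerivWithinAt
  set F'' := fderivWithin ℝ (fderivWithin ℝ F s) s y₀ with hF''
  have hsym : ∀ a b, F'' a b = F'' b a :=
    hF.isSymmSndFDerivWithinAt minSmoothness_two_le hs hyi hy
  have hΨF := hΨ.hasFDerivAt.comp_hasFDerivWithinAt y₀ hF1
  have key : ∀ a b c, fderivWithin ℝ (fun y => A y ![b, c]) s y₀ a =
      Ψ' (F' a) ![σ y₀, F' b, F' c] + Ψ (F y₀) ![σ' a, F' b, F' c]
        + Ψ (F y₀) ![σ y₀, F'' a b, F' c] + Ψ (F y₀) ![σ y₀, F' b, F'' a c] := fun a b c => by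
    have h1 : (fun y => A y ![b, c]) =ᶠ[𝓝[s] y₀]
        fun y => Ψ (F y) ![σ y, fderivWithin ℝ F s y b, fderivWithin ℝ F s y c] := by
      filter_upwards [hAe] with y h using h b c
    rw [h1.fderivWithin_eq_of_mem hy]
    have hb := hF2.clm_apply (hasFDerivWithinAt_const b y₀ s)
    have hc := hF2.clm_apply (hasFDerivWithinAt_const c y₀ s)
    have h2 := hΨF.continuousAlternatingMap_apply
      (g := ![σ, fun y => fderivWithin ℝ F s y b, fun y => fderivWithin ℝ F s y c])
      (g' := ![σ', _, _])
      (fun i => by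
        fin_cases i
        · exact hσ.hasFDerivWithinAt
        · exact hb
        · exact hc)
    have h4 : (fun y => Ψ (F y) ![σ y, fderivWithin ℝ F s y b, fderivWithin ℝ F s y c]) =
        fun y => (Ψ ∘ F) y fun i =>
          ![σ, fun y => fderivWithin ℝ F s y b, fun y => fderivWithin ℝ F s y c] i y := by
      funext y
      simp only [Function.comp]
      congr 1
      funext i
      fin_cases i <;> rfl
    rw [h4]
    have h3 := congrArg (fun L : E →L[ℝ] ℝ => L a) (h2.fderivWithin hu)
    refine h3.trans ?_
    rw [add_apply, sum_apply, Fin.sum_univ_three]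
    simp only [ContinuousLinearMap.comp_apply, Function.comp_apply]
    have e0 : (fun i => ![σ, fun y => fderivWithin ℝ F s y b,
        fun y => fderivWithin ℝ F s y c] i y₀) = ![σ y₀, F' b, F' c] := by
      funext i; fin_cases i <;> rfl
    rw [e0]
    have e1 : ∀ (i : Fin 3) (x : V), (Ψ (F y₀)).toContinuousLinearMap ![σ y₀, F' b, F' c] i x =
        Ψ (F y₀) (Function.update ![σ y₀, F' b, F' c] i x) := fun i x => rfl
    rw [e1, e1, e1, ← add_assoc, ← add_assoc]
    have u0 : ∀ x, Function.update ![σ y₀, F' b, F' c] 0 x = ![x, F' b, F' c] := fun x => by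
      funext i; fin_cases i <;> rfl
    have u1 : ∀ x, Function.update ![σ y₀, F' b, F' c] 1 x = ![σ y₀, x, F' c] := fun x => by
      funext i; fin_cases i <;> rfl
    have u2 : ∀ x, Function.update ![σ y₀, F' b, F' c] 2 x = ![σ y₀, F' b, x] := fun x => by
      funext i; fin_cases i <;> rfl
    rw [u0, u1, u2]
    simp
    rfl
  have sw : ∀ a b c, Ψ (F y₀) ![a, b, c] = - Ψ (F y₀) ![a, c, b] := fun a b c => by
    have := (Ψ (F y₀)).toAlternatingMap.map_swap ![a, c, b] (i := 1) (j := 2) (by decide)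
    refine Eq.trans ?_ this
    change Ψ (F y₀) _ = Ψ (F y₀) _
    congr 1
    funext i
    fin_cases i <;> rfl
  -- The six terms containing `F''` cancel in pairs: `F''` is symmetric and `Ψ` is alternating.
  rw [key, key, key, hsym v u, hsym w u, hsym w v, sw _ (F' v) (F'' u w), sw _ (F' u) (F'' v w)]
  ring

end AlongMap

/-! ### Hermitian linear algebra -/

/-- A real inner product for which multiplication by `i` is an isometry. -/
structure IsHermitianMetric (G : C3 →L[ℝ] C3 →L[ℝ] ℝ) : Prop where
  symm : ∀ u v, G u v = G v u
  pos : ∀ v, v ≠ 0 → 0 < G v v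
  herm : ∀ u v, G (Complex.I • u) (Complex.I • v) = G u v

/-- A unitary triple of vectors. -/
structure IsUnitaryTriple (G : C3 →L[ℝ] C3 →L[ℝ] ℝ) (e : Fin 3 → C3) : Prop where
  inner : ∀ i j, G (e i) (e j) = if i = j then 1 else 0
  inner_I : ∀ i j, G (Complex.I • e i) (e j) = 0

/-- The complex sesquilinear form associated with a Hermitian metric. -/
def sesq (G : C3 →L[ℝ] C3 →L[ℝ] ℝ) (u v : C3) : ℂ := G u v + Complex.I * G u (Complex.I • v)

theorem complex_smul_eq (c : ℂ) (u : C3) : c • u = c.re • u + c.im • (Complex.I • u) := by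
  conv_lhs => rw [← Complex.re_add_im c]
  rw [add_smul, mul_smul]
  rfl

section Sesq

variable {G : C3 →L[ℝ] C3 →L[ℝ] ℝ} (hG : IsHermitianMetric G)

theorem IsHermitianMetric.skew (hG : IsHermitianMetric G) (u v : C3) :
    G (Complex.I • u) v = -G u (Complex.I • v) := by
  rw [← hG.herm u, smul_smul, Complex.I_mul_I, neg_one_smul, map_neg, neg_neg]

theorem IsHermitianMetric.I_self (hG : IsHermitianMetric G) (u : C3) :
    G u (Complex.I • u) = 0 := by
  have h1 := hG.skew u u
  have h2 := hG.symm (Complex.I • u) u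
  linarith

theorem sesq_self (hG : IsHermitianMetric G) (u : C3) : sesq G u u = G u u := by
  simp [sesq, hG.I_self]

theorem sesq_sum_left {ι : Type*} (s : Finset ι) (u : ι → C3) (v : C3) :
    sesq G (∑ i ∈ s, u i) v = ∑ i ∈ s, sesq G (u i) v := by
  simp [sesq, Finset.sum_add_distrib, Finset.mul_sum]

theorem sesq_sum_right {ι : Type*} (s : Finset ι) (u : C3) (v : ι → C3) :
    sesq G u (∑ i ∈ s, v i) = ∑ i ∈ s, sesq G u (v i) := by
  simp [sesq, Finset.sum_add_distrib, Finset.mul_sum, Finset.smul_sum]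

theorem sesq_smul_left (hG : IsHermitianMetric G) (c : ℂ) (u v : C3) :
    sesq G (c • u) v = c * sesq G u v := by
  rw [complex_smul_eq]
  simp only [sesq, map_add, map_smul, add_apply, smul_apply, smul_eq_mul, hG.skew, smul_smul,
    Complex.I_mul_I, neg_one_smul, map_neg]
  apply Complex.ext
  · simp
    ring
  · simp

theorem sesq_conj (hG : IsHermitianMetric G) (u v : C3) :
    sesq G v u = (starRingEnd ℂ) (sesq G u v) := by
  apply Complex.ext
  · simp [sesq, hG.symm u v]
  · simp only [sesq, map_add, map_mul, Complex.conj_ofReal, Complex.conj_I]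
    rw [hG.symm v (Complex.I • u), hG.skew]
    simp [hG.symm v u]

theorem sesq_smul_right (hG : IsHermitianMetric G) (c : ℂ) (u v : C3) :
    sesq G u (c • v) = (starRingEnd ℂ) c * sesq G u v := by
  rw [sesq_conj hG, sesq_smul_left hG, map_mul, ← sesq_conj hG]

theorem sesq_re (u v : C3) : (sesq G u v).re = G u v := by simp [sesq]

theorem sesq_im (u v : C3) : (sesq G u v).im = G u (Complex.I • v) := by simp [sesq]

/-- Orthonormality and the Lagrangian condition are the real and imaginary parts of unitarity. -/
theorem isUnitaryTriple_iff (hG : IsHermitianMetric G) {e : Fin 3 → C3} :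
    IsUnitaryTriple G e ↔ ∀ i j, sesq G (e i) (e j) = if i = j then 1 else 0 := by
  constructor
  · intro h i j
    apply Complex.ext
    · rw [sesq_re, h.inner]; split_ifs <;> rfl
    · rw [sesq_im]
      have := hG.skew (e i) (e j)
      rw [h.inner_I] at this
      rw [show G (e i) (Complex.I • e j) = 0 by linarith]
      split_ifs <;> rfl
  · intro h
    constructor
    · intro i j
      rw [← sesq_re, h]; split_ifs <;> rfl
    · intro i j
      rw [hG.skew, ← sesq_im, h]; split_ifs <;> simp

theorem IsUnitaryTriple.repr_sum (hG : IsHermitianMetric G) {e : Fin 3 → C3}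
    (he : IsUnitaryTriple G e) (c : Fin 3 → ℂ) (j : Fin 3) :
    sesq G (∑ i, c i • e i) (e j) = c j := by
  rw [sesq_sum_left]
  simp [sesq_smul_left hG, (isUnitaryTriple_iff hG).1 he]

/-- A unitary triple is a basis over `ℂ`. -/
def IsUnitaryTriple.basis (hG : IsHermitianMetric G) {e : Fin 3 → C3}
    (he : IsUnitaryTriple G e) : Basis (Fin 3) ℂ C3 :=
  basisOfLinearIndependentOfCardEqFinrank
    (Fintype.linearIndependent_iff.2 fun c hc j => by
      rw [← he.repr_sum hG c j, hc]; simp [sesq]) (by simp)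

theorem IsUnitaryTriple.basis_apply (hG : IsHermitianMetric G) {e : Fin 3 → C3}
    (he : IsUnitaryTriple G e) : ⇑(he.basis hG) = e :=
  coe_basisOfLinearIndependentOfCardEqFinrank _ _

theorem IsUnitaryTriple.basis_repr (hG : IsHermitianMetric G) {e : Fin 3 → C3}
    (he : IsUnitaryTriple G e) (v : C3) (j : Fin 3) : (he.basis hG).repr v j = sesq G v (e j) := by
  rw [← he.repr_sum hG (fun i => (he.basis hG).repr v i) j]
  congr 1
  conv_rhs => rw [← (he.basis hG).sum_repr v, he.basis_apply hG]

theorem IsUnitaryTriple.sum_sesq (hG : IsHermitianMetric G) {e : Fin 3 → C3}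
    (he : IsUnitaryTriple G e) (v : C3) : ∑ i, sesq G v (e i) • e i = v := by
  conv_rhs => rw [← (he.basis hG).sum_repr v, he.basis_apply hG]
  simp only [he.basis_repr hG]

/-- The Gram determinant of a Hermitian metric in terms of a complex volume form of unit length. -/
theorem norm_sq_eq_det_gram (hG : IsHermitianMetric G) {Ψ : C3 [⋀^Fin 3]→L[ℂ] ℂ}
    (hΨ : ∀ u, IsUnitaryTriple G u → ‖Ψ u‖ = 1) (e : Basis (Fin 3) ℂ C3) :
    ‖Ψ e‖ ^ 2 = (Matrix.of fun i j => sesq G (e i) (e j)).det.re := by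
  open scoped ComplexOrder MatrixOrder in
  set M : Matrix (Fin 3) (Fin 3) ℂ := Matrix.of fun i j => sesq G (e i) (e j) with hM
  have hpd : M.PosDef := by
    rw [Matrix.posDef_iff_dotProduct_mulVec]
    refine ⟨?_, fun x hx => ?_⟩
    · ext i j
      simp only [Matrix.conjTranspose_apply, hM, Matrix.of_apply]
      exact (sesq_conj hG _ _).symm
    · set v : C3 := ∑ i, (starRingEnd ℂ) (x i) • e i with hv
      have hvne : v ≠ 0 := by
        intro h0
        apply hx
        funext i
        have := Fintype.linearIndependent_iff.1 e.linearIndependent _ h0 i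
        simpa using this
      have : star x ⬝ᵥ (M.mulVec x) = sesq G v v := by
        rw [hv, sesq_sum_left]
        simp only [sesq_sum_right, sesq_smul_left hG, sesq_smul_right hG, dotProduct,
          Matrix.mulVec, hM, Matrix.of_apply, Pi.star_apply, Complex.conj_conj]
        refine Finset.sum_congr rfl fun i _ => ?_
        rw [Finset.mul_sum, Finset.mul_sum]
        refine Finset.sum_congr rfl fun j _ => ?_
        rw [starRingEnd_apply]
        ring
      rw [this, sesq_self hG]
      exact_mod_cast hG.pos v hvne
  -- With the Gram matrix written as `B B*`, changing the basis by `B⁻¹` makes it unitary. There `Ψ`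
  -- has norm one, so `‖Ψ e‖ = ‖det B‖`, while the Gram determinant is `‖det B‖²`.
  obtain ⟨B, hB⟩ := CStarAlgebra.nonneg_iff_eq_mul_star_self.mp hpd.posSemidef.nonneg
  have hBu : IsUnit B := isUnit_of_mul_isUnit_left (hB ▸ hpd.isUnit)
  have hBd : IsUnit B.det := (Matrix.isUnit_iff_isUnit_det B).1 hBu
  set u : Fin 3 → C3 := fun i => ∑ j, B⁻¹ i j • e j with hu
  have hunit : IsUnitaryTriple G u := by
    rw [isUnitaryTriple_iff hG]
    intro i k
    have h1 : sesq G (u i) (u k) = (B⁻¹ * M * star B⁻¹) i k := by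
      simp only [hu, sesq_sum_left, sesq_sum_right, sesq_smul_left hG, sesq_smul_right hG,
        Matrix.mul_apply, Finset.sum_mul, Finset.mul_sum]
      refine Finset.sum_congr rfl fun a _ => Finset.sum_congr rfl fun b _ => ?_
      simp only [hM, Matrix.of_apply, Matrix.star_apply, starRingEnd_apply]
      ring
    have h2 : B⁻¹ * M * star B⁻¹ = 1 := by
      rw [hB, ← mul_assoc, Matrix.nonsing_inv_mul _ hBd, one_mul, ← star_mul,
        Matrix.nonsing_inv_mul _ hBd, star_one]
    rw [h1, h2, Matrix.one_apply]
  have h3 : Ψ u = Ψ e * e.det u := by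
    have h1 := Ψ.toAlternatingMap.eq_smul_basis_det e
    exact congrArg (fun A : C3 [⋀^Fin 3]→ₗ[ℂ] ℂ => A u) h1
  have h4 : e.det u = (B⁻¹).det := by
    rw [Basis.det_apply, ← Matrix.det_transpose]
    congr 1
    ext i j
    simp [Basis.toMatrix_apply, hu, Finsupp.single_apply]
  have h5 := hΨ u hunit
  have hdet : B.det ≠ 0 := hBd.ne_zero
  rw [h3, h4, Matrix.det_nonsing_inv, Ring.inverse_eq_inv, norm_mul, norm_inv] at h5
  have h6 : ‖Ψ e‖ = ‖B.det‖ := by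
    have : ‖B.det‖ ≠ 0 := norm_ne_zero_iff.2 hdet
    field_simp at h5
    exact h5
  rw [h6, hB, Matrix.det_mul, Matrix.star_eq_conjTranspose, Matrix.det_conjTranspose,
    ← starRingEnd_apply, Complex.mul_conj, Complex.ofReal_re, Complex.normSq_eq_norm_sq]

end Sesq

/-! ### Derivatives of Kähler metrics and holomorphic volume forms -/

/-- The Koszul expression for `g(Γ(u, v), w)` in terms of the derivative of the metric. -/
def koszul {V : Type*} [NormedAddCommGroup V] [NormedSpace ℝ V] (dG : V →L[ℝ] V →L[ℝ] V →L[ℝ] ℝ)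
    (u v w : V) : ℝ := (dG u v w + dG v u w - dG w u v) / 2

/-- The complex structure of a Kähler manifold is parallel. -/
theorem koszul_I {dG : C3 →L[ℝ] C3 →L[ℝ] C3 →L[ℝ] ℝ} (hs : ∀ u v w, dG u v w = dG u w v)
    (hh : ∀ u v w, dG u (Complex.I • v) (Complex.I • w) = dG u v w)
    (hc : ∀ u v w, dG u (Complex.I • v) w + dG v (Complex.I • w) u + dG w (Complex.I • u) v = 0)
    (u v w : C3) : koszul dG u (Complex.I • v) w = -koszul dG u v (Complex.I • w) := by
  have hII : ∀ x : C3, Complex.I • Complex.I • x = -x := fun x => by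
    rw [smul_smul, Complex.I_mul_I, neg_one_smul]
  have sk : ∀ a b c, dG a (Complex.I • b) c = -dG a b (Complex.I • c) := fun a b c => by
    rw [← hh a b, hII, map_neg, neg_neg]
  have h1 := hc u v w
  have h2 := hc u (Complex.I • v) (Complex.I • w)
  simp only [hII, map_neg, neg_apply] at h2
  unfold koszul
  rw [sk u v w, sk w u v] at *
  have e1 := sk (Complex.I • v) u w
  have e2 := hs u v w
  have e3 := hs (Complex.I • v) w u
  have e4 := hs (Complex.I • w) u v
  have e5 := hs v w u
  have e6 := hs v (Complex.I • w) u
  have e7 := hs u v (Complex.I • w)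
  have e8 := sk (Complex.I • w) u v
  have e9 := sk u v w
  have e10 := hs (Complex.I • w) (Complex.I • u) (Complex.I • v)
  have e11 := hh (Complex.I • w) u v
  linarith

/-- The difference of the two sides is the alternation of `dΨ` over four vectors, a complex `4`-form
on a space of complex dimension three. Complex linearity of `dΨ` in the direction of differentiation
is essential: this is where holomorphy is used. -/
theorem alternating_holomorphic {e : Basis (Fin 3) ℂ C3} (dΨ : C3 →L[ℂ] C3 [⋀^Fin 3]→L[ℂ] ℂ)
    (a : C3) : dΨ a ![e 0, e 1, e 2] = dΨ (e 0) ![a, e 1, e 2] - dΨ (e 1) ![a, e 0, e 2]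
      + dΨ (e 2) ![a, e 0, e 1] := by
  have h3 : (⇑e : Fin 3 → C3) = ![e 0, e 1, e 2] := by
    funext a
    fin_cases a <;> rfl
  have key : ∀ x w, dΨ x w = dΨ x ![e 0, e 1, e 2] * e.det w := fun x w => by
    have h1 := (dΨ x).toAlternatingMap.eq_smul_basis_det e
    have h2 := congrArg (fun A : C3 [⋀^Fin 3]→ₗ[ℂ] ℂ => A w) h1
    rw [← h3]
    exact h2
  have hd : ∀ x y z : C3, e.det ![x, y, z] = 
    e.repr x 0 * e.repr y 1 * e.repr z 2 - e.repr x 0 * e.repr z 1 * e.repr y 2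
      - e.repr y 0 * e.repr x 1 * e.repr z 2 + e.repr y 0 * e.repr z 1 * e.repr x 2
      + e.repr z 0 * e.repr x 1 * e.repr y 2 - e.repr z 0 * e.repr y 1 * e.repr x 2 := by
    intro x y z
    rw [Basis.det_apply, Matrix.det_fin_three]
    simp [Basis.toMatrix_apply]
  rw [key (e 0), key (e 1), key (e 2)]
  have ha : a = e.repr a 0 • e 0 + e.repr a 1 • e 1 + e.repr a 2 • e 2 := by
    rw [← Fin.sum_univ_three fun i => e.repr a i • e i, e.sum_repr]
  conv_lhs => rw [ha]
  simp only [map_add, map_smul, ContinuousAlternatingMap.add_apply,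
    ContinuousAlternatingMap.smul_apply, smul_eq_mul, hd, Basis.repr_self]
  simp
  ring

/-- The real part of a complex alternating form. -/
def reForm : (C3 [⋀^Fin 3]→L[ℂ] ℂ) →L[ℝ] (C3 [⋀^Fin 3]→L[ℝ] ℝ) :=
  (ContinuousLinearMap.compContinuousAlternatingMapCLM ℝ C3 ℂ ℝ (Fin 3) Complex.reCLM) ∘L
    (ContinuousAlternatingMap.restrictScalarsLI ℝ).toContinuousLinearMap

theorem reForm_apply (Ψ : C3 [⋀^Fin 3]→L[ℂ] ℂ) (v : Fin 3 → C3) : reForm Ψ v = (Ψ v).re := rfl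

/-- The logarithmic derivative of a holomorphic volume form of constant length is half the trace
of the derivative of the metric. -/
theorem fderiv_volume_eq {G : C3 → C3 →L[ℝ] C3 →L[ℝ] ℝ} {Ψ : C3 → C3 [⋀^Fin 3]→L[ℂ] ℂ} {y₀ : C3}
    (hGd : DifferentiableAt ℝ G y₀) (hΨd : DifferentiableAt ℂ Ψ y₀)
    (hG : ∀ᶠ y in 𝓝 y₀, IsHermitianMetric (G y))
    (hΨ : ∀ᶠ y in 𝓝 y₀, ∀ u, IsUnitaryTriple (G y) u → ‖Ψ y u‖ = 1)
    {e : Fin 3 → C3} (he : IsUnitaryTriple (G y₀) e) (h1 : Ψ y₀ e = 1) (a : C3) :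
    (fderiv ℂ Ψ y₀ a e).re = (∑ i, fderiv ℝ G y₀ a (e i) (e i)) / 2 := by
  have hG0 := hG.self_of_nhds
  -- The identity `‖Ψ e‖² = det(Gram)` is differentiated along this line with the vectors `e` held
  -- fixed. At `t = 0` the Gram matrix is the identity, so its determinant has the trace as
  -- derivative; on the other side `Ψ e = 1` gives `2 Re dΨ(a)(e)`.
  let γ : ℝ → C3 := fun t => y₀ + t • a
  have hγ0 : γ 0 = y₀ := by simp [γ]
  have hγ : HasDerivAt γ a 0 := by
    simpa [γ] using ((hasDerivAt_id (0 : ℝ)).smul_const a).const_add y₀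
  have hGγ : HasDerivAt (fun t => G (γ t)) (fderiv ℝ G y₀ a) 0 := by
    have : HasFDerivAt G (fderiv ℝ G y₀) (γ 0) := by rw [hγ0]; exact hGd.hasFDerivAt
    exact HasFDerivAt.comp_hasDerivAt (l := G) (f := γ) 0 this hγ
  have hm : ∀ i j, HasDerivAt (fun t => sesq (G (γ t)) (e i) (e j))
      (sesq (fderiv ℝ G y₀ a) (e i) (e j)) 0 := fun i j => by
    have hr : ∀ v, HasDerivAt (fun t => ((G (γ t) (e i) v : ℝ) : ℂ))
        ((fderiv ℝ G y₀ a (e i) v : ℝ) : ℂ) 0 := fun v => by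
      have h2 := (hGγ.clm_apply (hasDerivAt_const (0 : ℝ) (e i))).clm_apply
        (hasDerivAt_const (0 : ℝ) v)
      simp only [map_zero, add_zero] at h2
      exact h2.ofReal_comp
    exact (hr _).add ((hr _).const_mul _)
  have hm0 : ∀ i j, sesq (G (γ 0)) (e i) (e j) = if i = j then 1 else 0 := by
    rw [hγ0]; exact (isUnitaryTriple_iff hG0).1 he
  have hdet : HasDerivAt (fun t => (Matrix.of fun i j => sesq (G (γ t)) (e i) (e j)).det)
      (∑ i, sesq (fderiv ℝ G y₀ a) (e i) (e i)) 0 := by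
    simp only [Matrix.det_fin_three, Matrix.of_apply]
    have := (((((((hm 0 0).mul (hm 1 1)).mul (hm 2 2)).sub
      (((hm 0 0).mul (hm 1 2)).mul (hm 2 1))).sub (((hm 0 1).mul (hm 1 0)).mul (hm 2 2))).add
      (((hm 0 1).mul (hm 1 2)).mul (hm 2 0))).add (((hm 0 2).mul (hm 1 0)).mul (hm 2 1))).sub
      (((hm 0 2).mul (hm 1 1)).mul (hm 2 0))
    refine this.congr_deriv ?_
    simp [hm0, Fin.sum_univ_three]
  have hdre : HasDerivAt (fun t => (Matrix.of fun i j => sesq (G (γ t)) (e i) (e j)).det.re)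
      (∑ i, fderiv ℝ G y₀ a (e i) (e i)) 0 := by
    have := Complex.reCLM.hasFDerivAt.comp_hasDerivAt (0 : ℝ) hdet
    refine this.congr_deriv ?_
    simp [sesq]
  have hΨγ : HasDerivAt (fun t => Ψ (γ t) e) (fderiv ℂ Ψ y₀ a e) 0 := by
    have h2 : HasFDerivAt Ψ ((fderiv ℂ Ψ y₀).restrictScalars ℝ) (γ 0) := by
      rw [hγ0]; exact hΨd.hasFDerivAt.restrictScalars ℝ
    have h3 := h2.comp_hasDerivAt (0 : ℝ) hγ
    have h4 : HasFDerivAt (fun Φ : C3 [⋀^Fin 3]→L[ℂ] ℂ => Φ e)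
        ((ContinuousAlternatingMap.apply ℂ C3 ℂ e).restrictScalars ℝ) (Ψ (γ 0)) :=
      ((ContinuousAlternatingMap.apply ℂ C3 ℂ e).restrictScalars ℝ).hasFDerivAt
    exact h4.comp_hasDerivAt (0 : ℝ) h3
  have hn : HasDerivAt (fun t => ‖Ψ (γ t) e‖ ^ 2) (2 * (fderiv ℂ Ψ y₀ a e).re) 0 := by
    have h2 := hΨγ.norm_sq
    refine h2.congr_deriv ?_
    rw [hγ0, h1]
    simp
  have hev : (fun t => ‖Ψ (γ t) e‖ ^ 2) =ᶠ[𝓝 0]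
      fun t => (Matrix.of fun i j => sesq (G (γ t)) (e i) (e j)).det.re := by
    have hc : Tendsto γ (𝓝 0) (𝓝 y₀) := by
      have := hγ.continuousAt.tendsto
      rwa [hγ0] at this
    filter_upwards [hc.eventually hG, hc.eventually hΨ] with t h2 h3
    -- For `t ≠ 0` the triple need not be unitary for the metric at `γ t`, but it is still a complex
    -- basis, which suffices.
    have := norm_sq_eq_det_gram h2 h3 (he.basis hG0)
    rwa [he.basis_apply hG0] at this
  have := (hn.congr_of_eventuallyEq hev.symm).unique hdre
  linarith

/-- A complex volume form in terms of a unitary triple of volume one. -/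
theorem IsUnitaryTriple.volume_apply {G : C3 →L[ℝ] C3 →L[ℝ] ℝ} (hG : IsHermitianMetric G)
    {e : Fin 3 → C3} (he : IsUnitaryTriple G e) {Ψ : C3 [⋀^Fin 3]→L[ℂ] ℂ} (h1 : Ψ e = 1)
    (u v w : C3) : Ψ ![u, v, w] =
    sesq G u (e 0) * sesq G v (e 1) * sesq G w (e 2)
      - sesq G u (e 0) * sesq G w (e 1) * sesq G v (e 2)
      - sesq G v (e 0) * sesq G u (e 1) * sesq G w (e 2)
      + sesq G v (e 0) * sesq G w (e 1) * sesq G u (e 2)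
      + sesq G w (e 0) * sesq G u (e 1) * sesq G v (e 2)
      - sesq G w (e 0) * sesq G v (e 1) * sesq G u (e 2) := by
  have h2 : Ψ ![u, v, w] = Ψ e * (he.basis hG).det ![u, v, w] := by
    have h3 := Ψ.toAlternatingMap.eq_smul_basis_det (he.basis hG)
    rw [he.basis_apply hG] at h3
    exact congrArg (fun A : C3 [⋀^Fin 3]→ₗ[ℂ] ℂ => A ![u, v, w]) h3
  rw [h2, h1, one_mul, Basis.det_apply, Matrix.det_fin_three]
  simp [Basis.toMatrix_apply, he.basis_repr hG]

/-! ### Calabi-Yau structures in holomorphic charts -/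

theorem contDiffWithinAt_clm {E V W : Type*} [NormedAddCommGroup E] [NormedSpace ℝ E]
    [NormedAddCommGroup V] [NormedSpace ℝ V] [FiniteDimensional ℝ V]
    [NormedAddCommGroup W] [NormedSpace ℝ W] {n : WithTop ℕ∞} {A : E → V →L[ℝ] W} {s : Set E}
    {y : E} (h : ∀ v, ContDiffWithinAt ℝ n (fun z => A z v) s y) : ContDiffWithinAt ℝ n A s y := by
  let b := Module.finBasis ℝ V
  have hA : A = fun z => ∑ i, (LinearMap.toContinuousLinearMap (b.coord i)).smulRight (A z (b i)) := by
    funext z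
    ext v
    conv_lhs => rw [← b.sum_repr v, map_sum]
    simp
  rw [hA]
  refine ContDiffWithinAt.sum fun i _ => ?_
  exact ((ContinuousLinearMap.smulRightL ℝ V W
    (LinearMap.toContinuousLinearMap (b.coord i))).contDiff.contDiffAt).comp_contDiffWithinAt y
      (h (b i))

theorem contDiffAt_clm {E V W : Type*} [NormedAddCommGroup E] [NormedSpace ℝ E]
    [NormedAddCommGroup V] [NormedSpace ℝ V] [FiniteDimensional ℝ V]
    [NormedAddCommGroup W] [NormedSpace ℝ W] {n : WithTop ℕ∞} {A : E → V →L[ℝ] W}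
    {y : E} (h : ∀ v, ContDiffAt ℝ n (fun z => A z v) y) : ContDiffAt ℝ n A y := by
  simp only [← contDiffWithinAt_univ] at *
  exact contDiffWithinAt_clm h

section CalabiYauChart

variable {N : Type*} [TopologicalSpace N] [ChartedSpace C3 N]

variable [IsManifold 𝓘(ℂ, C3) ω N]

instance isManifold_complex_one : IsManifold 𝓘(ℂ, C3) 1 N := IsManifold.of_le (n := ω) le_top

instance isManifold_real_one : IsManifold 𝓘(ℝ, C3) 1 N := IsManifold.of_le (n := ∞) (by simp)

/-- The charts are holomorphic, so their real derivatives are complex derivatives with restricted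
scalars. Consequently `J` is the constant operator `i` in every chart. -/
theorem symmD_real_eq (p : N) {y : C3} (hy : y ∈ (extChartAt 𝓘(ℝ, C3) p).target) (v : C3) :
    symmD 𝓘(ℝ, C3) p y v = symmD 𝓘(ℂ, C3) p y v := by
  have hy' : y ∈ (extChartAt 𝓘(ℂ, C3) p).target := by
    simpa using hy
  have h1 : HasMFDerivWithinAt 𝓘(ℂ, C3) 𝓘(ℂ, C3) (extChartAt 𝓘(ℂ, C3) p).symm
      (range 𝓘(ℂ, C3)) y (symmD 𝓘(ℂ, C3) p y) :=
    (mdifferentiableWithinAt_extChartAt_symm hy').hasMFDerivWithinAt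
  have h2 : HasMFDerivWithinAt 𝓘(ℝ, C3) 𝓘(ℝ, C3) (extChartAt 𝓘(ℝ, C3) p).symm
      (range 𝓘(ℝ, C3)) y ((symmD 𝓘(ℂ, C3) p y).restrictScalars ℝ) :=
    ⟨h1.1, h1.2.restrictScalars ℝ⟩
  have hu : UniqueMDiffWithinAt 𝓘(ℝ, C3) (range 𝓘(ℝ, C3)) y :=
    (𝓘(ℝ, C3).uniqueDiffOn y (extChartAt_target_subset_range p hy)).uniqueMDiffWithinAt
  have h3 := h2.mfderivWithin hu
  exact congrArg (fun A : C3 →L[ℝ] C3 => A v) h3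

theorem symmD_I (p : N) {y : C3} (hy : y ∈ (extChartAt 𝓘(ℝ, C3) p).target) (v : C3) :
    symmD 𝓘(ℝ, C3) p y (Complex.I • v) = Complex.I • symmD 𝓘(ℝ, C3) p y v := by
  rw [symmD_real_eq p hy, symmD_real_eq p hy, map_smul]

namespace CalabiYau

variable (X : CalabiYau N)

/-- The metric, as a bilinear form on the model space. -/
def gAt (x : N) : C3 →L[ℝ] C3 →L[ℝ] ℝ := X.g.inner x

/-- The holomorphic volume form, as an alternating form on the model space. -/
def holAt (x : N) : C3 [⋀^Fin 3]→L[ℂ] ℂ := X.hol x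

theorem kah_eq (x : N) (u v : C3) :
    (X.kah x : C3 [⋀^Fin 2]→L[ℝ] ℝ) ![u, v] = X.gAt x (Complex.I • u) v :=
  X.kah_apply x u v

/-- The metric in the preferred chart at `p`. -/
def gChart (p : N) (y : C3) : C3 →L[ℝ] C3 →L[ℝ] ℝ :=
  ContinuousLinearMap.bilinearComp (X.gAt ((extChartAt 𝓘(ℝ, C3) p).symm y))
    (symmD 𝓘(ℝ, C3) p y) (symmD 𝓘(ℝ, C3) p y)

theorem gChart_apply (p : N) (y u v : C3) : X.gChart p y u v =
    X.gAt ((extChartAt 𝓘(ℝ, C3) p).symm y) (symmD 𝓘(ℝ, C3) p y u) (symmD 𝓘(ℝ, C3) p y v) :=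
  rfl

theorem gChart_self (p : N) : X.gChart p (extChartAt 𝓘(ℝ, C3) p p) = X.gAt p := by
  ext u v
  rw [gChart_apply, symmD_self, extChartAt_to_inv]
  rfl

theorem isHermitianMetric_gAt (x : N) : IsHermitianMetric (X.gAt x) :=
  ⟨X.g.symm x, X.g.pos x, X.hermitian x⟩

theorem isHermitianMetric_gChart (p : N) {y : C3} (hy : y ∈ (extChartAt 𝓘(ℝ, C3) p).target) :
    IsHermitianMetric (X.gChart p y) := by
  have h := X.isHermitianMetric_gAt ((extChartAt 𝓘(ℝ, C3) p).symm y)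
  refine ⟨fun u v => h.symm _ _, fun v hv => h.pos _ fun h0 => hv ?_, fun u v => ?_⟩
  · rw [← chartD_symmD hy v]
    exact (congrArg _ h0).trans (map_zero _)
  · rw [gChart_apply, symmD_I p hy, symmD_I p hy]
    exact h.herm _ _

theorem contDiffAt_gChart (p : N) {y : C3} (hy : y ∈ (extChartAt 𝓘(ℝ, C3) p).target) :
    ContDiffAt ℝ ∞ (X.gChart p) y := by
  have hs : ContMDiffAt 𝓘(ℝ, C3) 𝓘(ℝ, C3) ∞ (extChartAt 𝓘(ℝ, C3) p).symm y :=
    (contMDiffOn_extChartAt_symm p).contMDiffAt ((isOpen_extChartAt_target p).mem_nhds hy)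
  -- The coordinate fields are smooth because their components in the chart are constant; the smooth
  -- bundle metric is then evaluated on them.
  have hsec : ∀ v : C3, ContMDiffAt 𝓘(ℝ, C3) 𝓘(ℝ, C3).tangent ∞
      (fun z => (⟨(extChartAt 𝓘(ℝ, C3) p).symm z, symmD 𝓘(ℝ, C3) p z v⟩ :
        TangentBundle 𝓘(ℝ, C3) N)) y := fun v => by
    refine (contMDiffAt_tangent_iff (I := 𝓘(ℝ, C3)) (p := p) _
      ((extChartAt 𝓘(ℝ, C3) p).map_target hy)).2 ⟨hs, ?_⟩
    refine (contMDiffAt_const (c := v)).congr_of_eventuallyEq ?_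
    filter_upwards [(isOpen_extChartAt_target p).mem_nhds hy] with z hz
    exact chartD_symmD hz v
  suffices hsuff : ∀ u v, ContDiffAt ℝ ∞ (fun z => X.gChart p z u v) y from
    contDiffAt_clm fun u => contDiffAt_clm (hsuff u)
  intro u v
  have h : ContMDiffAt 𝓘(ℝ, C3) (𝓘(ℝ, C3).prod 𝓘(ℝ, ℝ)) ∞
      (fun z => Bundle.TotalSpace.mk' ℝ (E := Bundle.Trivial N ℝ)
        ((extChartAt 𝓘(ℝ, C3) p).symm z)
        (X.g.inner ((extChartAt 𝓘(ℝ, C3) p).symm z) (symmD 𝓘(ℝ, C3) p z u)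
          (symmD 𝓘(ℝ, C3) p z v))) y := by
    apply ContMDiffAt.clm_bundle_apply₂ (F₁ := C3) (F₂ := C3)
    · exact X.g.contMDiff.contMDiffAt.comp y hs
    · exact hsec u
    · exact hsec v
  rw [Bundle.contMDiffAt_totalSpace] at h
  exact h.2.contDiffAt

theorem norm_hol (p : N) {y : C3} (hy : y ∈ (extChartAt 𝓘(ℝ, C3) p).target) (u : Fin 3 → C3)
    (hu : IsUnitaryTriple (X.gChart p y) u) : ‖formInChart X.hol p y u‖ = 1 := by
  have h1 : formInChart X.hol p y u =
      X.holAt ((extChartAt 𝓘(ℝ, C3) p).symm y) fun i => symmD 𝓘(ℝ, C3) p y (u i) := by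
    simp only [symmD_real_eq p hy]
    rfl
  rw [h1]
  refine X.hol_unit _ _ hu.inner fun i j => ?_
  refine (X.kah_eq _ _ _).trans ?_
  rw [← hu.inner_I i j, gChart_apply, symmD_I p hy]

theorem differentiableAt_hol (p : N) {y : C3} (hy : y ∈ (extChartAt 𝓘(ℝ, C3) p).target) :
    DifferentiableAt ℂ (formInChart X.hol p) y := by
  have hy' : y ∈ (extChartAt 𝓘(ℂ, C3) p).target := by simpa using hy
  exact (X.hol_holomorphic p).differentiableAt ((isOpen_extChartAt_target p).mem_nhds hy')

theorem fderiv_gChart_apply (p : N) {y : C3} (hy : y ∈ (extChartAt 𝓘(ℝ, C3) p).target)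
    (a u v : C3) : fderiv ℝ (X.gChart p) y a u v = fderiv ℝ (fun z => X.gChart p z u v) y a := by
  have h := (X.contDiffAt_gChart p hy).differentiableAt (by simp)
  have h2 : HasFDerivAt (fun z => X.gChart p z u v) _ y :=
    (h.hasFDerivAt.clm_apply (hasFDerivAt_const u y)).clm_apply (hasFDerivAt_const v y)
  rw [h2.fderiv]
  simp

theorem fderiv_gChart_symm (p : N) {y : C3} (hy : y ∈ (extChartAt 𝓘(ℝ, C3) p).target)
    (a u v : C3) : fderiv ℝ (X.gChart p) y a u v = fderiv ℝ (X.gChart p) y a v u := by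
  rw [fderiv_gChart_apply X p hy, fderiv_gChart_apply X p hy]
  congr 1
  refine Filter.EventuallyEq.fderiv_eq ?_
  filter_upwards [(isOpen_extChartAt_target p).mem_nhds hy] with z hz
  exact (X.isHermitianMetric_gChart p hz).symm u v

theorem fderiv_gChart_herm (p : N) {y : C3} (hy : y ∈ (extChartAt 𝓘(ℝ, C3) p).target)
    (a u v : C3) : fderiv ℝ (X.gChart p) y a (Complex.I • u) (Complex.I • v) =
      fderiv ℝ (X.gChart p) y a u v := by
  rw [fderiv_gChart_apply X p hy, fderiv_gChart_apply X p hy]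
  congr 1
  refine Filter.EventuallyEq.fderiv_eq ?_
  filter_upwards [(isOpen_extChartAt_target p).mem_nhds hy] with z hz
  exact (X.isHermitianMetric_gChart p hz).herm u v

theorem formInChart_kah (p : N) {y : C3} (hy : y ∈ (extChartAt 𝓘(ℝ, C3) p).target) (u v : C3) :
    formInChart X.kah p y ![u, v] = X.gChart p y (Complex.I • u) v := by
  have h1 : formInChart X.kah p y ![u, v] =
      (X.kah ((extChartAt 𝓘(ℝ, C3) p).symm y) : C3 [⋀^Fin 2]→L[ℝ] ℝ)
        ![symmD 𝓘(ℝ, C3) p y u, symmD 𝓘(ℝ, C3) p y v] := by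
    rw [formInChart_apply]
    congr 1
    funext i
    fin_cases i <;> rfl
  rw [h1, kah_eq, gChart_apply, symmD_I p hy]

/-- The Kähler condition. -/
theorem fderiv_gChart_closed (p : N) (u v w : C3) :
    let dG := fderiv ℝ (X.gChart p) (extChartAt 𝓘(ℝ, C3) p p)
    dG u (Complex.I • v) w + dG v (Complex.I • w) u + dG w (Complex.I • u) v = 0 := by
  intro dG
  have hy : extChartAt 𝓘(ℝ, C3) p p ∈ (extChartAt 𝓘(ℝ, C3) p).target := mem_extChartAt_target p
  have hev : ∀ a b, (fun z => formInChart X.kah p z ![a, b]) =ᶠ[𝓝 (extChartAt 𝓘(ℝ, C3) p p)]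
      fun z => X.gChart p z (Complex.I • a) b := fun a b => by
    filter_upwards [(isOpen_extChartAt_target p).mem_nhds hy] with z hz
    exact X.formInChart_kah p hz a b
  have hd : ContDiffWithinAt ℝ ∞ (formInChart X.kah p) (range 𝓘(ℝ, C3))
      (extChartAt 𝓘(ℝ, C3) p p) := by
    refine contDiffWithinAt_alternating_iff.2 fun a => ?_
    have ha : a = ![a 0, a 1] := by
      funext i
      fin_cases i <;> rfl
    rw [ha]
    have h1 := X.contDiffAt_gChart p hy
    have h2 : ContDiffAt ℝ ∞ (fun z => X.gChart p z (Complex.I • a 0) (a 1))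
      (extChartAt 𝓘(ℝ, C3) p p) := (h1.clm_apply contDiffAt_const).clm_apply contDiffAt_const
    exact (h2.congr_of_eventuallyEq (hev _ _)).contDiffWithinAt
  have hu : UniqueDiffWithinAt ℝ (range 𝓘(ℝ, C3)) (extChartAt 𝓘(ℝ, C3) p p) :=
    𝓘(ℝ, C3).uniqueDiffOn _ (mem_range_self _)
  have h1 := extDerivWithin_two_apply (hd.differentiableWithinAt (by simp)) hu u v w
  have h2 : extDerivWithin (formInChart X.kah p) (range 𝓘(ℝ, C3))
      (extChartAt 𝓘(ℝ, C3) p p) = 0 := X.kah_closed p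
  rw [h2] at h1
  have h3 : ∀ a b c, fderivWithin ℝ (fun z => formInChart X.kah p z ![a, b]) (range 𝓘(ℝ, C3))
      (extChartAt 𝓘(ℝ, C3) p p) c = dG c (Complex.I • a) b := fun a b c => by
    rw [modelWithCornersSelf_coe, range_id, fderivWithin_univ, (hev a b).fderiv_eq]
    exact (X.fderiv_gChart_apply p hy _ _ _).symm
  rw [h3, h3, h3] at h1
  have h4 : dG v (Complex.I • w) u = -dG v (Complex.I • u) w := by
    rw [X.fderiv_gChart_symm p hy, ← X.fderiv_gChart_herm p hy v u, smul_smul, Complex.I_mul_I,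
      neg_one_smul, map_neg]
  rw [h4]
  have h5 : (0 : C3 [⋀^Fin 3]→L[ℝ] ℝ) ![u, v, w] = 0 := rfl
  rw [h5] at h1
  linarith

/-- The complex structure is parallel. -/
theorem koszul_gChart_I (p : N) (u v w : C3) :
    let dG := fderiv ℝ (X.gChart p) (extChartAt 𝓘(ℝ, C3) p p)
    koszul dG u (Complex.I • v) w = -koszul dG u v (Complex.I • w) :=
  koszul_I (X.fderiv_gChart_symm p (mem_extChartAt_target p))
    (X.fderiv_gChart_herm p (mem_extChartAt_target p)) (X.fderiv_gChart_closed p) u v w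

end CalabiYau

end CalabiYauChart

/-! ### The circle -/

section Circle

/-- The model of one-dimensional manifolds. -/
abbrev R1 := EuclideanSpace ℝ (Fin 1)

instance isManifold_circle_one : IsManifold (𝓡 1) 1 Circle := IsManifold.of_le (n := ω) le_top

instance isManifold_circle_infty : IsManifold (𝓡 1) ∞ Circle := IsManifold.of_le (n := ω) le_top

theorem contMDiff_coe_circle : ContMDiff (𝓡 1) 𝓘(ℝ, ℂ) ∞ (fun z : Circle => (z : ℂ)) :=
  have := finrank_real_complex_fact'
  contMDiff_coe_sphere (E := ℂ)

/-- The derivative of the inclusion of the circle into `ℂ`, on the model space. -/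
def coeD (z : Circle) : R1 →L[ℝ] ℂ := mfderiv (𝓡 1) 𝓘(ℝ, ℂ) (fun w : Circle => (w : ℂ)) z

/-- The `1`-form `dt` at `z`, as a linear form on the model space. -/
def dtAt (z : Circle) : R1 →L[ℝ] ℝ :=
  (Complex.imCLM ∘L (ContinuousLinearMap.mul ℝ ℂ).flip ((starRingEnd ℂ) (z : ℂ))) ∘L coeD z

/-- The vector `∂_t` at `z`, as a vector in the model space. -/
def partialAt (z : Circle) : R1 := partialT z

theorem dtAt_apply (z : Circle) (a : R1) : dtAt z a =
    (coeD z a * (starRingEnd ℂ) (z : ℂ)).im :=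
  rfl

/-- The curve `θ ↦ exp(iθ) z` in `ℂ` has velocity `iz` at `0`, and `iz · conj z = i`. -/
theorem dtAt_partialAt (z : Circle) : dtAt z (partialAt z) = 1 := by
  have hz : Circle.exp 0 * z = z := by simp
  have h1 : MDifferentiableAt (𝓡 1) 𝓘(ℝ, ℂ) (fun w : Circle => (w : ℂ)) z :=
    (contMDiff_coe_circle z).mdifferentiableAt (by simp)
  have h2 : MDifferentiableAt 𝓘(ℝ, ℝ) (𝓡 1) (fun θ : ℝ => Circle.exp θ * z) 0 := by
    have : ContMDiff 𝓘(ℝ, ℝ) (𝓡 1) ∞ (fun θ : ℝ => Circle.exp θ * z) :=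
      contMDiff_circleExp.mul contMDiff_const
    exact (this 0).mdifferentiableAt (by simp)
  have h3 := mfderiv_comp_apply_of_eq (I := 𝓘(ℝ, ℝ)) (I' := 𝓡 1) (I'' := 𝓘(ℝ, ℂ)) (x := (0 : ℝ))
    h1 h2 hz (1 : ℝ)
  have h4 : HasDerivAt (fun θ : ℝ => ((Circle.exp θ * z : Circle) : ℂ)) (Complex.I * (z : ℂ)) 0 := by
    have h5 : HasDerivAt (fun θ : ℝ => Complex.exp (θ * Complex.I)) Complex.I 0 := by
      have h6 : HasDerivAt (fun θ : ℝ => (θ : ℂ) * Complex.I) Complex.I 0 := by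
        simpa using (Complex.ofRealCLM.hasDerivAt (x := (0 : ℝ))).mul_const Complex.I
      simpa using h6.cexp
    simpa using h5.mul_const (z : ℂ)
  have h7 : coeD z (partialAt z) = Complex.I * (z : ℂ) := by
    refine Eq.trans ?_ h4.deriv
    rw [← fderiv_apply_one_eq_deriv, ← mfderiv_eq_fderiv]
    exact h3.symm
  rw [dtAt_apply]
  rw [h7, mul_assoc, Complex.mul_conj]
  simp

theorem smul_partialAt (z : Circle) (a : R1) : dtAt z a • partialAt z = a := by
  have h1 : finrank ℝ R1 = 1 := by simp
  have h0 : partialAt z ≠ 0 := fun h => by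
    have := dtAt_partialAt z
    rw [h, map_zero] at this
    norm_num at this
  obtain ⟨c, hc⟩ := (finrank_eq_one_iff_of_nonzero' (partialAt z) h0).1 h1 a
  rw [← hc, map_smul, dtAt_partialAt, smul_eq_mul, mul_one]

/-- The form `dt` in the preferred chart at `z`. -/
def dtChart (z : Circle) (y : R1) : R1 →L[ℝ] ℝ :=
  dtAt ((extChartAt (𝓡 1) z).symm y) ∘L symmD (𝓡 1) z y

/-- If `c` is the inverse chart followed by the inclusion in `ℂ`, then `dt` reads `Im(dc · conj c)`
in the chart. Only differentiability matters: the derivative itself drops out of the Christoffel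
symbols needed here. -/
theorem differentiableAt_dtChart (z : Circle) :
    DifferentiableAt ℝ (dtChart z) (extChartAt (𝓡 1) z z) := by
  set y₀ := extChartAt (𝓡 1) z z
  have hopen : IsOpen (extChartAt (𝓡 1) z).target := isOpen_extChartAt_target z
  have hy : y₀ ∈ (extChartAt (𝓡 1) z).target := mem_extChartAt_target z
  let c : R1 → ℂ := fun y => ((extChartAt (𝓡 1) z).symm y : ℂ)
  have hc : ContDiffAt ℝ ∞ c y₀ := by
    have h1 : ContMDiffAt 𝓘(ℝ, R1) (𝓡 1) ∞ (extChartAt (𝓡 1) z).symm y₀ :=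
      (contMDiffOn_extChartAt_symm z).contMDiffAt (hopen.mem_nhds hy)
    exact (contMDiff_coe_circle.contMDiffAt.comp y₀ h1).contDiffAt
  have hf : ContDiffAt ℝ ∞ (fderiv ℝ c) y₀ := hc.fderiv_right (by simp)
  refine ContDiffAt.differentiableAt (n := ∞) (contDiffAt_clm fun a => ?_) (by simp)
  have hsm : ContDiffAt ℝ ∞ (fun y => (fderiv ℝ c y a * (starRingEnd ℂ) (c y)).im) y₀ := by
    have h1 : ContDiffAt ℝ ∞ (fun y => fderiv ℝ c y a) y₀ := hf.clm_apply contDiffAt_const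
    have h2 : ContDiffAt ℝ ∞ (fun y => (starRingEnd ℂ) (c y)) y₀ :=
      Complex.conjCLE.contDiff.contDiffAt.comp y₀ hc
    exact Complex.imCLM.contDiff.contDiffAt.comp y₀ (h1.mul h2)
  refine hsm.congr_of_eventuallyEq ?_
  filter_upwards [hopen.mem_nhds hy] with y hy'
  have h1 : MDifferentiableWithinAt 𝓘(ℝ, R1) (𝓡 1) (extChartAt (𝓡 1) z).symm (range (𝓡 1)) y :=
    mdifferentiableWithinAt_extChartAt_symm hy'
  have h2 : MDifferentiableAt (𝓡 1) 𝓘(ℝ, ℂ) (fun w : Circle => (w : ℂ))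
    ((extChartAt (𝓡 1) z).symm y) := (contMDiff_coe_circle _).mdifferentiableAt (by simp)
  have hu : UniqueMDiffWithinAt 𝓘(ℝ, R1) (range (𝓡 1)) y :=
    ((𝓡 1).uniqueDiffOn y (extChartAt_target_subset_range z hy')).uniqueMDiffWithinAt
  have h3 := mfderiv_comp_mfderivWithin (I := 𝓘(ℝ, R1)) (I' := 𝓡 1) (I'' := 𝓘(ℝ, ℂ)) y h2 h1 hu
  rw [mfderivWithin_eq_fderivWithin] at h3
  have h4 : coeD ((extChartAt (𝓡 1) z).symm y) (symmD (𝓡 1) z y a) = fderiv ℝ c y a := by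
    refine (congrArg (fun A : R1 →L[ℝ] ℂ => A a) h3).symm.trans ?_
    rw [modelWithCornersSelf_coe, range_id, fderivWithin_univ]
    rfl
  change dtAt _ (symmD (𝓡 1) z y a) = _
  rw [dtAt_apply, h4]

end Circle

/-! ### The product of a Calabi-Yau threefold with a circle -/

section Product

variable {N : Type*} [TopologicalSpace N] [ChartedSpace C3 N] [IsManifold 𝓘(ℂ, C3) ω N]

/-- The two projections are linear projections in product charts, so `mfderiv_symmD` gives each
component. -/
theorem symmD_prod (p : N) (t : Circle) {y : C3 × R1}
    (hy : y ∈ (extChartAt JM (p, t)).target) (v : C3 × R1) :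
    symmD JM (p, t) y v = (symmD 𝓘(ℝ, C3) p y.1 v.1, symmD (𝓡 1) t y.2 v.2) := by
  have hyr : y ∈ range JM := extChartAt_target_subset_range (p, t) hy
  have hu := JM.uniqueDiffOn y hyr
  have hy' := hy
  rw [extChartAt_prod, PartialEquiv.prod_target] at hy'
  refine Prod.ext ?_ ?_
  · have h := mfderiv_symmD (I := JM) (I' := 𝓘(ℝ, C3)) (f := (Prod.fst : N × Circle → N)) (p := p)
      hy mdifferentiableAt_fst (by
        rw [extChartAt_prod]
        exact (extChartAt 𝓘(ℝ, C3) p).map_target hy'.1) v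
    have h1 : inCharts JM 𝓘(ℝ, C3) (Prod.fst : N × Circle → N) (p, t) p =ᶠ[𝓝[range JM] y]
        Prod.fst := by
      filter_upwards [extChartAt_target_mem_nhdsWithin_of_mem hy] with z hz
      rw [extChartAt_prod, PartialEquiv.prod_target] at hz
      rw [inCharts, extChartAt_prod]
      exact (extChartAt 𝓘(ℝ, C3) p).right_inv hz.1
    rw [h1.fderivWithin_eq_of_mem hyr, h1.self_of_nhdsWithin hyr, fderivWithin_fst hu] at h
    rw [mfderiv_fst] at h
    exact h
  · have h := mfderiv_symmD (I := JM) (I' := 𝓡 1) (f := (Prod.snd : N × Circle → Circle)) (p := t)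
      hy mdifferentiableAt_snd (by
        rw [extChartAt_prod]
        exact (extChartAt (𝓡 1) t).map_target hy'.2) v
    have h1 : inCharts JM (𝓡 1) (Prod.snd : N × Circle → Circle) (p, t) t =ᶠ[𝓝[range JM] y]
        Prod.snd := by
      filter_upwards [extChartAt_target_mem_nhdsWithin_of_mem hy] with z hz
      rw [extChartAt_prod, PartialEquiv.prod_target] at hz
      rw [inCharts, extChartAt_prod]
      exact (extChartAt (𝓡 1) t).right_inv hz.2
    rw [h1.fderivWithin_eq_of_mem hyr, h1.self_of_nhdsWithin hyr, fderivWithin_snd hu] at h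
    rw [mfderiv_snd] at h
    exact h

/-- The circle component is unchanged because the circle chart is centred at `t` itself. -/
theorem chartD_prod (p q : N) (t : Circle) (hq : q ∈ (extChartAt 𝓘(ℝ, C3) p).source)
    (v : C3 × R1) : chartD JM (p, t) (q, t) v = (chartD 𝓘(ℝ, C3) p q v.1, v.2) := by
  have hs : (q, t) ∈ (extChartAt JM (p, t)).source := by
    rw [extChartAt_prod]
    exact ⟨hq, mem_extChartAt_source t⟩
  have hy := (extChartAt JM (p, t)).map_source hs
  have h1 := chartD_symmD hy (chartD 𝓘(ℝ, C3) p q v.1, v.2)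
  have hyq := (extChartAt 𝓘(ℝ, C3) p).map_source hq
  have h2 := symmD_chartD hyq v.1
  rw [(extChartAt 𝓘(ℝ, C3) p).left_inv hq] at h2
  rw [(extChartAt JM (p, t)).left_inv hs, symmD_prod p t hy] at h1
  have h3 : extChartAt JM (p, t) (q, t) = (extChartAt 𝓘(ℝ, C3) p q, extChartAt (𝓡 1) t t) := by
    rw [extChartAt_prod]; rfl
  simp only [h3, h2, symmD_self] at h1
  exact h1

namespace CalabiYau

variable (X : CalabiYau N)

/-- The product metric on the model space. -/
def gMAt (p : N × Circle) : (C3 × R1) →ₗ[ℝ] (C3 × R1) →ₗ[ℝ] ℝ :=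
  LinearMap.mk₂ ℝ (fun v w => X.gAt p.1 v.1 w.1 + dtAt p.2 v.2 * dtAt p.2 w.2)
    (fun _ _ _ => by simp; ring) (fun _ _ _ => by simp; ring) (fun _ _ _ => by simp; ring)
    (fun _ _ _ => by simp; ring)

theorem gMAt_apply (p : N × Circle) (v w : C3 × R1) :
    X.gMAt p v w = X.gAt p.1 v.1 w.1 + dtAt p.2 v.2 * dtAt p.2 w.2 := rfl

theorem gMAt_pos (p : N × Circle) (v : C3 × R1) (hv : v ≠ 0) : 0 < X.gMAt p v v := by
  rw [gMAt_apply]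
  by_cases h : v.1 = 0
  · have h2 : v.2 ≠ 0 := fun h2 => hv (Prod.ext h h2)
    have h3 : dtAt p.2 v.2 ≠ 0 := fun h3 => h2 (by rw [← smul_partialAt p.2 v.2, h3, zero_smul])
    rw [h]
    simp only [map_zero, zero_add]
    exact mul_self_pos.2 h3
  · have := (X.isHermitianMetric_gAt p.1).pos _ h
    nlinarith [mul_self_nonneg (dtAt p.2 v.2)]

theorem gM_dual_spec (p : N × Circle) {l : C3 × R1 → ℝ} (l' : (C3 × R1) →ₗ[ℝ] ℝ)
    (hl : ∀ w, l w = l' w) (w : C3 × R1) :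
    X.gMAt p (dualVector (V := C3 × R1) (fun v w => X.gMAt p v w) l) w = l w :=
  dualVector_spec (b := fun v w => X.gMAt p v w) (by
    obtain ⟨c, hc⟩ := exists_dual (X.gMAt p) (X.gMAt_pos p) l'
    exact ⟨c, fun w => by rw [hc, hl]⟩) w

theorem gMAt_ext (p : N × Circle) {u v : C3 × R1} (h : ∀ w, X.gMAt p u w = X.gMAt p v w) :
    u = v := by
  by_contra hne
  have := X.gMAt_pos p (u - v) (sub_ne_zero.2 hne)
  rw [map_sub (X.gMAt p), LinearMap.sub_apply, h, sub_self] at this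
  exact lt_irrefl _ this

theorem dMetric_gM (p : N) (t : Circle) (w u v : C3 × R1) :
    dMetric (J := JM) X.gM (p, t) w u v =
      fderiv ℝ (X.gChart p) (extChartAt 𝓘(ℝ, C3) p p) w.1 u.1 v.1 +
      (fderiv ℝ (dtChart t) (extChartAt (𝓡 1) t t) w.2 u.2 * dtAt t v.2 +
        dtAt t u.2 * fderiv ℝ (dtChart t) (extChartAt (𝓡 1) t t) w.2 v.2) := by
  have h3 : extChartAt JM (p, t) (p, t) = (extChartAt 𝓘(ℝ, C3) p p, extChartAt (𝓡 1) t t) := by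
    rw [extChartAt_prod]; rfl
  have hyr : extChartAt JM (p, t) (p, t) ∈ range JM := mem_range_self _
  have hu := JM.uniqueDiffOn _ hyr
  have hev : metricInChart (J := JM) X.gM (p, t) u v =ᶠ[𝓝[range JM] extChartAt JM (p, t) (p, t)]
      fun y => X.gChart p y.1 u.1 v.1 + dtChart t y.2 u.2 * dtChart t y.2 v.2 := by
    filter_upwards [extChartAt_target_mem_nhdsWithin (I := JM) (p, t)] with y hy
    have h4 : metricInChart (J := JM) X.gM (p, t) u v y =
        X.gMAt ((extChartAt JM (p, t)).symm y) (symmD JM (p, t) y u) (symmD JM (p, t) y v) := rfl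
    rw [h4, symmD_prod p t hy, symmD_prod p t hy, gMAt_apply, extChartAt_prod]
    rfl
  rw [dMetric, hev.fderivWithin_eq_of_mem hyr]
  have hG := ((X.contDiffAt_gChart p (mem_extChartAt_target p)).differentiableAt
      (by simp)).hasFDerivAt
  have hG2 : HasFDerivAt (fun y : C3 × R1 => X.gChart p y.1)
      (fderiv ℝ (X.gChart p) (extChartAt 𝓘(ℝ, C3) p p) ∘L ContinuousLinearMap.fst ℝ C3 R1)
      (extChartAt 𝓘(ℝ, C3) p p, extChartAt (𝓡 1) t t) :=
    HasFDerivAt.comp (g := X.gChart p) (f := Prod.fst)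
      (extChartAt 𝓘(ℝ, C3) p p, extChartAt (𝓡 1) t t) hG hasFDerivAt_fst
  have hD2 : HasFDerivAt (fun y : C3 × R1 => dtChart t y.2)
      (fderiv ℝ (dtChart t) (extChartAt (𝓡 1) t t) ∘L ContinuousLinearMap.snd ℝ C3 R1)
      (extChartAt 𝓘(ℝ, C3) p p, extChartAt (𝓡 1) t t) :=
    HasFDerivAt.comp (g := dtChart t) (f := Prod.snd)
      (extChartAt 𝓘(ℝ, C3) p p, extChartAt (𝓡 1) t t)
      (differentiableAt_dtChart t).hasFDerivAt hasFDerivAt_snd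
  have hGa := (hG2.clm_apply (hasFDerivAt_const u.1 _)).clm_apply (hasFDerivAt_const v.1 _)
  have hDa := fun a : R1 => hD2.clm_apply (hasFDerivAt_const a _)
  have hd0 : dtChart t (extChartAt (𝓡 1) t t) = dtAt t := by
    rw [dtChart, symmD_self, extChartAt_to_inv]
    rfl
  have hfin := hGa.add ((hDa u.2).mul (hDa v.2))
  rw [h3] at hu ⊢
  refine (congrArg (fun L : C3 × R1 →L[ℝ] ℝ => L w)
    (hfin.hasFDerivWithinAt.fderivWithin hu)).trans ?_
  rw [← hd0]
  simp
  ring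

/-- For a direction with zero circle component, every circle term of the Koszul expression contains
`dt`, or its derivative, with a zero argument. Only the contribution of `N` survives. -/
theorem gMAt_christoffel (p : N) (t : Circle) (u : C3) (v w : C3 × R1) :
    X.gMAt (p, t) (christoffel (J := JM) X.gM (p, t) ((u, 0) : C3 × R1) v : C3 × R1) w =
      koszul (fderiv ℝ (X.gChart p) (extChartAt 𝓘(ℝ, C3) p p)) u v.1 w.1 := by
  set dG := fderiv ℝ (X.gChart p) (extChartAt 𝓘(ℝ, C3) p p) with hdG
  have hlin : IsLinearMap ℝ fun w : C3 × R1 => koszul dG u v.1 w.1 :=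
    ⟨fun _ _ => by simp [koszul]; ring, fun _ _ => by simp [koszul]; ring⟩
  have hl : ∀ w : C3 × R1, (dMetric (J := JM) X.gM (p, t) (u, 0) v w +
      dMetric (J := JM) X.gM (p, t) v (u, 0) w - dMetric (J := JM) X.gM (p, t) w (u, 0) v) / 2 =
      koszul dG u v.1 w.1 := fun w => by
    rw [dMetric_gM, dMetric_gM, dMetric_gM, koszul]
    simp [hdG]
  have := X.gM_dual_spec (p, t) (IsLinearMap.mk' _ hlin) hl w
  rw [hl] at this
  exact this

end CalabiYau

end Product

/-! ### Linear algebra on the tangent spaces of a special Lagrangian submanifold -/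

section StarInvolution

variable {V : Type*} [NormedAddCommGroup V] [NormedSpace ℝ V] (e : Basis (Fin 3) ℝ V)

theorem det_gram (s : Fin 3 → V) :
    (Matrix.of fun i j => ∑ k, e.repr (s i) k * e.repr (s j) k).det = e.det s ^ 2 := by
  have h3 : s = ![s 0, s 1, s 2] := by
    funext a
    fin_cases a <;> rfl
  conv_rhs => rw [h3, det_three]
  simp only [Matrix.det_fin_three, Matrix.of_apply, Fin.sum_univ_three]
  ring

variable [FiniteDimensional ℝ V]

theorem hodgeStar_two_one (β : V [⋀^Fin 2]→L[ℝ] ℝ) :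
    hodgeStar (m := 2) (k := 1) e (hodgeStar (m := 1) (k := 2) e β) = β := by
  apply ContinuousAlternatingMap.toAlternatingMap_injective
  refine Basis.ext_alternating e fun i _ => ?_
  change hodgeStar (m := 2) (k := 1) e (hodgeStar (m := 1) (k := 2) e β) _ = β _
  have hi : (fun a => e (i a)) = ![e (i 0), e (i 1)] := by
    funext a
    fin_cases a <;> rfl
  have h0 : ∀ u : V, β ![u, u] = 0 := fun u => by
    have := alternating_two_swap β u u
    linarith
  rw [hi, hodgeStar_one_apply]
  simp only [hodgeStar_two_apply, Fin.sum_univ_three, det_three, Basis.repr_self]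
  generalize i 0 = a
  generalize i 1 = b
  fin_cases a <;> fin_cases b <;> simp [h0] <;>
    exact (alternating_two_swap β _ _).symm

theorem alternating_two_apply (β : V [⋀^Fin 2]→L[ℝ] ℝ) (u v : V) :
    β ![u, v] = β ![e 1, e 2] * (e.repr u 1 * e.repr v 2 - e.repr u 2 * e.repr v 1)
      + β ![e 2, e 0] * (e.repr u 2 * e.repr v 0 - e.repr u 0 * e.repr v 2)
      + β ![e 0, e 1] * (e.repr u 0 * e.repr v 1 - e.repr u 1 * e.repr v 0) := by
  conv_lhs => rw [← hodgeStar_two_one e β, hodgeStar_one_apply]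
  simp only [hodgeStar_two_apply, Fin.sum_univ_three, det_three, Basis.repr_self]
  simp
  ring

/-- The Hodge star on `2`-forms in terms of an arbitrary basis. -/
theorem hodgeStar_two_apply_basis (β : V [⋀^Fin 2]→L[ℝ] ℝ) (s : Fin 3 → V) (v : V) :
    e.det ![s 0, s 1, s 2] * hodgeStar (m := 1) (k := 2) e β ![v] =
      β ![s 1, s 2] * (∑ k, e.repr (s 0) k * e.repr v k)
      + β ![s 2, s 0] * (∑ k, e.repr (s 1) k * e.repr v k)
      + β ![s 0, s 1] * (∑ k, e.repr (s 2) k * e.repr v k) := by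
  rw [hodgeStar_two_apply, alternating_two_apply e β (s 1), alternating_two_apply e β (s 2),
    alternating_two_apply e β (s 0), det_three]
  simp only [Fin.sum_univ_three]
  ring

/-- As for `2`-forms above, the dependence on the frame is isolated in a determinant. With `s` the
coordinate vectors of a chart, smoothness of the star reduces to smoothness of that determinant. -/
theorem hodgeStar_three_apply_basis (γ : V [⋀^Fin 3]→L[ℝ] ℝ) (s : Fin 3 → V) (v : Fin 0 → V) :
    e.det s * hodgeStar (m := 0) (k := 3) e γ v = γ s := by
  have h3 : (⇑e : Fin 3 → V) = ![e 0, e 1, e 2] := by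
    funext a
    fin_cases a <;> rfl
  rw [hodgeStar_three_apply, ← h3, mul_comm]
  exact (congrArg (fun A : V [⋀^Fin 3]→ₗ[ℝ] ℝ => A s)
    (γ.toAlternatingMap.eq_smul_basis_det e)).symm

end StarInvolution

/-! ### Calibrated tangent spaces: unitary frames and the volume form -/

namespace CalabiYau

variable {N : Type*} [TopologicalSpace N] [ChartedSpace C3 N] [IsManifold 𝓘(ℂ, C3) ω N]
  {X : CalabiYau N}
  {H : Type*} [TopologicalSpace H] {I : ModelWithCorners ℝ R3 H}
  {L : Type*} [TopologicalSpace L] [ChartedSpace H L] {f : L → N}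
  {e : ∀ x : L, Basis (Fin 3) ℝ (TangentSpace I x)}

variable (I f) in
/-- The derivative of `f`, in terms of the model spaces. -/
def dfAt (x : L) : R3 →L[ℝ] C3 := mfderiv I 𝓘(ℝ, C3) f x

variable (e) in
/-- The frame, in terms of the model space. -/
def frameAt (x : L) : Basis (Fin 3) ℝ R3 := e x

/-- A form at a point, in terms of the model space. -/
def formAt {k : ℕ} (α : DForm I L ℝ k) (x : L) : R3 [⋀^Fin k]→L[ℝ] ℝ := α x

variable (X f) in
/-- The dual of a `1`-form, in terms of the model space. -/
def sharpAt (α : DForm I L ℝ 1) (x : L) : R3 := X.sharp I f α x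

theorem IsSpecialLagrangian.unitary (hf : X.IsSpecialLagrangian I f)
    (he : X.IsOrientedOrthonormal I f e) (x : L) :
    IsUnitaryTriple (X.gAt (f x)) fun i => dfAt I f x (frameAt e x i) :=
  ⟨(he x).1, fun _ _ => (X.kah_eq (f x) _ _).symm.trans (hf.kah_eq_zero x _ _)⟩

theorem IsSpecialLagrangian.kah_df (hf : X.IsSpecialLagrangian I f) (x : L) (u v : R3) :
    X.gAt (f x) (dfAt I f x u) (Complex.I • dfAt I f x v) = 0 := by
  have h := hf.kah_eq_zero x u v
  have h2 : X.gAt (f x) (Complex.I • dfAt I f x u) (dfAt I f x v) = 0 :=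
    (X.kah_eq (f x) _ _).symm.trans h
  have := (X.isHermitianMetric_gAt (f x)).skew (dfAt I f x u) (dfAt I f x v)
  linarith

/-- Unit modulus on unitary triples, vanishing imaginary part on `L` and a positive real part leave
only the value `1`. -/
theorem IsSpecialLagrangian.holAt_frame (hf : X.IsSpecialLagrangian I f)
    (he : X.IsOrientedOrthonormal I f e) (x : L) :
    X.holAt (f x) (fun i => dfAt I f x (frameAt e x i)) = 1 := by
  have h3 : (fun i => dfAt I f x (frameAt e x i)) = ![dfAt I f x (frameAt e x 0),
      dfAt I f x (frameAt e x 1), dfAt I f x (frameAt e x 2)] := by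
    funext a
    fin_cases a <;> rfl
  have h1 : ‖X.holAt (f x) (fun i => dfAt I f x (frameAt e x i))‖ = 1 :=
    X.hol_unit (f x) _ (he x).1 fun _ _ => hf.kah_eq_zero x _ _
  have h2 : 0 < (X.holAt (f x) (fun i => dfAt I f x (frameAt e x i))).re := (he x).2
  have h4 : (X.holAt (f x) (fun i => dfAt I f x (frameAt e x i))).im = 0 := by
    rw [h3]
    exact hf.im_hol_eq_zero x _ _ _
  set c := X.holAt (f x) (fun i => dfAt I f x (frameAt e x i))
  have h5 : c = (c.re : ℂ) := Complex.ext rfl (by simp [h4])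
  rw [h5, Complex.norm_real, Real.norm_of_nonneg h2.le] at h1
  rw [h5, h1, Complex.ofReal_one]

theorem IsOrientedOrthonormal.gAt_frame (he : X.IsOrientedOrthonormal I f e) (x : L) (v : R3)
    (i : Fin 3) : X.gAt (f x) (dfAt I f x v) (dfAt I f x (frameAt e x i)) =
      (frameAt e x).repr v i := by
  conv_lhs => rw [← (frameAt e x).sum_repr v]
  have h : ∀ i j, X.gAt (f x) (dfAt I f x (frameAt e x i)) (dfAt I f x (frameAt e x j)) =
    if i = j then 1 else 0 := (he x).1
  simp only [map_sum, map_smul, sum_apply, smul_apply, h]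
  simp

theorem IsOrientedOrthonormal.gAt_df (he : X.IsOrientedOrthonormal I f e) (x : L) (v w : R3) :
    X.gAt (f x) (dfAt I f x v) (dfAt I f x w) =
      ∑ k, (frameAt e x).repr v k * (frameAt e x).repr w k := by
  conv_lhs => rw [← (frameAt e x).sum_repr w]
  simp only [map_sum, map_smul, he.gAt_frame, smul_eq_mul, mul_comm]

theorem IsOrientedOrthonormal.injective (he : X.IsOrientedOrthonormal I f e) (x : L) {v : R3}
    (h : dfAt I f x v = 0) : v = 0 := by
  refine (frameAt e x).repr.map_eq_zero_iff.1 (Finsupp.ext fun i => ?_)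
  rw [← he.gAt_frame, h]
  simp

theorem IsOrientedOrthonormal.gAt_df_pos (he : X.IsOrientedOrthonormal I f e) (x : L) {v : R3}
    (h : v ≠ 0) : 0 < X.gAt (f x) (dfAt I f x v) (dfAt I f x v) :=
  (X.isHermitianMetric_gAt (f x)).pos _ fun h0 => h (he.injective x h0)

/-- Since `L` is Lagrangian, the unitary coordinates of its tangent vectors are real, and the
complex determinant computing `hol` becomes the real one. -/
theorem IsSpecialLagrangian.holAt_df (hf : X.IsSpecialLagrangian I f)
    (he : X.IsOrientedOrthonormal I f e) (x : L) (u v w : R3) :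
    X.holAt (f x) ![dfAt I f x u, dfAt I f x v, dfAt I f x w] =
      (((frameAt e x).det ![u, v, w] : ℝ) : ℂ) := by
  have hs : ∀ a i, sesq (X.gAt (f x)) (dfAt I f x a) (dfAt I f x (frameAt e x i)) =
      (((frameAt e x).repr a i : ℝ) : ℂ) := fun a i => by
    rw [sesq, hf.kah_df, he.gAt_frame]
    simp
  rw [(hf.unitary he x).volume_apply (X.isHermitianMetric_gAt (f x)) (hf.holAt_frame he x),
    det_three]
  simp only [hs]
  push_cast
  rfl

theorem IsOrientedOrthonormal.sharp_spec (he : X.IsOrientedOrthonormal I f e)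
    (α : DForm I L ℝ 1) (x : L) (w : R3) :
    X.gAt (f x) (dfAt I f x (X.sharpAt f α x)) (dfAt I f x w) = formAt α x ![w] := by
  let B : R3 →ₗ[ℝ] R3 →ₗ[ℝ] ℝ := LinearMap.mk₂ ℝ
    (fun v w => X.gAt (f x) (dfAt I f x v) (dfAt I f x w))
    (fun _ _ _ => by simp) (fun _ _ _ => by simp) (fun _ _ _ => by simp) (fun _ _ _ => by simp)
  let l : R3 →ₗ[ℝ] ℝ :=
    ((ContinuousAlternatingMap.ofSubsingleton ℝ R3 ℝ (0 : Fin 1)).symm (formAt α x)).toLinearMap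
  have hl : ∀ w, formAt α x ![w] = l w := fun w => by
    change _ = (formAt α x) (fun _ => w)
    congr 1
    funext a
    fin_cases a; rfl
  have hb : ∃ c, ∀ w, X.gAt (f x) (dfAt I f x c) (dfAt I f x w) = formAt α x ![w] := by
    obtain ⟨c, hc⟩ := exists_dual B (fun v hv => he.gAt_df_pos x hv) l
    exact ⟨c, fun w => by rw [hl, ← hc]; rfl⟩
  exact dualVector_spec (V := R3)
    (b := fun v w => X.gAt (f x) (dfAt I f x v) (dfAt I f x w)) hb w

theorem IsOrientedOrthonormal.sharp_repr (he : X.IsOrientedOrthonormal I f e)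
    (α : DForm I L ℝ 1) (x : L) (i : Fin 3) :
    (frameAt e x).repr (X.sharpAt f α x) i = formAt α x ![frameAt e x i] := by
  rw [← he.gAt_frame, he.sharp_spec]

/-- Combined with `holAt_df` this reads `*α = Re hol(α^∨, ·, ·)`, the form in which `d*α` is
computed. -/
theorem IsOrientedOrthonormal.star₁_apply (he : X.IsOrientedOrthonormal I f e)
    (α : DForm I L ℝ 1) (x : L) (v w : R3) :
    formAt (star₁ e α) x ![v, w] = (frameAt e x).det ![X.sharpAt f α x, v, w] := by
  have h : formAt (star₁ e α) x ![v, w] = ∑ i, formAt α x ![frameAt e x i] *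
    (frameAt e x).det ![frameAt e x i, v, w] := hodgeStar_one_apply (frameAt e x) (formAt α x) v w
  rw [h]
  simp only [Fin.sum_univ_three, det_three, Basis.repr_self, he.sharp_repr]
  simp
  ring

end CalabiYau

/-! ### Smoothness of the metric dual and of the Hodge star -/

/-- Positivity makes `G z` an isomorphism onto the dual, `b z` is its inverse applied to `A z`, and
inversion of linear maps is smooth at invertible ones. -/
theorem contDiffWithinAt_of_bilin {E V : Type*} [NormedAddCommGroup E] [NormedSpace ℝ E]
    [NormedAddCommGroup V] [NormedSpace ℝ V] [FiniteDimensional ℝ V]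
    {G : E → V →L[ℝ] V →L[ℝ] ℝ} {A : E → V →L[ℝ] ℝ} {b : E → V} {s : Set E} {y : E} (hys : y ∈ s)
    (hG : ContDiffWithinAt ℝ ∞ G s y) (hA : ContDiffWithinAt ℝ ∞ A s y)
    (hpos : ∀ᶠ z in 𝓝[s] y, ∀ v, v ≠ 0 → 0 < G z v v)
    (hb : ∀ᶠ z in 𝓝[s] y, ∀ w, G z (b z) w = A z w) : ContDiffWithinAt ℝ ∞ b s y := by
  have hequiv : ∀ z, (∀ v, v ≠ 0 → 0 < G z v v) →
      ∃ T : V ≃L[ℝ] (V →L[ℝ] ℝ), (T : V →L[ℝ] V →L[ℝ] ℝ) = G z := fun z hz => by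
    have hinj : Function.Injective (G z).toLinearMap := by
      rw [← LinearMap.ker_eq_bot, LinearMap.ker_eq_bot']
      intro v hv
      by_contra h
      have := hz v h
      rw [show G z v = 0 from hv] at this
      simp at this
    have hfr : finrank ℝ V = finrank ℝ (V →L[ℝ] ℝ) := by
      rw [← (LinearMap.toContinuousLinearMap (𝕜 := ℝ) (E := V) (F' := ℝ)).finrank_eq]
      exact (Subspace.dual_finrank_eq (K := ℝ) (V := V)).symm
    refine ⟨(LinearEquiv.ofInjectiveOfFinrankEq (G z).toLinearMap hinj hfr).toContinuousLinearEquiv,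
      ?_⟩
    ext v w
    rfl
  have hev : b =ᶠ[𝓝[s] y] fun z => ContinuousLinearMap.inverse (G z) (A z) := by
    filter_upwards [hpos, hb] with z h1 h2
    obtain ⟨T, hT⟩ := hequiv z h1
    have h3 : A z = T (b z) := by
      ext w
      rw [← h2 w, ← hT]
      rfl
    rw [← hT, ContinuousLinearMap.inverse_equiv, h3]
    exact (T.symm_apply_apply _).symm
  obtain ⟨T, hT⟩ := hequiv y (hpos.self_of_nhdsWithin hys)
  have h1 : ContDiffAt ℝ ∞ ContinuousLinearMap.inverse (G y) := by
    rw [← hT]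
    exact contDiffAt_map_inverse T
  exact ((h1.comp_contDiffWithinAt y hG).clm_apply hA).congr_of_eventuallyEq_of_mem hev hys

/-! ### The metric, the volume and the star of `L` in charts -/

namespace CalabiYau

variable {N : Type*} [TopologicalSpace N] [ChartedSpace C3 N] [IsManifold 𝓘(ℂ, C3) ω N]
  {X : CalabiYau N}

theorem formInChart_hol (X : CalabiYau N) (p : N) {y : C3}
    (hy : y ∈ (extChartAt 𝓘(ℝ, C3) p).target) (u : Fin 3 → C3) : formInChart X.hol p y u =
      X.holAt ((extChartAt 𝓘(ℝ, C3) p).symm y) fun i => symmD 𝓘(ℝ, C3) p y (u i) := by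
  simp only [symmD_real_eq p hy]
  rfl

/-- The real part of the holomorphic volume form, in the preferred chart at `p`. -/
def reHol (X : CalabiYau N) (p : N) (y : C3) : C3 [⋀^Fin 3]→L[ℝ] ℝ := reForm (formInChart X.hol p y)

theorem hasFDerivAt_reHol (X : CalabiYau N) (p : N) {y : C3}
    (hy : y ∈ (extChartAt 𝓘(ℝ, C3) p).target) : HasFDerivAt (X.reHol p)
      (reForm ∘L (fderiv ℂ (formInChart X.hol p) y).restrictScalars ℝ) y :=
  HasFDerivAt.comp (g := reForm) (f := formInChart X.hol p) y reForm.hasFDerivAt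
    ((X.differentiableAt_hol p hy).hasFDerivAt.restrictScalars ℝ)

variable {H : Type*} [TopologicalSpace H] {I : ModelWithCorners ℝ R3 H}
  {L : Type*} [TopologicalSpace L] [ChartedSpace H L] {f : L → N}
  {e : ∀ x : L, Basis (Fin 3) ℝ (TangentSpace I x)}

section Chart

variable {x₀ : L} {y : R3} {p : N}

theorem eventually_mem_chart (hf : ContMDiff I 𝓘(ℝ, C3) ∞ f)
    (hy : y ∈ (extChartAt I x₀).target)
    (hp : f ((extChartAt I x₀).symm y) ∈ (extChartAt 𝓘(ℝ, C3) p).source) :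
    ∀ᶠ z in 𝓝[range I] y, z ∈ (extChartAt I x₀).target ∧
      f ((extChartAt I x₀).symm z) ∈ (extChartAt 𝓘(ℝ, C3) p).source := by
  have hc : ContinuousWithinAt (fun z => f ((extChartAt I x₀).symm z)) (range I) y :=
    (hf.continuous.continuousAt.comp (continuousAt_extChartAt_symm'' hy)).continuousWithinAt
  filter_upwards [extChartAt_target_mem_nhdsWithin_of_mem hy,
    hc.preimage_mem_nhdsWithin ((isOpen_extChartAt_source p).mem_nhds hp)] with z h1 h2
  exact ⟨h1, h2⟩

variable [IsManifold I ∞ L]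

theorem df_symmD (hf : ContMDiff I 𝓘(ℝ, C3) ∞ f)
    (hy : y ∈ (extChartAt I x₀).target)
    (hp : f ((extChartAt I x₀).symm y) ∈ (extChartAt 𝓘(ℝ, C3) p).source) (v : R3) :
    dfAt I f ((extChartAt I x₀).symm y) (symmD I x₀ y v) =
      symmD 𝓘(ℝ, C3) p (inCharts I 𝓘(ℝ, C3) f x₀ p y)
        (fderivWithin ℝ (inCharts I 𝓘(ℝ, C3) f x₀ p) (range I) y v) :=
  have : IsManifold I 1 L := IsManifold.of_le (n := ∞) (by simp)
  mfderiv_symmD hy ((hf _).mdifferentiableAt (by simp)) hp v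

theorem contDiffWithinAt_fderivWithin_inCharts (hf : ContMDiff I 𝓘(ℝ, C3) ∞ f)
    (hy : y ∈ (extChartAt I x₀).target)
    (hp : f ((extChartAt I x₀).symm y) ∈ (extChartAt 𝓘(ℝ, C3) p).source) :
    ContDiffWithinAt ℝ ∞ (fderivWithin ℝ (inCharts I 𝓘(ℝ, C3) f x₀ p) (range I)) (range I) y :=
  (contDiffWithinAt_inCharts hy (hf _) hp).fderivWithin_right I.uniqueDiffOn (by simp)
    (extChartAt_target_subset_range x₀ hy)

variable (X I f x₀) in
/-- The induced metric in the preferred chart at `x₀`. -/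
def inducedChart (z : R3) : R3 →L[ℝ] R3 →L[ℝ] ℝ :=
  ContinuousLinearMap.bilinearComp (X.gAt (f ((extChartAt I x₀).symm z)))
    (dfAt I f ((extChartAt I x₀).symm z) ∘L symmD I x₀ z)
    (dfAt I f ((extChartAt I x₀).symm z) ∘L symmD I x₀ z)

theorem inducedChart_eq (hf : ContMDiff I 𝓘(ℝ, C3) ∞ f)
    (hy : y ∈ (extChartAt I x₀).target)
    (hp : f ((extChartAt I x₀).symm y) ∈ (extChartAt 𝓘(ℝ, C3) p).source) (u v : R3) :
    X.inducedChart I f x₀ y u v = X.gChart p (inCharts I 𝓘(ℝ, C3) f x₀ p y)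
      (fderivWithin ℝ (inCharts I 𝓘(ℝ, C3) f x₀ p) (range I) y u)
      (fderivWithin ℝ (inCharts I 𝓘(ℝ, C3) f x₀ p) (range I) y v) := by
  rw [gChart_apply, ← df_symmD hf hy hp, ← df_symmD hf hy hp, inCharts,
    (extChartAt 𝓘(ℝ, C3) p).left_inv hp]
  rfl

theorem contDiffWithinAt_inducedChart (hf : ContMDiff I 𝓘(ℝ, C3) ∞ f)
    (hy : y ∈ (extChartAt I x₀).target) :
    ContDiffWithinAt ℝ ∞ (X.inducedChart I f x₀) (range I) y := by
  set p := f ((extChartAt I x₀).symm y)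
  have hp : f ((extChartAt I x₀).symm y) ∈ (extChartAt 𝓘(ℝ, C3) p).source :=
    mem_extChartAt_source _
  have hyr := extChartAt_target_subset_range x₀ hy
  refine contDiffWithinAt_clm fun u => contDiffWithinAt_clm fun v => ?_
  have hF := contDiffWithinAt_inCharts (p := p) hy (hf _) hp
  have hF' := contDiffWithinAt_fderivWithin_inCharts hf hy hp
  have hG := (X.contDiffAt_gChart p ((extChartAt 𝓘(ℝ, C3) p).map_source hp)).comp_contDiffWithinAt
    (f := inCharts I 𝓘(ℝ, C3) f x₀ p) y hF
  refine ContDiffWithinAt.congr_of_eventuallyEq_of_mem ((hG.clm_apply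
    (hF'.clm_apply (contDiffWithinAt_const (c := u)))).clm_apply
    (hF'.clm_apply (contDiffWithinAt_const (c := v)))) ?_ hyr
  filter_upwards [eventually_mem_chart hf hy hp] with z hz
  exact inducedChart_eq hf hz.1 hz.2 u v

theorem symmD_ne_zero (hy : y ∈ (extChartAt I x₀).target) {v : R3} (hv : v ≠ 0) :
    symmD I x₀ y v ≠ 0 := fun h => by
  have : IsManifold I 1 L := IsManifold.of_le (n := ∞) (by simp)
  have h1 := chartD_symmD hy v
  rw [h, map_zero] at h1
  exact hv h1.symm

theorem IsOrientedOrthonormal.inducedChart_pos (he : X.IsOrientedOrthonormal I f e)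
    (hy : y ∈ (extChartAt I x₀).target) {v : R3} (hv : v ≠ 0) :
    0 < X.inducedChart I f x₀ y v v :=
  he.gAt_df_pos _ (symmD_ne_zero hy hv)

variable (X f x₀) in
/-- The dual of a `1`-form, in the preferred chart at `x₀`. -/
def sharpChart (α : DForm I L ℝ 1) (z : R3) : R3 :=
  chartD I x₀ ((extChartAt I x₀).symm z) (X.sharpAt f α ((extChartAt I x₀).symm z))

theorem symmD_sharpChart (hy : y ∈ (extChartAt I x₀).target) (α : DForm I L ℝ 1) :
    symmD I x₀ y (X.sharpChart f x₀ α y) = X.sharpAt f α ((extChartAt I x₀).symm y) :=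
  have : IsManifold I 1 L := IsManifold.of_le (n := ∞) (by simp)
  symmD_chartD hy _

theorem formInChart_one {k : ℕ} (α : DForm I L ℝ k) (z : R3) (v : Fin k → R3) :
    formInChart α x₀ z v = formAt α ((extChartAt I x₀).symm z) fun i => symmD I x₀ z (v i) := rfl

theorem IsOrientedOrthonormal.sharpChart_spec (he : X.IsOrientedOrthonormal I f e)
    (hy : y ∈ (extChartAt I x₀).target) (α : DForm I L ℝ 1) (w : R3) :
    X.inducedChart I f x₀ y (X.sharpChart f x₀ α y) w = formInChart α x₀ y ![w] := by
  have h1 : X.inducedChart I f x₀ y (X.sharpChart f x₀ α y) w =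
    X.gAt (f ((extChartAt I x₀).symm y)) (dfAt I f ((extChartAt I x₀).symm y)
      (symmD I x₀ y (X.sharpChart f x₀ α y))) (dfAt I f ((extChartAt I x₀).symm y)
      (symmD I x₀ y w)) := rfl
  rw [h1, symmD_sharpChart hy, he.sharp_spec, formInChart_one]
  congr 1
  funext a
  fin_cases a; rfl

theorem IsOrientedOrthonormal.contDiffWithinAt_sharpChart (he : X.IsOrientedOrthonormal I f e)
    (hf : ContMDiff I 𝓘(ℝ, C3) ∞ f) (hy : y ∈ (extChartAt I x₀).target) {α : DForm I L ℝ 1}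
    (hα : IsSmoothForm α) : ContDiffWithinAt ℝ ∞ (X.sharpChart f x₀ α) (range I) y := by
  have hA : ContDiffWithinAt ℝ ∞ (fun z =>
      (ContinuousAlternatingMap.ofSubsingleton ℝ R3 ℝ (0 : Fin 1)).symm (formInChart α x₀ z))
      (range I) y :=
    contDiffWithinAt_clm fun v =>
      contDiffWithinAt_alternating_iff.1 (isSmoothForm_iff.1 hα x₀ y hy) fun _ => v
  refine contDiffWithinAt_of_bilin (extChartAt_target_subset_range x₀ hy)
    (contDiffWithinAt_inducedChart (X := X) hf hy) hA ?_ ?_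
  · filter_upwards [extChartAt_target_mem_nhdsWithin_of_mem hy] with z hz v hv
    exact he.inducedChart_pos hz hv
  · filter_upwards [extChartAt_target_mem_nhdsWithin_of_mem hy] with z hz w
    rw [he.sharpChart_spec hz]
    change _ = formInChart α x₀ z fun _ => w
    congr 1
    funext a
    fin_cases a; rfl

/-! #### The volume -/

/-- The standard basis. -/
def stdBasis : Basis (Fin 3) ℝ R3 := (EuclideanSpace.basisFun (Fin 3) ℝ).toBasis

theorem stdBasis_repr (v : R3) (i : Fin 3) : stdBasis.repr v i = v i := rfl

variable (e x₀) in
/-- The volume of the coordinate vectors in the preferred chart at `x₀`. -/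
def volChart (z : R3) : ℝ :=
  (frameAt e ((extChartAt I x₀).symm z)).det fun i => symmD I x₀ z (stdBasis i)

theorem volChart_ne_zero (hy : y ∈ (extChartAt I x₀).target) : volChart e x₀ y ≠ 0 := by
  have hli : LinearIndependent ℝ fun i => symmD I x₀ y (stdBasis i) := by
    refine stdBasis.linearIndependent.map' (symmD I x₀ y).toLinearMap ?_
    rw [LinearMap.ker_eq_bot']
    intro v hv
    by_contra h
    exact symmD_ne_zero hy h hv
  have := (frameAt e ((extChartAt I x₀).symm y)).isUnit_det
    (basisOfLinearIndependentOfCardEqFinrank hli (by simp))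
  rw [coe_basisOfLinearIndependentOfCardEqFinrank] at this
  exact this.ne_zero

theorem det_symmD (u : Fin 3 → R3) :
    ((frameAt e ((extChartAt I x₀).symm y)).det fun i => symmD I x₀ y (u i)) =
      volChart e x₀ y * stdBasis.det u := by
  have h := ((frameAt e ((extChartAt I x₀).symm y)).det.compLinearMap
    (symmD I x₀ y).toLinearMap).eq_smul_basis_det stdBasis
  exact congrArg (fun A : R3 [⋀^Fin 3]→ₗ[ℝ] ℝ => A u) h

theorem IsSpecialLagrangian.reHol_eq (hf : X.IsSpecialLagrangian I f)
    (he : X.IsOrientedOrthonormal I f e) (hy : y ∈ (extChartAt I x₀).target)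
    (hp : f ((extChartAt I x₀).symm y) ∈ (extChartAt 𝓘(ℝ, C3) p).source) (u v w : R3) :
    X.reHol p (inCharts I 𝓘(ℝ, C3) f x₀ p y)
      ![fderivWithin ℝ (inCharts I 𝓘(ℝ, C3) f x₀ p) (range I) y u,
        fderivWithin ℝ (inCharts I 𝓘(ℝ, C3) f x₀ p) (range I) y v,
        fderivWithin ℝ (inCharts I 𝓘(ℝ, C3) f x₀ p) (range I) y w] =
      (frameAt e ((extChartAt I x₀).symm y)).det
        ![symmD I x₀ y u, symmD I x₀ y v, symmD I x₀ y w] := by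
  have hc := hf.embedding.contMDiff
  have hyF : inCharts I 𝓘(ℝ, C3) f x₀ p y ∈ (extChartAt 𝓘(ℝ, C3) p).target :=
    (extChartAt 𝓘(ℝ, C3) p).map_source hp
  rw [reHol, reForm_apply, formInChart_hol X p hyF]
  have h1 : (fun i => symmD 𝓘(ℝ, C3) p (inCharts I 𝓘(ℝ, C3) f x₀ p y)
      (![fderivWithin ℝ (inCharts I 𝓘(ℝ, C3) f x₀ p) (range I) y u,
        fderivWithin ℝ (inCharts I 𝓘(ℝ, C3) f x₀ p) (range I) y v,
        fderivWithin ℝ (inCharts I 𝓘(ℝ, C3) f x₀ p) (range I) y w] i)) =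
      ![dfAt I f ((extChartAt I x₀).symm y) (symmD I x₀ y u),
        dfAt I f ((extChartAt I x₀).symm y) (symmD I x₀ y v),
        dfAt I f ((extChartAt I x₀).symm y) (symmD I x₀ y w)] := by
    funext i
    fin_cases i <;> exact (df_symmD hc hy hp _).symm
  have h2 : (extChartAt 𝓘(ℝ, C3) p).symm (inCharts I 𝓘(ℝ, C3) f x₀ p y) =
      f ((extChartAt I x₀).symm y) := (extChartAt 𝓘(ℝ, C3) p).left_inv hp
  rw [h2]
  refine (congrArg (fun t => (X.holAt (f ((extChartAt I x₀).symm y)) t).re) h1).trans ?_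
  rw [hf.holAt_df he, Complex.ofReal_re]

/-- No continuity of the frame is available. Instead the volume is `Re hol` on the images of the
coordinate vectors, and one complex derivative of `hol` suffices for continuity. Its only use is to
fix a sign. -/
theorem IsSpecialLagrangian.continuousWithinAt_volChart (hf : X.IsSpecialLagrangian I f)
    (he : X.IsOrientedOrthonormal I f e) (hy : y ∈ (extChartAt I x₀).target) :
    ContinuousWithinAt (volChart e x₀) (range I) y := by
  have hc := hf.embedding.contMDiff
  set p := f ((extChartAt I x₀).symm y)
  have hp : f ((extChartAt I x₀).symm y) ∈ (extChartAt 𝓘(ℝ, C3) p).source :=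
    mem_extChartAt_source _
  have hyr := extChartAt_target_subset_range x₀ hy
  set F := inCharts I 𝓘(ℝ, C3) f x₀ p
  have hF : ContDiffWithinAt ℝ ∞ F (range I) y := contDiffWithinAt_inCharts (p := p) hy (hc _) hp
  have hF' : ContDiffWithinAt ℝ ∞ (fderivWithin ℝ F (range I)) (range I) y :=
    contDiffWithinAt_fderivWithin_inCharts hc hy hp
  have hΨ : HasFDerivWithinAt (fun z => X.reHol p (F z)) _ (range I) y :=
    HasFDerivAt.comp_hasFDerivWithinAt (g := X.reHol p) (f := F) y
      (X.hasFDerivAt_reHol p ((extChartAt 𝓘(ℝ, C3) p).map_source hp))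
      (hF.differentiableWithinAt (by simp)).hasFDerivWithinAt
  have hb : ∀ i, HasFDerivWithinAt (fun z => fderivWithin ℝ F (range I) z (stdBasis i)) _
      (range I) y := fun i =>
    ((hF'.clm_apply (contDiffWithinAt_const (c := stdBasis i))).differentiableWithinAt
      (by simp)).hasFDerivWithinAt
  have h1 := (hΨ.continuousAlternatingMap_apply hb).continuousWithinAt
  refine h1.congr_of_eventuallyEq_of_mem ?_ hyr
  filter_upwards [eventually_mem_chart hc hy hp] with z hz
  have h2 := hf.reHol_eq he hz.1 hz.2 (stdBasis 0) (stdBasis 1) (stdBasis 2)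
  have h3 : (fun i => symmD I x₀ z (stdBasis i)) = ![symmD I x₀ z (stdBasis 0),
      symmD I x₀ z (stdBasis 1), symmD I x₀ z (stdBasis 2)] := by
    funext i
    fin_cases i <;> rfl
  rw [volChart, h3, ← h2]
  congr 1
  funext i
  fin_cases i <;> rfl

theorem IsOrientedOrthonormal.volChart_sq (he : X.IsOrientedOrthonormal I f e) (z : R3) :
    volChart e x₀ z ^ 2 =
      (Matrix.of fun i j => X.inducedChart I f x₀ z (stdBasis i) (stdBasis j)).det := by
  rw [volChart, ← det_gram]
  congr 1
  ext i j
  exact (he.gAt_df _ _ _).symm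

/-- The square is the Gram determinant of the induced metric, smooth and nonzero, so the absolute
value is smooth; by continuity the sign is locally constant. -/
theorem IsSpecialLagrangian.contDiffWithinAt_volChart (hf : X.IsSpecialLagrangian I f)
    (he : X.IsOrientedOrthonormal I f e) (hy : y ∈ (extChartAt I x₀).target) :
    ContDiffWithinAt ℝ ∞ (volChart e x₀) (range I) y := by
  have hc := hf.embedding.contMDiff
  have hyr := extChartAt_target_subset_range x₀ hy
  have hm : ∀ i j, ContDiffWithinAt ℝ ∞
      (fun z => X.inducedChart I f x₀ z (stdBasis i) (stdBasis j)) (range I) y := fun i j =>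
    ((contDiffWithinAt_inducedChart (X := X) hc hy).clm_apply contDiffWithinAt_const).clm_apply
      contDiffWithinAt_const
  have hD : ContDiffWithinAt ℝ ∞ (fun z => volChart e x₀ z ^ 2) (range I) y := by
    simp only [he.volChart_sq, Matrix.det_fin_three, Matrix.of_apply]
    exact (((((((hm 0 0).mul (hm 1 1)).mul (hm 2 2)).sub
      (((hm 0 0).mul (hm 1 2)).mul (hm 2 1))).sub (((hm 0 1).mul (hm 1 0)).mul (hm 2 2))).add
      (((hm 0 1).mul (hm 1 2)).mul (hm 2 0))).add (((hm 0 2).mul (hm 1 0)).mul (hm 2 1))).sub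
      (((hm 0 2).mul (hm 1 1)).mul (hm 2 0))
  have hne : volChart e x₀ y ≠ 0 := volChart_ne_zero hy
  have hs : ContDiffWithinAt ℝ ∞ (fun z => |volChart e x₀ z|) (range I) y := by
    have := hD.sqrt (pow_ne_zero 2 hne)
    simpa only [Real.sqrt_sq_eq_abs] using this
  have hcont := hf.continuousWithinAt_volChart he hy
  rcases lt_or_gt_of_ne hne with h | h
  · refine hs.neg.congr_of_eventuallyEq_of_mem ?_ hyr
    filter_upwards [hcont.eventually (gt_mem_nhds h)] with z hz
    rw [abs_of_neg hz, neg_neg]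
  · refine hs.congr_of_eventuallyEq_of_mem ?_ hyr
    filter_upwards [hcont.eventually (lt_mem_nhds h)] with z hz
    rw [abs_of_pos hz]

end Chart

/-! #### The Hodge star -/

section Star

variable [IsManifold I ∞ L]

theorem IsSpecialLagrangian.star₁_smooth (hf : X.IsSpecialLagrangian I f)
    (he : X.IsOrientedOrthonormal I f e) {α : DForm I L ℝ 1} (hα : IsSmoothForm α) :
    IsSmoothForm (star₁ e α) := by
  refine isSmoothForm_iff.2 fun x₀ y hy => contDiffWithinAt_alternating_iff.2 fun u => ?_
  have hyr := extChartAt_target_subset_range x₀ hy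
  have hb := contDiffWithinAt_euclidean.1
    (he.contDiffWithinAt_sharpChart hf.embedding.contMDiff hy hα)
  -- In coordinates `*α` is `volChart` times the determinant of the components of `α^∨` and the two
  -- arguments.
  have hdet : ContDiffWithinAt ℝ ∞
      (fun z => stdBasis.det ![X.sharpChart f x₀ α z, u 0, u 1]) (range I) y := by
    simp only [det_three, stdBasis_repr]
    have hc : ∀ c : ℝ, ContDiffWithinAt ℝ ∞ (fun _ : R3 => c) (range I) y :=
      fun c => contDiffWithinAt_const
    exact ((((((((hb 0).mul (hc _)).mul (hc _)).sub (((hb 0).mul (hc _)).mul (hc _))).sub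
      (((hc _).mul (hb 1)).mul (hc _))).add (((hc _).mul (hc _)).mul (hb 2)))).add
      (((hc _).mul (hb 1)).mul (hc _))).sub (((hc _).mul (hc _)).mul (hb 2))
  refine ((hf.contDiffWithinAt_volChart he hy).mul hdet).congr_of_eventuallyEq_of_mem ?_ hyr
  filter_upwards [extChartAt_target_mem_nhdsWithin_of_mem hy] with z hz
  rw [← det_symmD, formInChart_one]
  have h1 : (fun i => symmD I x₀ z (u i)) = ![symmD I x₀ z (u 0), symmD I x₀ z (u 1)] := by
    funext i
    fin_cases i <;> rfl
  rw [h1, he.star₁_apply, ← symmD_sharpChart hz]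
  congr 1
  funext i
  fin_cases i <;> rfl

theorem IsSpecialLagrangian.star₂_smooth (hf : X.IsSpecialLagrangian I f)
    (he : X.IsOrientedOrthonormal I f e) {β : DForm I L ℝ 2} (hβ : IsSmoothForm β) :
    IsSmoothForm (star₂ e β) := by
  refine isSmoothForm_iff.2 fun x₀ y hy => contDiffWithinAt_alternating_iff.2 fun u => ?_
  have hyr := extChartAt_target_subset_range x₀ hy
  have hc := hf.embedding.contMDiff
  have hb : ∀ i j, ContDiffWithinAt ℝ ∞
      (fun z => formInChart β x₀ z ![stdBasis i, stdBasis j]) (range I) y := fun i j =>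
    contDiffWithinAt_alternating_iff.1 (isSmoothForm_iff.1 hβ x₀ y hy) _
  have hg : ∀ i, ContDiffWithinAt ℝ ∞
      (fun z => X.inducedChart I f x₀ z (stdBasis i) (u 0)) (range I) y := fun i =>
    ((contDiffWithinAt_inducedChart (X := X) hc hy).clm_apply contDiffWithinAt_const).clm_apply
      contDiffWithinAt_const
  -- This is `hodgeStar_two_apply_basis` on the coordinate vectors, divided by `volChart`: the
  -- numerator contains only coefficients of `β` and of the induced metric.
  refine (((hf.contDiffWithinAt_volChart he hy).inv (volChart_ne_zero hy)).mul
    ((((hb 1 2).mul (hg 0)).add ((hb 2 0).mul (hg 1))).add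
      ((hb 0 1).mul (hg 2)))).congr_of_eventuallyEq_of_mem ?_ hyr
  filter_upwards [extChartAt_target_mem_nhdsWithin_of_mem hy] with z hz
  have hne : volChart e x₀ z ≠ 0 := volChart_ne_zero hz
  have h1 : (fun i => symmD I x₀ z (u i)) = ![symmD I x₀ z (u 0)] := by
    funext i
    fin_cases i; rfl
  have h2 : ∀ i j, formInChart β x₀ z ![stdBasis i, stdBasis j] =
      formAt β ((extChartAt I x₀).symm z) ![symmD I x₀ z (stdBasis i), symmD I x₀ z (stdBasis j)] :=
    fun i j => by
      rw [formInChart_one]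
      congr 1
      funext a
      fin_cases a <;> rfl
  have h3 : ∀ i, X.inducedChart I f x₀ z (stdBasis i) (u 0) = _ := fun i => he.gAt_df _ _ _
  have h4 := hodgeStar_two_apply_basis (frameAt e ((extChartAt I x₀).symm z))
    (formAt β ((extChartAt I x₀).symm z)) (fun i => symmD I x₀ z (stdBasis i)) (symmD I x₀ z (u 0))
  have h5 : volChart e x₀ z = (frameAt e ((extChartAt I x₀).symm z)).det
      ![symmD I x₀ z (stdBasis 0), symmD I x₀ z (stdBasis 1), symmD I x₀ z (stdBasis 2)] := by
    rw [volChart]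
    congr 1
    funext i
    fin_cases i <;> rfl
  rw [formInChart_one, h1]
  refine (eq_inv_mul_iff_mul_eq₀ hne).2 ?_
  rw [h5]
  simp only [h2, h3]
  exact h4

theorem IsSpecialLagrangian.star₃_smooth (hf : X.IsSpecialLagrangian I f)
    (he : X.IsOrientedOrthonormal I f e) {γ : DForm I L ℝ 3} (hγ : IsSmoothForm γ) :
    IsSmoothForm (star₃ e γ) := by
  refine isSmoothForm_iff.2 fun x₀ y hy => contDiffWithinAt_alternating_iff.2 fun u => ?_
  have hyr := extChartAt_target_subset_range x₀ hy
  refine (((hf.contDiffWithinAt_volChart he hy).inv (volChart_ne_zero hy)).mul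
    (contDiffWithinAt_alternating_iff.1 (isSmoothForm_iff.1 hγ x₀ y hy)
      stdBasis)).congr_of_eventuallyEq_of_mem ?_ hyr
  filter_upwards [extChartAt_target_mem_nhdsWithin_of_mem hy] with z hz
  have h1 := hodgeStar_three_apply_basis (frameAt e ((extChartAt I x₀).symm z))
    (formAt γ ((extChartAt I x₀).symm z)) (fun i => symmD I x₀ z (stdBasis i))
    (fun i => symmD I x₀ z (u i))
  rw [formInChart_one, formInChart_one]
  exact (eq_inv_mul_iff_mul_eq₀ (volChart_ne_zero hz)).2 h1

end Star

end CalabiYau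

/-! ### Pairs of forms and normal sections -/

theorem chartD_I {N : Type*} [TopologicalSpace N] [ChartedSpace C3 N] [IsManifold 𝓘(ℂ, C3) ω N]
    {p q : N} (hq : q ∈ (extChartAt 𝓘(ℝ, C3) p).source) (v : C3) :
    chartD 𝓘(ℝ, C3) p q (Complex.I • v) = Complex.I • chartD 𝓘(ℝ, C3) p q v := by
  have hy := (extChartAt 𝓘(ℝ, C3) p).map_source hq
  have h1 := symmD_chartD hy v
  have h2 := chartD_symmD hy (Complex.I • chartD 𝓘(ℝ, C3) p q v)
  rw [(extChartAt 𝓘(ℝ, C3) p).left_inv hq] at h1 h2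
  rw [symmD_I p hy, h1] at h2
  exact h2

namespace CalabiYau

variable {N : Type*} [TopologicalSpace N] [ChartedSpace C3 N] [IsManifold 𝓘(ℂ, C3) ω N]
  {X : CalabiYau N}
  {H : Type*} [TopologicalSpace H] {I : ModelWithCorners ℝ R3 H}
  {L : Type*} [TopologicalSpace L] [ChartedSpace H L] {f : L → N} {t₀ : Circle}
  {e : ∀ x : L, Basis (Fin 3) ℝ (TangentSpace I x)}

theorem mfderiv_slice (hf : ContMDiff I 𝓘(ℝ, C3) ∞ f) (t₀ : Circle) (x : L) (v : R3) :
    (mfderiv I JM (slice f t₀) x v : C3 × R1) = (dfAt I f x v, 0) := by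
  have h1 : HasMFDerivAt I 𝓘(ℝ, C3) f x (mfderiv I 𝓘(ℝ, C3) f x) :=
    ((hf x).mdifferentiableAt (by simp)).hasMFDerivAt
  have h2 := h1.prodMk (hasMFDerivAt_const (I' := 𝓡 1) t₀ x)
  exact congrArg (fun A : R3 →L[ℝ] C3 × R1 => A v) h2.mfderiv

/-- A section of the pulled back tangent bundle of `N × S¹`, in terms of the model space. -/
def secAt (s : ∀ x : L, TangentSpace JM (slice f t₀ x)) (x : L) : C3 × R1 := s x

theorem gM_slice (hf : ContMDiff I 𝓘(ℝ, C3) ∞ f) (s : ∀ x : L, TangentSpace JM (slice f t₀ x))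
    (x : L) (v : R3) : X.gM _ (s x) (mfderiv I JM (slice f t₀) x v) =
      X.gAt (f x) (secAt s x).1 (dfAt I f x v) := by
  have h : X.gM _ (s x) (mfderiv I JM (slice f t₀) x v) =
      X.gMAt (slice f t₀ x) (secAt s x) (dfAt I f x v, 0) :=
    congrArg (X.gMAt (slice f t₀ x) (secAt s x)) (mfderiv_slice hf t₀ x v)
  rw [h, gMAt_apply, map_zero, mul_zero, add_zero]
  rfl

theorem toNormal_fst (α : DForm I L ℝ 1) (τ : DForm I L ℝ 0) (x : L) :
    (secAt (X.toNormal I f t₀ (α, τ)) x).1 =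
      Complex.I • dfAt I f x (X.sharpAt f α x) := rfl

theorem toNormal_snd (α : DForm I L ℝ 1) (τ : DForm I L ℝ 0) (x : L) :
    (secAt (X.toNormal I f t₀ (α, τ)) x).2 = formAt τ x ![] • partialAt t₀ := rfl

/-- A section of the pulled back tangent bundle of `N × S¹` at a point, in the preferred chart. -/
def sectionChart (f : L → N) (t₀ : Circle) (p : N) (s : ∀ x : L, TangentSpace JM (slice f t₀ x))
    (x : L) : C3 × R1 := chartD JM (p, t₀) (slice f t₀ x) (s x)

theorem sectionChart_eq {p : N} {x : L} (hx : f x ∈ (extChartAt 𝓘(ℝ, C3) p).source)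
    (s : ∀ x : L, TangentSpace JM (slice f t₀ x)) : sectionChart f t₀ p s x =
      (chartD 𝓘(ℝ, C3) p (f x) (secAt s x).1, (secAt s x).2) :=
  chartD_prod p (f x) t₀ hx (s x)

theorem contMDiffAt_section_iff (hf : ContMDiff I 𝓘(ℝ, C3) ∞ f)
    (s : ∀ x : L, TangentSpace JM (slice f t₀ x)) {p : N} {x : L}
    (hx : f x ∈ (extChartAt 𝓘(ℝ, C3) p).source) :
    ContMDiffAt I JM.tangent ∞
      (fun x => (⟨slice f t₀ x, s x⟩ : TangentBundle JM (N × Circle))) x ↔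
    ContMDiffAt I 𝓘(ℝ, C3 × R1) ∞ (sectionChart f t₀ p s) x := by
  have hs : slice f t₀ x ∈ (extChartAt JM (p, t₀)).source := by
    rw [extChartAt_prod]
    exact ⟨hx, mem_extChartAt_source t₀⟩
  rw [contMDiffAt_tangent_iff (I := JM) (h := slice f t₀) s hs]
  exact and_iff_right ((hf x).prodMk contMDiffAt_const)

theorem IsSpecialLagrangian.toNormal_normal (hf : X.IsSpecialLagrangian I f)
    (α : DForm I L ℝ 1) (τ : DForm I L ℝ 0) (x : L) (v : R3) :
    X.gM _ (X.toNormal I f t₀ (α, τ) x) (mfderiv I JM (slice f t₀) x v) = 0 := by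
  rw [gM_slice hf.embedding.contMDiff, toNormal_fst]
  have h := hf.kah_df x (X.sharpAt f α x) v
  have := (X.isHermitianMetric_gAt (f x)).skew (dfAt I f x (X.sharpAt f α x)) (dfAt I f x v)
  rw [h, neg_zero] at this
  exact this

theorem toForms_fst (s : ∀ x : L, TangentSpace JM (slice f t₀ x)) (x : L) (w : Fin 1 → R3) :
    formAt (X.toForms I f t₀ s).1 x w =
      X.gAt (f x) (-(Complex.I • (secAt s x).1)) (dfAt I f x (w 0)) := rfl

theorem toForms_snd (s : ∀ x : L, TangentSpace JM (slice f t₀ x)) (x : L) (w : Fin 0 → R3) :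
    formAt (X.toForms I f t₀ s).2 x w = dtAt t₀ (secAt s x).2 := rfl

theorem IsOrientedOrthonormal.toForms_toNormal (he : X.IsOrientedOrthonormal I f e)
    (p : FormPair I (L := L)) : X.toForms I f t₀ (X.toNormal I f t₀ p) = p := by
  obtain ⟨α, τ⟩ := p
  refine Prod.ext (funext fun x => ?_) (funext fun x => ?_)
  · refine alternating_one_ext (V := R3) fun v => ?_
    refine (toForms_fst _ x ![v]).trans ?_
    rw [toNormal_fst, smul_smul, Complex.I_mul_I, neg_one_smul, neg_neg]
    exact he.sharp_spec α x v
  · refine alternating_zero_ext (V := R3) ?_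
    refine (toForms_snd _ x ![]).trans ?_
    rw [toNormal_snd, map_smul, dtAt_partialAt, smul_eq_mul, mul_one]
    rfl

/-- Orthogonality to `TL` says that the unitary coordinates of the `N`-component are purely
imaginary, so this component is `J` of a real combination of the frame. -/
theorem IsSpecialLagrangian.toNormal_toForms (hf : X.IsSpecialLagrangian I f)
    (he : X.IsOrientedOrthonormal I f e) (s : ∀ x : L, TangentSpace JM (slice f t₀ x)) (x : L)
    (hs : ∀ v : TangentSpace I x, X.gM _ (s x) (mfderiv I JM (slice f t₀) x v) = 0) :
    X.toNormal I f t₀ (X.toForms I f t₀ s) x = s x := by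
  have hG := X.isHermitianMetric_gAt (f x)
  have hs' : ∀ v : R3, X.gAt (f x) (secAt s x).1 (dfAt I f x v) = 0 := fun v => by
    rw [← gM_slice hf.embedding.contMDiff]
    exact hs v
  refine Prod.ext ?_ ?_
  · change (secAt (X.toNormal I f t₀ ((X.toForms I f t₀ s).1, (X.toForms I f t₀ s).2)) x).1 =
      (secAt s x).1
    rw [toNormal_fst]
    set v := (secAt s x).1 with hv
    have h1 := (hf.unitary he x).sum_sesq hG v
    have h2 : ∀ i, sesq (X.gAt (f x)) v (dfAt I f x (frameAt e x i)) =
        Complex.I * ((X.gAt (f x) v (Complex.I • dfAt I f x (frameAt e x i)) : ℝ) : ℂ) := fun i => by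
      rw [sesq, hs', Complex.ofReal_zero, zero_add]
    have h3 : X.sharpAt f (X.toForms I f t₀ s).1 x =
        ∑ i, X.gAt (f x) v (Complex.I • dfAt I f x (frameAt e x i)) • frameAt e x i := by
      rw [← (frameAt e x).sum_repr (X.sharpAt f (X.toForms I f t₀ s).1 x)]
      refine Finset.sum_congr rfl fun i _ => ?_
      rw [he.sharp_repr, toForms_fst, map_neg, neg_apply, hG.skew, neg_neg]
      rfl
    conv_rhs => rw [← h1]
    rw [h3, map_sum, Finset.smul_sum]
    refine Finset.sum_congr rfl fun i _ => ?_
    rw [h2, mul_smul, map_smul]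
    rfl
  · change (secAt (X.toNormal I f t₀ ((X.toForms I f t₀ s).1, (X.toForms I f t₀ s).2)) x).2 =
      (secAt s x).2
    rw [toNormal_snd, toForms_snd, smul_partialAt]

section Smooth

variable [IsManifold I ∞ L]

/-- Because it holds throughout the chart domains and not only at the base point, this formula gives
both the smoothness of the section and its derivative. -/
theorem sectionChart_toNormal (hf : ContMDiff I 𝓘(ℝ, C3) ∞ f) {x₀ : L} {p : N} {y : R3}
    (hy : y ∈ (extChartAt I x₀).target)
    (hp : f ((extChartAt I x₀).symm y) ∈ (extChartAt 𝓘(ℝ, C3) p).source)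
    (α : DForm I L ℝ 1) (τ : DForm I L ℝ 0) :
    sectionChart f t₀ p (X.toNormal I f t₀ (α, τ)) ((extChartAt I x₀).symm y) =
      (Complex.I • fderivWithin ℝ (inCharts I 𝓘(ℝ, C3) f x₀ p) (range I) y
        (X.sharpChart f x₀ α y), formInChart τ x₀ y ![] • partialAt t₀) := by
  rw [sectionChart_eq hp]
  refine Prod.ext ?_ ?_
  · change chartD _ _ _ (Complex.I • dfAt I f _ (X.sharpAt f α _)) = _
    rw [chartD_I hp, ← symmD_sharpChart hy, df_symmD hf hy hp]
    have hyF : inCharts I 𝓘(ℝ, C3) f x₀ p y ∈ (extChartAt 𝓘(ℝ, C3) p).target :=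
      (extChartAt 𝓘(ℝ, C3) p).map_source hp
    have h := chartD_symmD hyF (fderivWithin ℝ (inCharts I 𝓘(ℝ, C3) f x₀ p) (range I) y
      (X.sharpChart f x₀ α y))
    rw [show (extChartAt 𝓘(ℝ, C3) p).symm (inCharts I 𝓘(ℝ, C3) f x₀ p y) =
      f ((extChartAt I x₀).symm y) from (extChartAt 𝓘(ℝ, C3) p).left_inv hp] at h
    rw [h]
  · change formAt τ _ ![] • partialAt t₀ = _
    rw [formInChart_one]
    congr 2
    exact Subsingleton.elim _ _

theorem IsOrientedOrthonormal.contMDiffAt_sectionChart_toNormal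
    (he : X.IsOrientedOrthonormal I f e) (hf : ContMDiff I 𝓘(ℝ, C3) ∞ f) {α : DForm I L ℝ 1}
    {τ : DForm I L ℝ 0} (hα : IsSmoothForm α) (hτ : IsSmoothForm τ) (x : L) :
    ContMDiffAt I 𝓘(ℝ, C3 × R1) ∞
      (sectionChart f t₀ (f x) (X.toNormal I f t₀ (α, τ))) x := by
  have hy := mem_extChartAt_target (I := I) x
  have hp : f ((extChartAt I x).symm (extChartAt I x x)) ∈ (extChartAt 𝓘(ℝ, C3) (f x)).source := by
    rw [extChartAt_to_inv]
    exact mem_extChartAt_source _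
  have h1 : ContDiffWithinAt ℝ ∞ (fun y => (Complex.I •
      fderivWithin ℝ (inCharts I 𝓘(ℝ, C3) f x (f x)) (range I) y (X.sharpChart f x α y),
      formInChart τ x y ![] • partialAt t₀)) (range I) (extChartAt I x x) :=
    (((contDiffWithinAt_fderivWithin_inCharts hf hy hp).clm_apply
      (he.contDiffWithinAt_sharpChart hf hy hα)).const_smul Complex.I).prodMk
      ((contDiffWithinAt_alternating_iff.1 (hτ.contDiffWithinAt x) ![]).smul
        contDiffWithinAt_const)
  rw [contMDiffAt_iff_source]
  refine (h1.congr_of_eventuallyEq_of_mem ?_ (mem_range_self _)).contMDiffWithinAt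
  filter_upwards [eventually_mem_chart hf hy hp] with z hz
  exact sectionChart_toNormal hf hz.1 hz.2 α τ

theorem IsSpecialLagrangian.isNormalSection_toNormal (hf : X.IsSpecialLagrangian I f)
    (he : X.IsOrientedOrthonormal I f e) {α : DForm I L ℝ 1}
    {τ : DForm I L ℝ 0} (hα : IsSmoothForm α) (hτ : IsSmoothForm τ) :
    X.IsNormalSection I f t₀ (X.toNormal I f t₀ (α, τ)) :=
  ⟨fun x => (contMDiffAt_section_iff hf.embedding.contMDiff _ (mem_extChartAt_source (f x))).2
    (he.contMDiffAt_sectionChart_toNormal hf.embedding.contMDiff hα hτ x),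
    fun x v => hf.toNormal_normal α τ x v⟩

theorem isSmoothForm_toForms (hf : ContMDiff I 𝓘(ℝ, C3) ∞ f)
    {s : ∀ x : L, TangentSpace JM (slice f t₀ x)}
    (hs : ContMDiff I JM.tangent ∞
      (fun x => (⟨slice f t₀ x, s x⟩ : TangentBundle JM (N × Circle)))) :
    IsSmoothForm (X.toForms I f t₀ s).1 ∧ IsSmoothForm (X.toForms I f t₀ s).2 := by
  have key : ∀ x₀ : L, ∀ y ∈ (extChartAt I x₀).target, ContDiffWithinAt ℝ ∞
      (fun z => sectionChart f t₀ (f ((extChartAt I x₀).symm y)) s ((extChartAt I x₀).symm z))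
      (range I) y := fun x₀ y hy => by
    have h1 := (contMDiffAt_section_iff hf s
      (mem_extChartAt_source (I := 𝓘(ℝ, C3)) (f ((extChartAt I x₀).symm y)))).1 (hs _)
    have h2 : ContMDiffWithinAt 𝓘(ℝ, R3) I ∞ (extChartAt I x₀).symm (range I) y :=
      (contMDiffOn_extChartAt_symm x₀ y hy).mono_of_mem_nhdsWithin
        (extChartAt_target_mem_nhdsWithin_of_mem hy)
    exact (h1.comp_contMDiffWithinAt y h2).contDiffWithinAt
  constructor
  · refine isSmoothForm_iff.2 fun x₀ y hy => contDiffWithinAt_alternating_iff.2 fun u => ?_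
    set p := f ((extChartAt I x₀).symm y) with hpdef
    have hp : f ((extChartAt I x₀).symm y) ∈ (extChartAt 𝓘(ℝ, C3) p).source :=
      mem_extChartAt_source _
    have hF := contDiffWithinAt_inCharts (p := p) hy (hf _) hp
    have hF' := contDiffWithinAt_fderivWithin_inCharts hf hy hp
    have hG := (X.contDiffAt_gChart p
      ((extChartAt 𝓘(ℝ, C3) p).map_source hp)).comp_contDiffWithinAt
      (f := inCharts I 𝓘(ℝ, C3) f x₀ p) y hF
    have hS : ContDiffWithinAt ℝ ∞ (fun z => -(Complex.I •
        (sectionChart f t₀ p s ((extChartAt I x₀).symm z)).1)) (range I) y :=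
      ((key x₀ y hy).fst.const_smul Complex.I).neg
    refine ((hG.clm_apply hS).clm_apply (hF'.clm_apply
      (contDiffWithinAt_const (c := u 0)))).congr_of_eventuallyEq_of_mem ?_
      (extChartAt_target_subset_range x₀ hy)
    filter_upwards [eventually_mem_chart hf hy hp] with z hz
    have hzF : inCharts I 𝓘(ℝ, C3) f x₀ p z ∈ (extChartAt 𝓘(ℝ, C3) p).target :=
      (extChartAt 𝓘(ℝ, C3) p).map_source hz.2
    have hz1 : (extChartAt 𝓘(ℝ, C3) p).symm (inCharts I 𝓘(ℝ, C3) f x₀ p z) =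
      f ((extChartAt I x₀).symm z) := (extChartAt 𝓘(ℝ, C3) p).left_inv hz.2
    rw [formInChart_one, toForms_fst, df_symmD hf hz.1 hz.2]
    change _ = X.gChart p (inCharts I 𝓘(ℝ, C3) f x₀ p z) _ _
    rw [gChart_apply, sectionChart_eq hz.2, map_neg (symmD _ _ _), symmD_I p hzF]
    have h1 := symmD_chartD hzF (secAt s ((extChartAt I x₀).symm z)).1
    rw [hz1] at h1 ⊢
    rw [h1]
  · refine isSmoothForm_iff.2 fun x₀ y hy => contDiffWithinAt_alternating_iff.2 fun u => ?_
    set p := f ((extChartAt I x₀).symm y) with hpdef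
    have hp : f ((extChartAt I x₀).symm y) ∈ (extChartAt 𝓘(ℝ, C3) p).source :=
      mem_extChartAt_source _
    refine ((dtAt t₀).contDiff.contDiffAt.comp_contDiffWithinAt y
      (key x₀ y hy).snd).congr_of_eventuallyEq_of_mem ?_ (extChartAt_target_subset_range x₀ hy)
    filter_upwards [eventually_mem_chart hf hy hp] with z hz
    rw [formInChart_one, toForms_snd]
    change _ = dtAt t₀ (sectionChart f t₀ p s ((extChartAt I x₀).symm z)).2
    rw [sectionChart_eq hz.2]

theorem IsSpecialLagrangian.bijOn_toNormal (hf : X.IsSpecialLagrangian I f)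
    (he : X.IsOrientedOrthonormal I f e) :
    Set.BijOn (X.toNormal I f t₀) {p | IsSmoothForm p.1 ∧ IsSmoothForm p.2}
      {s | X.IsNormalSection I f t₀ s} := by
  refine ⟨fun p hp => hf.isNormalSection_toNormal he hp.1 hp.2, fun p _ q _ hpq => ?_,
    fun s hs => ⟨X.toForms I f t₀ s, isSmoothForm_toForms hf.embedding.contMDiff hs.1,
      funext fun x => hf.toNormal_toForms he s x (hs.2 x)⟩⟩
  rw [← he.toForms_toNormal (t₀ := t₀) p, ← he.toForms_toNormal (t₀ := t₀) q, hpq]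

end Smooth

end CalabiYau

/-! ### The operator `D` at a point -/

/-- The vector product of a unitary triple of volume one with vectors whose components are
prescribed, summed over the triple. -/
theorem sum_volume_frame {G : C3 →L[ℝ] C3 →L[ℝ] ℝ} (hG : IsHermitianMetric G) {E : Fin 3 → C3}
    (hE : IsUnitaryTriple G E) {Ψ : C3 [⋀^Fin 3]→L[ℂ] ℂ} (h1 : Ψ E = 1) {n : Fin 3 → C3}
    {c : Fin 3 → Fin 3 → ℝ} (hn : ∀ i j, sesq G (n i) (E j) = Complex.I * (c i j : ℂ)) (w : C3) :
    ∑ i, (Ψ ![E i, n i, w]).re = -((c 1 2 - c 2 1) * G w (Complex.I • E 0) +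
      (c 2 0 - c 0 2) * G w (Complex.I • E 1) + (c 0 1 - c 1 0) * G w (Complex.I • E 2)) := by
  -- Each term is a determinant whose rows are a unit vector, the imaginary row `i c` and the
  -- coordinates of `w`. Its real part selects the imaginary parts of the coordinates of `w`, and no
  -- diagonal entry of `c` survives.
  simp only [hE.volume_apply hG h1, (isUnitaryTriple_iff hG).1 hE, hn, Fin.sum_univ_three]
  simp [sesq]
  ring

theorem extDerivWithin_zero_apply {E : Type*} [NormedAddCommGroup E] [NormedSpace ℝ E]
    {A : E → E [⋀^Fin 0]→L[ℝ] ℝ} {s : Set E} {y : E} (hA : DifferentiableWithinAt ℝ A s y)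
    (hs : UniqueDiffWithinAt ℝ s y) (v : E) :
    extDerivWithin A s y ![v] = fderivWithin ℝ (fun z => A z ![]) s y v := by
  rw [extDerivWithin_apply hA hs]
  have h0 : (0 : Fin 1).removeNth ![v] = ![] := Subsingleton.elim _ _
  simp [h0]

namespace CalabiYau

variable {N : Type*} [TopologicalSpace N] [ChartedSpace C3 N] [IsManifold 𝓘(ℂ, C3) ω N]
  {X : CalabiYau N}
  {H : Type*} [TopologicalSpace H] {I : ModelWithCorners ℝ R3 H}
  {L : Type*} [TopologicalSpace L] [ChartedSpace H L] {f : L → N} {t₀ : Circle}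
  {e : ∀ x : L, Basis (Fin 3) ℝ (TangentSpace I x)}

theorem phi_eq (p : N × Circle) (u v w : C3 × R1) : X.phi p u v w =
    X.gAt p.1 (Complex.I • u.1) v.1 * dtAt p.2 w.2 + X.gAt p.1 (Complex.I • v.1) w.1 * dtAt p.2 u.2
      + X.gAt p.1 (Complex.I • w.1) u.1 * dtAt p.2 v.2 + (X.holAt p.1 ![u.1, v.1, w.1]).re := by
  rw [← kah_eq, ← kah_eq, ← kah_eq]
  rfl

theorem gMAt_cross (p : N × Circle) (u v w : C3 × R1) :
    X.gMAt p (X.cross p u v : C3 × R1) w = X.phi p u v w := by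
  -- The slot of `Re hol` left free, as a linear map; it serves to show that `φ(u, v, ·)` is linear
  -- and hence has a representing vector.
  let K : C3 →L[ℝ] ℝ := (reForm (X.holAt p.1)).toContinuousMultilinearMap.toContinuousLinearMap
    ![u.1, v.1, 0] 2
  have hK : ∀ a, K a = (X.holAt p.1 ![u.1, v.1, a]).re := fun a => by
    change (X.holAt p.1 (Function.update ![u.1, v.1, 0] 2 a)).re = _
    congr 2
    funext i
    fin_cases i <;> rfl
  have hlin : IsLinearMap ℝ fun w : C3 × R1 => X.phi p u v w := by
    constructor
    · intro w w'
      simp only [phi_eq, ← hK, Prod.fst_add, Prod.snd_add, map_add, smul_add, add_apply]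
      ring
    · intro c w
      simp only [phi_eq, ← hK, Prod.smul_fst, Prod.smul_snd, smul_comm Complex.I c w.1]
      simp only [map_smul _ c, smul_apply, smul_eq_mul]
      ring
  exact X.gM_dual_spec p (IsLinearMap.mk' _ hlin) (fun _ => rfl) w

theorem gMAt_smul_I (p : N) (t : Circle) (a : C3) (r : ℝ) (w : C3 × R1) :
    X.gMAt (p, t) (Complex.I • a, r • partialAt t) w =
      -X.gAt p a (Complex.I • w.1) + r * dtAt t w.2 := by
  rw [gMAt_apply]
  simp only [map_smul (dtAt t), dtAt_partialAt, smul_eq_mul, mul_one]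
  rw [(X.isHermitianMetric_gAt p).skew]

section Pointwise

variable [IsManifold I ∞ L]

variable (X I f) in
/-- The vector field `α^∨` of `L`, in the preferred charts at `x` and `f x`. -/
def sharpAlong (α : DForm I L ℝ 1) (x : L) (y : R3) : C3 :=
  fderivWithin ℝ (inCharts I 𝓘(ℝ, C3) f x (f x)) (range I) y (X.sharpChart f x α y)

variable (X I f) in
/-- The derivative of the metric in the preferred chart at `f x`. -/
def dgAt (x : L) : C3 →L[ℝ] C3 →L[ℝ] C3 →L[ℝ] ℝ :=
  fderiv ℝ (X.gChart (f x)) (extChartAt 𝓘(ℝ, C3) (f x) (f x))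

variable (X I f) in
/-- The inner product `⟨∇_v α^∨, w⟩`. -/
def covInner (α : DForm I L ℝ 1) (x : L) (v : R3) (w : C3) : ℝ :=
  X.gAt (f x) (fderivWithin ℝ (X.sharpAlong I f α x) (range I) (extChartAt I x x) v) w +
    koszul (X.dgAt f x) (dfAt I f x v) (dfAt I f x (X.sharpAt f α x)) w

theorem mem_chart_self (f : L → N) (x : L) :
    f ((extChartAt I x).symm (extChartAt I x x)) ∈ (extChartAt 𝓘(ℝ, C3) (f x)).source := by
  rw [extChartAt_to_inv]
  exact mem_extChartAt_source _

theorem inCharts_self (f : L → N) (x : L) :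
    inCharts I 𝓘(ℝ, C3) f x (f x) (extChartAt I x x) = extChartAt 𝓘(ℝ, C3) (f x) (f x) := by
  rw [inCharts, extChartAt_to_inv]

theorem fderivWithin_inCharts_self (hf : ContMDiff I 𝓘(ℝ, C3) ∞ f) (x : L) (v : R3) :
    fderivWithin ℝ (inCharts I 𝓘(ℝ, C3) f x (f x)) (range I) (extChartAt I x x) v =
      dfAt I f x v := by
  have : IsManifold I 1 L := IsManifold.of_le (n := ∞) (by simp)
  have h := df_symmD hf (mem_extChartAt_target (I := I) x) (mem_chart_self f x) v
  rw [inCharts_self, symmD_self, symmD_self, extChartAt_to_inv] at h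
  exact h.symm

theorem sharpChart_self (α : DForm I L ℝ 1) (x : L) :
    X.sharpChart f x α (extChartAt I x x) = X.sharpAt f α x := by
  have : IsManifold I 1 L := IsManifold.of_le (n := ∞) (by simp)
  rw [sharpChart, extChartAt_to_inv, chartD_self]
  rfl

theorem sharpAlong_self (hf : ContMDiff I 𝓘(ℝ, C3) ∞ f) (α : DForm I L ℝ 1) (x : L) :
    X.sharpAlong I f α x (extChartAt I x x) = dfAt I f x (X.sharpAt f α x) := by
  rw [sharpAlong, fderivWithin_inCharts_self hf, sharpChart_self]

theorem IsOrientedOrthonormal.contDiffWithinAt_sharpAlong (he : X.IsOrientedOrthonormal I f e)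
    (hf : ContMDiff I 𝓘(ℝ, C3) ∞ f) {α : DForm I L ℝ 1} (hα : IsSmoothForm α) (x : L) :
    ContDiffWithinAt ℝ ∞ (X.sharpAlong I f α x) (range I) (extChartAt I x x) :=
  (contDiffWithinAt_fderivWithin_inCharts hf (mem_extChartAt_target x) (mem_chart_self f x)).clm_apply
    (he.contDiffWithinAt_sharpChart hf (mem_extChartAt_target x) hα)

theorem formAt_extD_zero {τ : DForm I L ℝ 0} (hτ : IsSmoothForm τ) (x : L) (v : R3) :
    formAt (extD τ) x ![v] =
      fderivWithin ℝ (fun z => formInChart τ x z ![]) (range I) (extChartAt I x x) v :=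
  extDerivWithin_zero_apply ((hτ.contDiffWithinAt x).differentiableWithinAt (by simp))
    (I.uniqueDiffOn _ (mem_range_self _)) v

/-- The covariant derivative of the normal section `Jα^∨ + τ ∂_t`. -/
theorem IsOrientedOrthonormal.gMAt_covDeriv (he : X.IsOrientedOrthonormal I f e)
    (hf : ContMDiff I 𝓘(ℝ, C3) ∞ f) {α : DForm I L ℝ 1} (hα : IsSmoothForm α)
    {τ : DForm I L ℝ 0} (hτ : IsSmoothForm τ) (x : L) (v : R3) (w : C3 × R1) :
    X.gMAt (f x, t₀) (covDeriv I X.gM (slice f t₀) (X.toNormal I f t₀ (α, τ)) x v : C3 × R1) w =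
      -X.covInner I f α x v (Complex.I • w.1) + formAt (extD τ) x ![v] * dtAt t₀ w.2 := by
  set S := sectionChart f t₀ (f x) (X.toNormal I f t₀ (α, τ)) with hS
  set y₀ := extChartAt I x x with hy₀
  have hu := I.uniqueDiffOn _ (mem_range_self (f := I) (chartAt H x x))
  have hmd : MDifferentiableAt I 𝓘(ℝ, C3 × R1) S x :=
    (he.contMDiffAt_sectionChart_toNormal hf hα hτ x).mdifferentiableAt (by simp)
  have hσ := ((he.contDiffWithinAt_sharpAlong hf hα x).differentiableWithinAt
    (by simp)).hasFDerivWithinAt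
  have hτ' := ((contDiffWithinAt_alternating_iff.1 (hτ.contDiffWithinAt x)
    ![]).differentiableWithinAt (by simp)).hasFDerivWithinAt
  have hev : S ∘ (extChartAt I x).symm =ᶠ[𝓝[range I] y₀] fun z =>
      (Complex.I • X.sharpAlong I f α x z, formInChart τ x z ![] • partialAt t₀) := by
    filter_upwards [eventually_mem_chart hf (mem_extChartAt_target x) (mem_chart_self f x)] with z hz
    exact sectionChart_toNormal hf hz.1 hz.2 α τ
  let A : R3 →L[ℝ] C3 × R1 := mfderiv I 𝓘(ℝ, C3 × R1) S x
  let Γ : C3 × R1 → C3 × R1 := fun a =>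
    christoffel (J := JM) X.gM (f x, t₀) a (secAt (X.toNormal I f t₀ (α, τ)) x)
  have h1 : A v = (Complex.I • fderivWithin ℝ (X.sharpAlong I f α x) (range I) y₀ v,
      formAt (extD τ) x ![v] • partialAt t₀) := by
    rw [formAt_extD_zero hτ]
    have h2 : A = fderivWithin ℝ (S ∘ (extChartAt I x).symm) (range I) y₀ := hmd.mfderiv
    rw [h2, hev.fderivWithin_eq_of_mem (mem_range_self _)]
    have h3 := (hσ.const_smul Complex.I).prodMk (hτ'.smul_const (partialAt t₀))
    exact congrArg (fun B : R3 →L[ℝ] C3 × R1 => B v) (h3.fderivWithin hu)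
  have h4 : (covDeriv I X.gM (slice f t₀) (X.toNormal I f t₀ (α, τ)) x v : C3 × R1) =
      A v + Γ (dfAt I f x v, 0) :=
    congrArg (fun a : C3 × R1 => A v + Γ a) (mfderiv_slice hf t₀ x v)
  have h5 : ∀ w : C3 × R1, X.gMAt (f x, t₀) (Γ (dfAt I f x v, 0)) w =
      koszul (X.dgAt f x) (dfAt I f x v) (Complex.I • dfAt I f x (X.sharpAt f α x)) w.1 :=
    fun w => X.gMAt_christoffel (f x) t₀ (dfAt I f x v) (secAt (X.toNormal I f t₀ (α, τ)) x) w
  -- `J` is constant in the chart, so it already commutes with the derivative part `h1`. The Kähler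
  -- identity does the same for the Christoffel part, and in both `J` moves to the test vector with
  -- a minus sign.
  have h6 : koszul (X.dgAt f x) (dfAt I f x v) (Complex.I • dfAt I f x (X.sharpAt f α x)) w.1 =
      -koszul (X.dgAt f x) (dfAt I f x v) (dfAt I f x (X.sharpAt f α x)) (Complex.I • w.1) :=
    X.koszul_gChart_I (f x) _ _ _
  refine (congrArg (fun a => X.gMAt (f x, t₀) a w) h4).trans ?_
  rw [map_add, LinearMap.add_apply, h1, h5, h6, gMAt_smul_I, covInner]
  ring

end Pointwise

end CalabiYau

/-! ### The antisymmetric part and the trace of the covariant derivative -/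

namespace CalabiYau

variable {N : Type*} [TopologicalSpace N] [ChartedSpace C3 N] [IsManifold 𝓘(ℂ, C3) ω N]
  {X : CalabiYau N}
  {H : Type*} [TopologicalSpace H] {I : ModelWithCorners ℝ R3 H}
  {L : Type*} [TopologicalSpace L] [ChartedSpace H L] {f : L → N} {t₀ : Circle}
  {e : ∀ x : L, Basis (Fin 3) ℝ (TangentSpace I x)}

theorem formInChart_hol_self (X : CalabiYau N) (p : N) :
    formInChart X.hol p (extChartAt 𝓘(ℝ, C3) p p) = X.holAt p :=
  formInChart_self X.hol p

section Pointwise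

variable [IsManifold I ∞ L]

/-- `extDerivWithin_inner_along` applies to `α = ⟨α^∨, df ·⟩`. Antisymmetrizing the Koszul
expression leaves exactly the derivatives of the metric found there. -/
theorem IsOrientedOrthonormal.formAt_extD_one (he : X.IsOrientedOrthonormal I f e)
    (hf : ContMDiff I 𝓘(ℝ, C3) ∞ f) {α : DForm I L ℝ 1} (hα : IsSmoothForm α) (x : L) (u v : R3) :
    formAt (extD α) x ![u, v] =
      X.covInner I f α x u (dfAt I f x v) - X.covInner I f α x v (dfAt I f x u) := by
  have hy := mem_extChartAt_target (I := I) x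
  have hyr : extChartAt I x x ∈ range I := mem_range_self _
  have hp := mem_chart_self (I := I) f x
  have hG := (X.contDiffAt_gChart (f x) (mem_extChartAt_target (f x))).differentiableAt
    (n := ∞) (by simp)
  rw [← inCharts_self (I := I) f x] at hG
  have h := extDerivWithin_inner_along (G := X.gChart (f x)) I.uniqueDiffOn
    hyr (I.range_subset_closure_interior hyr) (contDiffWithinAt_inCharts hy (hf _) hp)
    ((he.contDiffWithinAt_sharpAlong hf hα x).differentiableWithinAt (by simp)) hG
    ((hα.contDiffWithinAt x).differentiableWithinAt (by simp)) (by
      filter_upwards [eventually_mem_chart hf hy hp] with z hz v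
      rw [← he.sharpChart_spec hz.1, inducedChart_eq hf hz.1 hz.2]
      rfl) u v
  refine h.trans ?_
  rw [sharpAlong_self hf, fderivWithin_inCharts_self hf, fderivWithin_inCharts_self hf,
    inCharts_self, gChart_self, covInner, covInner]
  have hs : ∀ a b c, X.dgAt f x a b c = X.dgAt f x a c b := fun a b c =>
    X.fderiv_gChart_symm (f x) (mem_extChartAt_target _) a b c
  change X.dgAt f x _ _ _ + _ - (X.dgAt f x _ _ _ + _) = _
  simp only [koszul]
  rw [hs (dfAt I f x u) (dfAt I f x v), hs (dfAt I f x v) (dfAt I f x u),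
    hs (dfAt I f x (X.sharpAt f α x)) (dfAt I f x v)]
  ring

/-- The divergence formula for `α^∨`, obtained with the ambient connection by differentiating `Re
hol(α^∨, df ·, df ·)`. The derivative of `α^∨` gives the trace directly; the derivatives of `hol`
must account for the Christoffel terms. -/
theorem IsSpecialLagrangian.formAt_extD_star₁ (hf : X.IsSpecialLagrangian I f)
    (he : X.IsOrientedOrthonormal I f e) {α : DForm I L ℝ 1} (hα : IsSmoothForm α) (x : L) :
    formAt (extD (star₁ e α)) x ![frameAt e x 0, frameAt e x 1, frameAt e x 2] =
      ∑ i, X.covInner I f α x (frameAt e x i) (dfAt I f x (frameAt e x i)) := by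
  have hc := hf.embedding.contMDiff
  have hy := mem_extChartAt_target (I := I) x
  have hyr : extChartAt I x x ∈ range I := mem_range_self _
  have hp := mem_chart_self (I := I) f x
  have hyp := mem_extChartAt_target (I := 𝓘(ℝ, C3)) (f x)
  have hΨ := X.hasFDerivAt_reHol (f x) hyp
  have hΨd := hΨ.differentiableAt
  rw [← inCharts_self (I := I) f x] at hΨd
  have h := extDerivWithin_contract_along (Ψ := X.reHol (f x)) I.uniqueDiffOn
    hyr (I.range_subset_closure_interior hyr) (contDiffWithinAt_inCharts hy (hc _) hp)
    ((he.contDiffWithinAt_sharpAlong hc hα x).differentiableWithinAt (by simp)) hΨd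
    (((hf.star₁_smooth he hα).contDiffWithinAt x).differentiableWithinAt (by simp)) (by
      filter_upwards [eventually_mem_chart hc hy hp] with z hz v w
      rw [sharpAlong, hf.reHol_eq he hz.1 hz.2, symmD_sharpChart hz.1, ← he.star₁_apply,
        formInChart_one]
      congr 1
      funext i
      fin_cases i <;> rfl) (frameAt e x 0) (frameAt e x 1) (frameAt e x 2)
  refine h.trans ?_
  set E : Fin 3 → C3 := fun i => dfAt I f x (frameAt e x i) with hE
  set a := dfAt I f x (X.sharpAt f α x) with ha
  have hunit : IsUnitaryTriple (X.gAt (f x)) E := hf.unitary he x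
  have hG := X.isHermitianMetric_gAt (f x)
  have e1 : ∀ i, fderivWithin ℝ (inCharts I 𝓘(ℝ, C3) f x (f x)) (range I) (extChartAt I x x)
    (frameAt e x i) = E i := fun i => fderivWithin_inCharts_self hc x _
  have e2 : X.sharpAlong I f α x (extChartAt I x x) = a := sharpAlong_self hc α x
  have e3 : X.reHol (f x) (extChartAt 𝓘(ℝ, C3) (f x) (f x)) = reForm (X.holAt (f x)) := by
    rw [reHol, formInChart_hol_self X (f x)]
  set q := extChartAt 𝓘(ℝ, C3) (f x) (f x) with hq
  set dΨ := fderiv ℂ (formInChart X.hol (f x)) q with hdΨ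
  have e4 : ∀ b u, fderiv ℝ (X.reHol (f x)) q b u = (dΨ b u).re := fun b u => by
    rw [hΨ.fderiv]
    rfl
  have e5 : ∀ b, reForm (X.holAt (f x)) ![b, E 1, E 2] = X.gAt (f x) b (E 0) ∧
      reForm (X.holAt (f x)) ![b, E 0, E 2] = -X.gAt (f x) b (E 1) ∧
      reForm (X.holAt (f x)) ![b, E 0, E 1] = X.gAt (f x) b (E 2) := fun b => by
    simp only [reForm_apply, hunit.volume_apply hG (hf.holAt_frame he x),
      (isUnitaryTriple_iff hG).1 hunit]
    simp [sesq_re]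
  -- The three derivatives of `hol` along the frame combine into one derivative along `α^∨`.
  have e6 := alternating_holomorphic (e := hunit.basis hG) dΨ a
  rw [hunit.basis_apply hG] at e6
  -- The unit length of `hol` converts this derivative into half the trace of the derivative of the
  -- metric.
  have e7 : (dΨ a E).re = (∑ i, X.dgAt f x a (E i) (E i)) / 2 := by
    refine fderiv_volume_eq (G := X.gChart (f x))
      ((X.contDiffAt_gChart (f x) hyp).differentiableAt (by simp))
      (X.differentiableAt_hol (f x) hyp) ?_ ?_ (by rw [gChart_self]; exact hunit) ?_ a
    · filter_upwards [(isOpen_extChartAt_target (f x)).mem_nhds hyp] with z hz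
      exact X.isHermitianMetric_gChart (f x) hz
    · filter_upwards [(isOpen_extChartAt_target (f x)).mem_nhds hyp] with z hz u hu
      exact X.norm_hol (f x) hz u hu
    · rw [formInChart_hol_self X (f x)]
      exact hf.holAt_frame he x
  have e8 : (![E 0, E 1, E 2] : Fin 3 → C3) = E := by
    funext i
    fin_cases i <;> rfl
  have hs : ∀ a b c, X.dgAt f x a b c = X.dgAt f x a c b := fun a b c =>
    X.fderiv_gChart_symm (f x) (mem_extChartAt_target _) a b c
  have e9 := congrArg Complex.re e6
  rw [e8, e7, Complex.add_re, Complex.sub_re] at e9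
  rw [inCharts_self, e1, e1, e1, e2, e3, e4, e4, e4, (e5 _).1, (e5 _).2.1, (e5 _).2.2]
  -- In the trace of the Koszul expression the outer two terms cancel by symmetry of the metric,
  -- leaving the same half trace.
  simp only [covInner, koszul, Fin.sum_univ_three] at e9 ⊢
  rw [← ha]
  have k0 := hs (E 0) a (E 0)
  have k1 := hs (E 1) a (E 1)
  have k2 := hs (E 2) a (E 2)
  simp only [hE] at *
  linarith

end Pointwise

end CalabiYau

/-! ### The formula for the operator `D^∨` -/

section Linearity

variable {V : Type*} [NormedAddCommGroup V] [NormedSpace ℝ V] [FiniteDimensional ℝ V] {m k : ℕ}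

theorem hodgeStar_add (e : Basis (Fin (m + k)) ℝ V) (β β' : V [⋀^Fin k]→L[ℝ] ℝ) :
    hodgeStar e (β + β') = hodgeStar e β + hodgeStar e β' := by
  simp only [hodgeStar, ContinuousAlternatingMap.add_apply, add_smul, Finset.sum_add_distrib,
    smul_add]

theorem hodgeStar_neg (e : Basis (Fin (m + k)) ℝ V) (β : V [⋀^Fin k]→L[ℝ] ℝ) :
    hodgeStar e (-β) = -hodgeStar e β :=
  (AddMonoidHom.mk' (hodgeStar e) (hodgeStar_add e)).map_neg β

theorem hodgeStar_sub (e : Basis (Fin (m + k)) ℝ V) (β β' : V [⋀^Fin k]→L[ℝ] ℝ) :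
    hodgeStar e (β - β') = hodgeStar e β - hodgeStar e β' :=
  (AddMonoidHom.mk' (hodgeStar e) (hodgeStar_add e)).map_sub β β'

end Linearity

section StarLinearity

variable {H : Type*} [TopologicalSpace H] {I : ModelWithCorners ℝ R3 H}
  {L : Type*} [TopologicalSpace L] [ChartedSpace H L]
  {e : ∀ x : L, Basis (Fin 3) ℝ (TangentSpace I x)}

theorem star₁_sub (α α' : DForm I L ℝ 1) : star₁ e (α - α') = star₁ e α - star₁ e α' :=
  funext fun x => hodgeStar_sub (V := R3) (m := 2) (k := 1) (e x) (α x) (α' x)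

theorem star₁_neg (α : DForm I L ℝ 1) : star₁ e (-α) = -star₁ e α :=
  funext fun x => hodgeStar_neg (V := R3) (m := 2) (k := 1) (e x) (α x)

theorem star₂_neg (β : DForm I L ℝ 2) : star₂ e (-β) = -star₂ e β :=
  funext fun x => hodgeStar_neg (V := R3) (m := 1) (k := 2) (e x) (β x)

theorem star₃_neg (γ : DForm I L ℝ 3) : star₃ e (-γ) = -star₃ e γ :=
  funext fun x => hodgeStar_neg (V := R3) (m := 0) (k := 3) (e x) (γ x)

theorem star₁_star₂ (β : DForm I L ℝ 2) : star₁ e (star₂ e β) = β :=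
  funext fun x => hodgeStar_two_one (V := R3) (e x) (β x)

end StarLinearity

namespace CalabiYau

variable {N : Type*} [TopologicalSpace N] [ChartedSpace C3 N] [IsManifold 𝓘(ℂ, C3) ω N]
  {X : CalabiYau N}
  {H : Type*} [TopologicalSpace H] {I : ModelWithCorners ℝ R3 H}
  {L : Type*} [TopologicalSpace L] [ChartedSpace H L] {f : L → N} {t₀ : Circle}
  {e : ∀ x : L, Basis (Fin 3) ℝ (TangentSpace I x)}

theorem normalProj_eq (hf : ContMDiff I 𝓘(ℝ, C3) ∞ f) (x : L) (w : C3 × R1) :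
    (X.normalProj I f t₀ e x w : C3 × R1) = w - ∑ j, X.gAt (f x) w.1 (dfAt I f x (frameAt e x j)) •
      ((dfAt I f x (frameAt e x j), 0) : C3 × R1) := by
  let m : Fin 3 → C3 × R1 := fun j => mfderiv I JM (slice f t₀) x (e x j)
  have hm : m = fun j => (dfAt I f x (frameAt e x j), 0) :=
    funext fun j => mfderiv_slice hf t₀ x (e x j)
  have h : (X.normalProj I f t₀ e x w : C3 × R1) =
      w - ∑ j, X.gMAt (slice f t₀ x) w (m j) • m j := rfl
  rw [h, hm]
  simp only [gMAt_apply, map_zero, mul_zero, add_zero]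
  rfl

theorem gMAt_opD (hf : ContMDiff I 𝓘(ℝ, C3) ∞ f) (s : ∀ x : L, TangentSpace JM (slice f t₀ x))
    (x : L) (w : C3 × R1) : X.gMAt (f x, t₀) (X.opD I f t₀ e s x : C3 × R1) w =
      ∑ i, X.phi (f x, t₀) ((dfAt I f x (frameAt e x i), 0) : C3 × R1)
        (X.normalProj I f t₀ e x (covDeriv I X.gM (slice f t₀) s x (e x i)) : C3 × R1) w := by
  let c : (C3 × R1) → (C3 × R1) → C3 × R1 := fun u v => X.cross (f x, t₀) u v
  let n : Fin 3 → C3 × R1 := fun i =>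
    X.normalProj I f t₀ e x (covDeriv I X.gM (slice f t₀) s x (e x i))
  have h : (X.opD I f t₀ e s x : C3 × R1) =
      ∑ i, c (dfAt I f x (frameAt e x i), 0) (n i) := by
    have hm : (fun i => (mfderiv I JM (slice f t₀) x (e x i) : C3 × R1)) =
      fun j => (dfAt I f x (frameAt e x j), 0) := funext fun j => mfderiv_slice hf t₀ x (e x j)
    exact congrArg (fun m : Fin 3 → C3 × R1 => ∑ i, c (m i) (n i)) hm
  refine (congrArg (fun a => X.gMAt (f x, t₀) a w) h).trans ?_
  rw [map_sum, LinearMap.sum_apply]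
  exact Finset.sum_congr rfl fun i _ => X.gMAt_cross (f x, t₀) _ _ w

section Pointwise

variable [IsManifold I ∞ L]

/-- The two sides are compared by pairing with an arbitrary vector `w`, which replaces the cross
product by `φ`. -/
theorem IsSpecialLagrangian.opD_toNormal (hf : X.IsSpecialLagrangian I f)
    (he : X.IsOrientedOrthonormal I f e) {α : DForm I L ℝ 1} (hα : IsSmoothForm α)
    {τ : DForm I L ℝ 0} (hτ : IsSmoothForm τ) :
    X.opD I f t₀ e (X.toNormal I f t₀ (α, τ)) =
      X.toNormal I f t₀ (-star₂ e (extD α) - extD τ, star₃ e (extD (star₁ e α))) := by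
  have hc := hf.embedding.contMDiff
  funext x
  refine X.gMAt_ext (f x, t₀) fun w => (gMAt_opD hc _ x w).trans ?_
  have hG := X.isHermitianMetric_gAt (f x)
  set E : Fin 3 → C3 := fun i => dfAt I f x (frameAt e x i) with hE
  have hunit : IsUnitaryTriple (X.gAt (f x)) E := hf.unitary he x
  -- All of the first-order information needed is in this matrix and in the components `T` of `dτ`.
  set c : Fin 3 → Fin 3 → ℝ := fun i j => X.covInner I f α x (frameAt e x i) (E j) with hcdef
  set T : Fin 3 → ℝ := fun i => formAt (extD τ) x ![frameAt e x i] with hT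
  let Ds : Fin 3 → C3 × R1 := fun i =>
    covDeriv I X.gM (slice f t₀) (X.toNormal I f t₀ (α, τ)) x (e x i)
  let n : Fin 3 → C3 × R1 := fun i => X.normalProj I f t₀ e x (Ds i)
  have hII : ∀ u : C3, Complex.I • Complex.I • u = -u := fun u => by
    rw [smul_smul, Complex.I_mul_I, neg_one_smul]
  have hs : ∀ i w, X.gMAt (f x, t₀) (Ds i) w =
      -X.covInner I f α x (frameAt e x i) (Complex.I • w.1) + T i * dtAt t₀ w.2 := fun i w =>
    he.gMAt_covDeriv hc hα hτ x (frameAt e x i) w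
  have hs1 : ∀ i j, X.gAt (f x) (Ds i).1 (Complex.I • E j) = c i j := fun i j => by
    have h := hs i (Complex.I • E j, 0)
    rw [gMAt_apply, map_zero, mul_zero, mul_zero, add_zero, add_zero] at h
    refine h.trans ?_
    simp only [hII, hcdef, covInner, koszul, map_neg, neg_apply]
    ring
  have hs2 : ∀ i, dtAt t₀ (Ds i).2 = T i := fun i => by
    have h := hs i (0, partialAt t₀)
    simp only [gMAt_apply, map_zero, dtAt_partialAt, smul_zero, covInner, koszul] at h
    simpa using h
  have hn : ∀ i, n i = Ds i - ∑ j, X.gAt (f x) (Ds i).1 (E j) • ((E j, 0) : C3 × R1) := fun i =>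
    normalProj_eq hc x (Ds i)
  have hn1 : ∀ i, (n i).1 = (Ds i).1 - ∑ j, X.gAt (f x) (Ds i).1 (E j) • E j := fun i => by
    rw [hn, Prod.fst_sub, Prod.fst_sum]
    rfl
  have hn2 : ∀ i, dtAt t₀ (n i).2 = T i := fun i => by
    rw [hn, Prod.snd_sub, Prod.snd_sum, ← hs2]
    simp
  have hEI : ∀ i j, X.gAt (f x) (E i) (Complex.I • E j) = 0 := fun i j => hf.kah_df x _ _
  -- Normal projection removes the real parts of the unitary coordinates of the covariant derivative
  -- and keeps the imaginary parts `c i j`.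
  have hsesq : ∀ i j, sesq (X.gAt (f x)) (n i).1 (E j) = Complex.I * (c i j : ℂ) := fun i j => by
    have h1 : X.gAt (f x) (n i).1 (E j) = 0 := by
      rw [hn1]
      simp [hunit.inner]
    have h2 : X.gAt (f x) (n i).1 (Complex.I • E j) = c i j := by
      rw [hn1, ← hs1]
      simp [hEI]
    rw [sesq, h1, h2, Complex.ofReal_zero, zero_add]
  -- Of the three `kah ∧ dt` terms, one gives the diagonal of `c`, one gives `dτ`, and the third
  -- vanishes because the tangent vectors have no circle component.
  have hphi : ∀ i, X.phi (f x, t₀) ((E i, 0) : C3 × R1) (n i) w =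
      c i i * dtAt t₀ w.2 + (X.holAt (f x) ![E i, (n i).1, w.1]).re
        - T i * X.gAt (f x) w.1 (Complex.I • E i) := fun i => by
    have h1 : X.gAt (f x) (Complex.I • E i) (n i).1 = c i i := by
      rw [hG.symm, ← sesq_im, hsesq]
      simp
    rw [phi_eq]
    simp only [map_zero, mul_zero, add_zero]
    rw [h1, hn2, hG.skew w.1]
    ring
  refine (Finset.sum_congr rfl fun i _ => hphi i).trans ?_
  rw [Finset.sum_sub_distrib, Finset.sum_add_distrib,
    sum_volume_frame hG hunit (hf.holAt_frame he x) hsesq]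
  set α' : DForm I L ℝ 1 := -star₂ e (extD α) - extD τ with hα'
  set τ' : DForm I L ℝ 0 := star₃ e (extD (star₁ e α)) with hτ'
  have hτx : formAt τ' x ![] = ∑ i, c i i := by
    refine Eq.trans ?_ (hf.formAt_extD_star₁ he hα x)
    exact hodgeStar_three_apply (frameAt e x) (formAt (extD (star₁ e α)) x) ![]
  have hst : ∀ k, formAt α' x ![frameAt e x k] =
      -hodgeStar (m := 1) (k := 2) (frameAt e x) (formAt (extD α) x) ![frameAt e x k] - T k :=
    fun k => rfl
  have hsharp : dfAt I f x (X.sharpAt f α' x) = ∑ k, formAt α' x ![frameAt e x k] • E k := by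
    conv_lhs => rw [← (frameAt e x).sum_repr (X.sharpAt f α' x)]
    simp only [map_sum, map_smul, he.sharp_repr, hE]
  -- The combinations `c i j - c j i` left by `Re hol` are thus the components of `dα`, and `*`
  -- places each on the complementary index.
  have hd : ∀ i j, formAt (extD α) x ![frameAt e x i, frameAt e x j] = c i j - c j i :=
    fun i j => he.formAt_extD_one hc hα x _ _
  have hfin : X.gMAt (f x, t₀) (X.toNormal I f t₀ (α', τ') x : C3 × R1) w =
      -X.gAt (f x) (dfAt I f x (X.sharpAt f α' x)) (Complex.I • w.1) +
        formAt τ' x ![] * dtAt t₀ w.2 :=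
    gMAt_smul_I (f x) t₀ (dfAt I f x (X.sharpAt f α' x)) (formAt τ' x ![]) w
  have hsym : ∀ k, X.gAt (f x) w.1 (Complex.I • E k) = -X.gAt (f x) (E k) (Complex.I • w.1) :=
    fun k => by rw [hG.symm, hG.skew]
  refine Eq.trans ?_ hfin.symm
  rw [hsharp, hτx]
  simp only [hst, hodgeStar_two_apply, hd, hsym, Fin.sum_univ_three, Basis.repr_self, map_add,
    map_smul, add_apply, smul_apply, smul_eq_mul]
  simp
  ring

theorem IsSpecialLagrangian.opDvee_eq (hf : X.IsSpecialLagrangian I f)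
    (he : X.IsOrientedOrthonormal I f e) {α : DForm I L ℝ 1} (hα : IsSmoothForm α)
    {τ : DForm I L ℝ 0} (hτ : IsSmoothForm τ) :
    X.opDvee I f t₀ e (α, τ) = (-star₂ e (extD α) - extD τ, star₃ e (extD (star₁ e α))) := by
  rw [opDvee, hf.opD_toNormal he hα hτ, he.toForms_toNormal]

/-- The mixed terms are `*ddτ` and `*d**dα = *ddα`, both zero. Smoothness of the stars of smooth
forms is needed because `extD` is additive only on such forms. -/
theorem IsSpecialLagrangian.opDvee_opDvee (hf : X.IsSpecialLagrangian I f)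
    (he : X.IsOrientedOrthonormal I f e) {α : DForm I L ℝ 1} (hα : IsSmoothForm α)
    {τ : DForm I L ℝ 0} (hτ : IsSmoothForm τ) :
    X.opDvee I f t₀ e (X.opDvee I f t₀ e (α, τ)) =
      (star₂ e (extD (star₂ e (extD α))) - extD (star₃ e (extD (star₁ e α))),
        -star₃ e (extD (star₁ e (extD τ)))) := by
  have h1 := hf.star₂_smooth he hα.extD
  have h2 := hf.star₃_smooth he (hf.star₁_smooth he hα).extD
  have h3 : extD (-star₂ e (extD α) - extD τ) = -extD (star₂ e (extD α)) := by
    rw [extD_sub h1.neg hτ.extD, extD_neg, extD_extD hτ, sub_zero]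
  have h4 : extD (star₁ e (-star₂ e (extD α) - extD τ)) = -extD (star₁ e (extD τ)) := by
    rw [star₁_sub, star₁_neg, star₁_star₂, extD_sub hα.extD.neg (hf.star₁_smooth he hτ.extD),
      extD_neg, extD_extD hα, neg_zero, zero_sub]
  rw [hf.opDvee_eq he hα hτ, hf.opDvee_eq he (h1.neg.sub hτ.extD) h2, h3, h4, star₂_neg, star₃_neg,
    neg_neg]

end Pointwise

end CalabiYau

end SpecialLagrangianDirac

end

/-! ### The main theorem -/

open SpecialLagrangianDirac in
theorem mainTheorem9 {N : Type*} [TopologicalSpace N] [ChartedSpace C3 N]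
    [IsManifold 𝓘(ℂ, C3) ω N] (X : CalabiYau N)
    {H : Type*} [TopologicalSpace H] (I : ModelWithCorners ℝ R3 H)
    {L : Type*} [TopologicalSpace L] [ChartedSpace H L] [IsManifold I ∞ L]
    (f : L → N) (hf : X.IsSpecialLagrangian I f) (t₀ : Circle)
    (e : ∀ x : L, Module.Basis (Fin 3) ℝ (TangentSpace I x))
    (he : X.IsOrientedOrthonormal I f e) :
    Set.BijOn (X.toNormal I f t₀) {p | IsSmoothForm p.1 ∧ IsSmoothForm p.2}
        {s | X.IsNormalSection I f t₀ s} ∧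
      ∀ (α : DForm I L ℝ 1) (τ : DForm I L ℝ 0), IsSmoothForm α → IsSmoothForm τ →
        X.opD I f t₀ e (X.toNormal I f t₀ (α, τ)) = X.toNormal I f t₀ (X.opDvee I f t₀ e (α, τ)) ∧
        X.opDvee I f t₀ e (α, τ) = (-star₂ e (extD α) - extD τ, star₃ e (extD (star₁ e α))) ∧
        IsSmoothForm (X.opDvee I f t₀ e (α, τ)).1 ∧ IsSmoothForm (X.opDvee I f t₀ e (α, τ)).2 ∧
        X.opDvee I f t₀ e (X.opDvee I f t₀ e (α, τ)) = -lap e (α, τ) ∧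
        X.opDvee I f t₀ e (X.opDvee I f t₀ e (α, τ)) = hodgeLap e (α, τ) := by
  refine ⟨hf.bijOn_toNormal he, fun α τ hα hτ => ?_⟩
  have hD := hf.opDvee_eq (t₀ := t₀) he hα hτ
  refine ⟨by rw [hD, hf.opD_toNormal he hα hτ], hD, ?_, ?_, ?_, ?_⟩
  · rw [hD]
    exact (hf.star₂_smooth he hα.extD).neg.sub hτ.extD
  · rw [hD]
    exact hf.star₃_smooth he (hf.star₁_smooth he hα).extD
  -- The sign `(-1)^(3p+1)` is `1` for `p = 1` and `-1` for `p = 2`.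
  · rw [hf.opDvee_opDvee he hα hτ, lap, dStar₂, dStar₁, dStar₁]
    refine Prod.ext ?_ ?_
    · norm_num
      abel
    · norm_num
  -- The codifferential has the opposite signs, `-1` for `p = 1` and `1` for `p = 2`, so the square
  -- is the nonnegative Laplacian.
  · rw [hf.opDvee_opDvee he hα hτ, hodgeLap, codiff₂, codiff₁, codiff₁]
    refine Prod.ext ?_ ?_
    · norm_num [extD_neg]
      abel
    · norm_num
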